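/- **Setting.** Let $d\ge 0$, let $\ell\ge 2$ be even, let $S\in\{\tfrac12,1,\tfrac32,\dots\}$ and $0<\beta<\infty$. Let $\Lambda_\ell=\{0,1,\dots,\ell-1\}^d$ and $\Lambda_\ell^*=\tfrac{2\pi}{\ell}\{-\tfrac\ell2+1,\dots,\tfrac\ell2\}^d$. On $\bigotimes_{x\in\Lambda_\ell}\mathbb C^{2S+1}$ let $S_x^{(1)},S_x^{(2)},S_x^{(3)}$ be the standard spin-$S$ operators at the site $x$. **Couplings.** The *basic interactions* on $\mathbb Z^d$ are the following functions of $x$: - nearest neighbour: $a\,1_{\|x\|_1=1}$ with $a\ge0$; - Yukawa: $a\,e^{-b\|x\|_1}$ with $a\ge0$, $b>0$; - power law in the $\ell^1$ norm: $a\|x\|_1^{-s}$ for $x\ne0$ and $0$ at $x=0$, with $a\ge0$, $s>d$; - random walk: $c\sum_{w:0\to x}\bigl(\tfrac{\lambda}{2d}\bigr)^{|w|}$ with $c\ge0$, $\lambda\in[0,1)$, where the sum is over all nearest-neighbour walks $w$ from $0$ to $x$ on $\tfrac1m\mathbb Z^d$, for some integer $m\ge1$, and $|w|$ is the number of steps;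 - power law in the Euclidean norm: $a\|x\|_2^{-s}$ for $x\neq0$ and $0$ at $x=0$, with $a\ge0$, $s>d$. Let $J^{(1)},J^{(2)},J^{(3)}:\mathbb Z^d\to\mathbb R$ be such that each of $J^{(1)}$, $-J^{(2)}$, $J^{(3)}$ is a (finite) convex combination of basic interactions (types and parameters may differ for the three). Assume that $$J^{(3)}_x\ge J^{(1)}_x\ge -J^{(2)}_x\ge0\qquad\text{for all }x\in\mathbb Z^d,$$ and that $J^{(3)}_x\neq0$ for some $x\ne0$. Let $J^{(i)}_{x,\mathrm{per}}=\sum_{z\in\mathbb Z^d}J^{(i)}_{x+\ell z}$ and $$H=-\sum_{i=1}^3\sum_{x,y\in\Lambda_\ell}J^{(i)}_{x-y,\mathrm{per}}\,S_x^{(i)}S_y^{(i)},\qquad \langle A\rangle=\frac{\operatorname{Tr}A\,e^{-\beta H}}{\operatorname{Tr}e^{-\beta H}} .$$ For $k\in\Lambda_\ell^*$ write $$\widehat{\langle S_0^{(3)}S_x^{(3)}\rangle}(k)=\sum_{x\in\Lambda_\ell}e^{-ikx}\langle S_0^{(3)}S_x^{(3)}\rangle,\qquad \varepsilon(k)=\sum_{x\in\Lambda_\ell}J^{(3)}_{x,\mathrm{per}}(1-\cos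 kx),$$ $$e(k)=\tfrac12\sum_{x\in\Lambda_\ell}\Bigl(\bigl(J^{(1)}_{x,\mathrm{per}}-J^{(2)}_{x,\mathrm{per}}\cos kx\bigr)\langle S_0^{(1)}S_x^{(1)}\rangle+\bigl(J^{(2)}_{x,\mathrm{per}}-J^{(1)}_{x,\mathrm{per}}\cos kx\bigr)\langle S_0^{(2)}S_x^{(2)}\rangle\Bigr).$$ **Lemma (infrared bound for the usual correlation function).** For all $k\in\Lambda_\ell^*\setminus\{0\}$ we have $\varepsilon(k)>0$, $e(k)$ is real with $e(k)\ge0$, the Fourier transform $\widehat{\langle S_0^{(3)}S_x^{(3)}\rangle}(k)$ is real, and $$\widehat{\langle S_0^{(3)}S_x^{(3)}\rangle}(k)\le\sqrt{\frac{e(k)}{2\varepsilon(k)}}+\frac1{2\beta\,\varepsilon(k)} .$$ -/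

import Mathlib

/-!
Quantum spin systems on the discrete torus `{0, …, ℓ-1}^d`, spin `S = N / 2`.
Spin directions `1, 2, 3` are the elements `0, 1, 2` of `Fin 3`.
-/

noncomputable section

namespace QSpin

open Complex

/-! ### Coupling parameters on `ℤ^d` -/

/-- The `ℓ¹` norm on `ℤ^d`. -/
def norm1 {d : ℕ} (x : Fin d → ℤ) : ℝ := ∑ j, |(x j : ℝ)|

/-- The Euclidean norm on `ℤ^d`. -/
def norm2 {d : ℕ} (x : Fin d → ℤ) : ℝ := Real.sqrt (∑ j, (x j : ℝ) ^ 2)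

/-- Nearest-neighbour coupling. -/
def nearestNeighbour (d : ℕ) (a : ℝ) (x : Fin d → ℤ) : ℝ :=
  if norm1 x = 1 then a else 0

/-- Yukawa coupling `a exp (-b ‖x‖₁)`. -/
def yukawa (d : ℕ) (a b : ℝ) (x : Fin d → ℤ) : ℝ :=
  a * Real.exp (-b * norm1 x)

/-- Power law `a ‖x‖₁^(-s)` for `x ≠ 0`; no self-interaction. -/
def powerLaw1 (d : ℕ) (a s : ℝ) (x : Fin d → ℤ) : ℝ :=
  if x = 0 then 0 else a * norm1 x ^ (-s)

/-- Power law `a ‖x‖₂^(-s)` for `x ≠ 0`; no self-interaction. -/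
def powerLaw2 (d : ℕ) (a s : ℝ) (x : Fin d → ℤ) : ℝ :=
  if x = 0 then 0 else a * norm2 x ^ (-s)

/-- The `2d` nearest-neighbour steps `± e_j`. -/
def step {d : ℕ} (p : Fin d × Bool) : Fin d → ℤ :=
  if p.2 then Pi.single p.1 1 else -Pi.single p.1 1

/-- The number of nearest-neighbour walks on `ℤ^d` with `n` steps from `0` to `x`
(a walk is given by its successive steps). -/
def walkCount {d : ℕ} (n : ℕ) (x : Fin d → ℤ) : ℕ :=
  Fintype.card {w : Fin n → Fin d × Bool // ∑ t, step (w t) = x}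

/-- `c ∑_{w : 0 → x} (lam / 2d)^{|w|}`, the sum over all nearest-neighbour walks from `0` to `x`
on the lattice `(1/m) ℤ^d`; after scaling by `m` these are the walks on `ℤ^d` from `0` to `m x`. -/
def randomWalk (d : ℕ) (m : ℕ) (c lam : ℝ) (x : Fin d → ℤ) : ℝ :=
  c * ∑' n : ℕ, (lam / (2 * d)) ^ n * (walkCount n ((m : ℤ) • x) : ℝ)

/-- The basic interactions, with nonnegative amplitude. -/
def basicCouplings (d : ℕ) : Set ((Fin d → ℤ) → ℝ) :=
  {J | (∃ a : ℝ, 0 ≤ a ∧ J = nearestNeighbour d a) ∨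
    (∃ a b : ℝ, 0 ≤ a ∧ 0 < b ∧ J = yukawa d a b) ∨
    (∃ a s : ℝ, 0 ≤ a ∧ (d : ℝ) < s ∧ J = powerLaw1 d a s) ∨
    (∃ (m : ℕ) (c lam : ℝ), 1 ≤ m ∧ 0 ≤ c ∧ 0 ≤ lam ∧ lam < 1 ∧ J = randomWalk d m c lam) ∨
    (∃ a s : ℝ, 0 ≤ a ∧ (d : ℝ) < s ∧ J = powerLaw2 d a s)}

/-- The admissible triples of couplings: `J¹`, `-J²`, `J³` are convex combinations of basic
interactions, and `J³ ≥ J¹ ≥ -J² ≥ 0` pointwise. -/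
structure Admissible {d : ℕ} (J : Fin 3 → (Fin d → ℤ) → ℝ) : Prop where
  mem_one : J 0 ∈ convexHull ℝ (basicCouplings d)
  mem_two : -J 1 ∈ convexHull ℝ (basicCouplings d)
  mem_three : J 2 ∈ convexHull ℝ (basicCouplings d)
  one_le_three : ∀ x, J 0 x ≤ J 2 x
  neg_two_le_one : ∀ x, -J 1 x ≤ J 0 x
  neg_two_nonneg : ∀ x, 0 ≤ -J 1 x

/-! ### The box with periodic couplings, and its dual -/

/-- The box `{0, …, ℓ-1}^d`. -/
abbrev Box (d ℓ : ℕ) : Type := Fin d → Fin ℓ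

/-- The inclusion of the box in `ℤ^d`. -/
def pos {d ℓ : ℕ} (x : Box d ℓ) : Fin d → ℤ := fun j => ((x j : ℕ) : ℤ)

/-- The periodised coupling `∑_{z ∈ ℤ^d} J (x + ℓ z)`. -/
def periodise {d : ℕ} (ℓ : ℕ) (J : (Fin d → ℤ) → ℝ) (x : Fin d → ℤ) : ℝ :=
  ∑' z : Fin d → ℤ, J (x + (ℓ : ℤ) • z)

/-- The dual box `(2π/ℓ) {-ℓ/2 + 1, …, ℓ/2}^d`. -/
def dualBox (d ℓ : ℕ) : Set (Fin d → ℝ) :=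
  {k | ∃ m : Fin d → ℤ, ∀ j, -(ℓ : ℝ) / 2 + 1 ≤ m j ∧ (m j : ℝ) ≤ ℓ / 2 ∧
    k j = 2 * Real.pi / ℓ * m j}

/-- The inner product `k · x`. -/
def dot {d : ℕ} (k : Fin d → ℝ) (x : Fin d → ℤ) : ℝ := ∑ j, k j * x j

/-- The Fourier transform on the box. -/
def fourier {d ℓ : ℕ} (f : Box d ℓ → ℂ) (k : Fin d → ℝ) : ℂ :=
  ∑ x, Complex.exp (-I * (dot k (pos x) : ℂ)) * f x

/-! ### Spin operators -/

/-- The eigenvalue `S - a` of the third spin operator at the basis vector `a`, with `S = N / 2`. -/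
def weight {N : ℕ} (a : Fin (N + 1)) : ℝ := (N : ℝ) / 2 - (a : ℕ)

/-- Raising operator `|m⟩ ↦ √(S(S+1) - m(m+1)) |m+1⟩`; the basis vector `a` has `m = S - a`. -/
def raising (N : ℕ) : Matrix (Fin (N + 1)) (Fin (N + 1)) ℂ :=
  Matrix.of fun a b => if (b : ℕ) = a + 1 then
    (Real.sqrt ((N : ℝ) / 2 * ((N : ℝ) / 2 + 1) - weight b * (weight b + 1)) : ℂ) else 0

/-- Lowering operator `|m⟩ ↦ √(S(S+1) - (m-1)m) |m-1⟩`. -/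
def lowering (N : ℕ) : Matrix (Fin (N + 1)) (Fin (N + 1)) ℂ :=
  Matrix.of fun a b => if (a : ℕ) = b + 1 then
    (Real.sqrt ((N : ℝ) / 2 * ((N : ℝ) / 2 + 1) - (weight b - 1) * weight b) : ℂ) else 0

/-- The three spin operators on `ℂ^(2S+1)`, `2S = N`. -/
def spinMatrix (N : ℕ) (i : Fin 3) : Matrix (Fin (N + 1)) (Fin (N + 1)) ℂ :=
  ![(1 / 2 : ℂ) • (raising N + lowering N),
    (1 / (2 * I) : ℂ) • (raising N - lowering N),
    Matrix.diagonal fun a => (weight a : ℂ)] i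

/-- Classical configurations; they index the standard basis of `⊗_{x} ℂ^(2S+1)`. -/
abbrev Config (d ℓ N : ℕ) : Type := Box d ℓ → Fin (N + 1)

/-- Operators on `⊗_{x} ℂ^(2S+1)`, as matrices in the standard basis. -/
abbrev Op (d ℓ N : ℕ) : Type := Matrix (Config d ℓ N) (Config d ℓ N) ℂ

/-- The spin operator `S_x^i`, i.e. `spinMatrix N i` at the site `x` tensored with the identity
at the other sites. -/
def spin {d ℓ : ℕ} (N : ℕ) (i : Fin 3) (x : Box d ℓ) : Op d ℓ N :=
  Matrix.of fun σ τ => if ∀ y, y ≠ x → σ y = τ y then spinMatrix N i (σ x) (τ x) else 0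

/-- The Hamiltonian with periodised couplings, at zero external field. -/
def hamiltonian {d : ℕ} (ℓ N : ℕ) (J : Fin 3 → (Fin d → ℤ) → ℝ) : Op d ℓ N :=
  -∑ i : Fin 3, ∑ x : Box d ℓ, ∑ y : Box d ℓ,
    (periodise ℓ (J i) (pos x - pos y) : ℂ) • (spin N i x * spin N i y)

/-- The Gibbs state `⟨A⟩ = Tr (A exp (-β H)) / Tr exp (-β H)`. -/
def gibbs {d : ℕ} (ℓ N : ℕ) (J : Fin 3 → (Fin d → ℤ) → ℝ) (β : ℝ) (A : Op d ℓ N) : ℂ :=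
  (A * NormedSpace.exp (-(β : ℂ) • hamiltonian ℓ N J)).trace /
    (NormedSpace.exp (-(β : ℂ) • hamiltonian ℓ N J)).trace

/-- The correlation function `x ↦ ⟨S_0^i S_x^i⟩`. -/
def corr {d : ℕ} (ℓ N : ℕ) [NeZero ℓ] (J : Fin 3 → (Fin d → ℤ) → ℝ) (β : ℝ) (i : Fin 3)
    (x : Box d ℓ) : ℂ :=
  gibbs ℓ N J β (spin N i 0 * spin N i x)

/-! ### The functions `ε` and `e` -/

/-- `ε(k) = ∑_x J³_per(x) (1 - cos kx)`. -/
def eps {d : ℕ} (ℓ : ℕ) (J : Fin 3 → (Fin d → ℤ) → ℝ) (k : Fin d → ℝ) : ℝ :=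
  ∑ x : Box d ℓ, periodise ℓ (J 2) (pos x) * (1 - Real.cos (dot k (pos x)))

/-- `e(k) = ½ ∑_x ((J¹_per - J²_per cos kx) ⟨S_0¹ S_x¹⟩ + (J²_per - J¹_per cos kx) ⟨S_0² S_x²⟩)`. -/
def eFun {d : ℕ} (ℓ N : ℕ) [NeZero ℓ] (J : Fin 3 → (Fin d → ℤ) → ℝ) (β : ℝ)
    (k : Fin d → ℝ) : ℂ :=
  1 / 2 * ∑ x : Box d ℓ,
    (((periodise ℓ (J 0) (pos x) -
        periodise ℓ (J 1) (pos x) * Real.cos (dot k (pos x)) : ℝ) : ℂ) * corr ℓ N J β 0 x +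
      ((periodise ℓ (J 1) (pos x) -
        periodise ℓ (J 0) (pos x) * Real.cos (dot k (pos x)) : ℝ) : ℂ) * corr ℓ N J β 1 x)

end QSpin

end

section


set_option linter.unusedSectionVars false

open scoped Matrix.Norms.Operator
open NormedSpace Filter Topology

section BanachExp

variable {𝔸 : Type*} [NormedRing 𝔸] [NormedAlgebra ℝ 𝔸] [CompleteSpace 𝔸]

theorem exp_add_smul_eq (X Y : 𝔸) (t : ℝ) :
    exp (X + t • Y) = exp X +
      t • ((∫ s in (0 : ℝ)..1, exp (s • (X + t • Y)) * Y * exp (-(s • X))) * exp X) := by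
  let _ : NormedAlgebra ℚ 𝔸 := NormedAlgebra.restrictScalars ℚ ℝ 𝔸
  have hcont : Continuous (exp : 𝔸 → 𝔸) := exp_continuous
  have hder : ∀ s : ℝ, HasDerivAt (fun s : ℝ => exp (s • (X + t • Y)) * exp (-(s • X)))
      (t • (exp (s • (X + t • Y)) * Y * exp (-(s • X)))) s := by
    intro s
    have h1 := hasDerivAt_exp_smul_const (𝕂 := ℝ) (X + t • Y) s
    have h2 := hasDerivAt_exp_smul_const' (𝕂 := ℝ) (-X) s
    have h3 := h1.mul h2
    simp only [← smul_neg]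
    refine h3.congr_deriv ?_
    simp only [mul_add, add_mul, mul_neg, neg_mul, mul_assoc, smul_mul_assoc, mul_smul_comm]
    abel
  have hint := intervalIntegral.integral_eq_sub_of_hasDerivAt (a := 0) (b := 1)
    (fun s _ => hder s) (by
      apply Continuous.intervalIntegrable
      fun_prop)
  rw [intervalIntegral.integral_smul] at hint
  simp only [one_smul, zero_smul, neg_zero, exp_zero, mul_one] at hint
  rw [← smul_mul_assoc, hint, sub_mul, mul_assoc, ← exp_add_of_commute]
  · simp
  · exact (Commute.refl X).neg_left

theorem hasDerivAt_exp_add_smul (X Y : 𝔸) :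
    HasDerivAt (fun t : ℝ => exp (X + t • Y))
      ((∫ s in (0 : ℝ)..1, exp (s • X) * Y * exp (-(s • X))) * exp X) 0 := by
  let _ : NormedAlgebra ℚ 𝔸 := NormedAlgebra.restrictScalars ℚ ℝ 𝔸
  have hcont : Continuous (exp : 𝔸 → 𝔸) := exp_continuous
  set Φ : ℝ → 𝔸 := fun t =>
    (∫ s in (0 : ℝ)..1, exp (s • (X + t • Y)) * Y * exp (-(s • X))) * exp X with hΦ
  have hΦc : Continuous Φ := by
    refine Continuous.mul ?_ continuous_const
    apply intervalIntegral.continuous_parametric_intervalIntegral_of_continuous'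
    fun_prop
  have h0 : (∫ s in (0 : ℝ)..1, exp (s • X) * Y * exp (-(s • X))) * exp X = Φ 0 := by
    simp [hΦ]
  rw [h0, hasDerivAt_iff_tendsto_slope]
  refine ((hΦc.tendsto 0).mono_left nhdsWithin_le_nhds).congr' ?_
  filter_upwards [self_mem_nhdsWithin] with t ht
  have ht : t ≠ 0 := ht
  rw [slope_def_module, exp_add_smul_eq X Y t]
  simp [hΦ, smul_smul, ht]

theorem hasDerivAt_map_exp_add_smul (φ : 𝔸 →L[ℝ] ℝ) (X Y : 𝔸) :
    HasDerivAt (fun t : ℝ => φ (exp (X + t • Y)))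
      (∫ s in (0 : ℝ)..1, φ (exp (s • X) * Y * exp (-(s • X)) * exp X)) 0 := by
  let _ : NormedAlgebra ℚ 𝔸 := NormedAlgebra.restrictScalars ℚ ℝ 𝔸
  have hcont : Continuous (exp : 𝔸 → 𝔸) := exp_continuous
  have h := φ.hasFDerivAt.comp_hasDerivAt 0 (hasDerivAt_exp_add_smul X Y)
  refine h.congr_deriv ?_
  have e1 : ∀ M : 𝔸, φ (M * exp X) = (φ.comp ((ContinuousLinearMap.mul ℝ 𝔸).flip (exp X))) M :=
    fun M => by simp
  simp only [e1]
  rw [← ContinuousLinearMap.intervalIntegral_comp_comm]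
  apply Continuous.intervalIntegrable
  fun_prop

theorem norm_exp_le_exp_norm [NormOneClass 𝔸] (x : 𝔸) : ‖exp x‖ ≤ Real.exp ‖x‖ := by
  have h := exp_series_hasSum_exp' (𝕂 := ℝ) x
  have h2 := exp_series_hasSum_exp' (𝕂 := ℝ) ‖x‖
  rw [← h.tsum_eq, Real.exp_eq_exp_ℝ]
  refine tsum_of_norm_bounded h2 fun n => ?_
  rw [norm_smul, Real.norm_of_nonneg (by positivity), smul_eq_mul]
  gcongr
  exact norm_pow_le x n

theorem norm_pow_sub_pow_le (a b : 𝔸) (r : ℝ) (ha : ‖a‖ ≤ r) (hb : ‖b‖ ≤ r) (n : ℕ) :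
    ‖a ^ (n + 1) - b ^ (n + 1)‖ ≤ (n + 1) * r ^ n * ‖a - b‖ := by
  have hr : 0 ≤ r := (norm_nonneg a).trans ha
  induction n with
  | zero => simp
  | succ n ih =>
    have : a ^ (n + 1 + 1) - b ^ (n + 1 + 1) =
        a ^ (n + 1) * (a - b) + (a ^ (n + 1) - b ^ (n + 1)) * b := by
      rw [pow_succ a, pow_succ b]; noncomm_ring
    rw [this]
    have h1 : ‖a ^ (n + 1)‖ ≤ r ^ (n + 1) :=
      (norm_pow_le' a n.succ_pos).trans (pow_le_pow_left₀ (norm_nonneg _) ha _)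
    calc _ ≤ ‖a ^ (n + 1)‖ * ‖a - b‖ + ‖a ^ (n + 1) - b ^ (n + 1)‖ * ‖b‖ :=
          (norm_add_le _ _).trans (add_le_add (norm_mul_le _ _) (norm_mul_le _ _))
      _ ≤ r ^ (n + 1) * ‖a - b‖ + ((n + 1) * r ^ n * ‖a - b‖) * r := by gcongr
      _ = _ := by push_cast; ring

/-- A Trotter type limit: `(1 + T / n + U / n ^ 2) ^ n → exp T`. -/
theorem tendsto_one_add_pow_exp [NormOneClass 𝔸] (T U : 𝔸) :
    Tendsto (fun n : ℕ => (1 + ((n : ℝ) + 1)⁻¹ • T + (((n : ℝ) + 1)⁻¹) ^ 2 • U) ^ (n + 1)) atTop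
      (𝓝 (exp T)) := by
  let _ : NormedAlgebra ℚ 𝔸 := NormedAlgebra.restrictScalars ℚ ℝ 𝔸
  have hlim : Tendsto (fun n : ℕ => ((n : ℝ) + 1)⁻¹) atTop (𝓝 0) := by
    simpa using tendsto_one_div_add_atTop_nhds_zero_nat (𝕜 := ℝ)
  have hd : HasDerivAt (fun t : ℝ => exp (t • T)) T 0 := by
    simpa using hasDerivAt_exp_smul_const (𝕂 := ℝ) T 0
  have hd2 : HasDerivAt (fun t : ℝ => exp (t • T) - (1 + t • T + t ^ 2 • U)) 0 0 := by
    have h1 : HasDerivAt (fun t : ℝ => 1 + t • T + t ^ 2 • U) T 0 := by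
      have := (((hasDerivAt_id (0 : ℝ)).smul_const T).const_add 1).add
        (((hasDerivAt_id (0 : ℝ)).pow 2).smul_const U)
      exact this.congr_deriv (by simp)
    exact (hd.sub h1).congr_deriv (by simp)
  have hlittle := hd2.isLittleO
  simp only [zero_smul, exp_zero, sub_zero, smul_zero, add_zero, ne_eq, OfNat.ofNat_ne_zero,
    not_false_eq_true, zero_pow, sub_self] at hlittle
  set M : ℝ := ‖T‖ + ‖U‖
  have hM : 0 ≤ M := by positivity
  have key : Tendsto (fun n : ℕ => ((n : ℝ) + 1) * Real.exp M *
      ‖exp (((n : ℝ) + 1)⁻¹ • T) -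
        (1 + ((n : ℝ) + 1)⁻¹ • T + (((n : ℝ) + 1)⁻¹) ^ 2 • U)‖) atTop (𝓝 0) := by
    have h3 := (hlittle.norm_left.comp_tendsto hlim).tendsto_div_nhds_zero.const_mul (Real.exp M)
    simp only [mul_zero] at h3
    refine h3.congr fun n => ?_
    simp only [Function.comp, div_inv_eq_mul]
    ring
  rw [tendsto_iff_norm_sub_tendsto_zero]
  refine squeeze_zero (fun _ => norm_nonneg _) (fun n => ?_) key
  have hn : (0 : ℝ) < (n : ℝ) + 1 := by positivity
  set h : ℝ := ((n : ℝ) + 1)⁻¹ with hh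
  have hpos : 0 < h := by positivity
  have hle : h ≤ 1 := by
    rw [hh]; apply inv_le_one_of_one_le₀; linarith [(Nat.cast_nonneg n : (0 : ℝ) ≤ n)]
  have e1 : exp T = exp (h • T) ^ (n + 1) := by
    rw [← exp_nsmul, ← Nat.cast_smul_eq_nsmul ℝ, smul_smul]
    push_cast
    rw [hh, mul_inv_cancel₀ hn.ne', one_smul]
  have hb1 : ‖exp (h • T)‖ ≤ Real.exp (h * M) := by
    refine (norm_exp_le_exp_norm _).trans (Real.exp_le_exp.mpr ?_)
    rw [norm_smul, Real.norm_of_nonneg hpos.le]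
    gcongr
    exact le_add_of_nonneg_right (norm_nonneg U)
  have hb2 : ‖1 + h • T + h ^ 2 • U‖ ≤ Real.exp (h * M) := by
    calc _ ≤ ‖(1 : 𝔸)‖ + ‖h • T‖ + ‖h ^ 2 • U‖ := norm_add₃_le
      _ = 1 + h * ‖T‖ + h ^ 2 * ‖U‖ := by
        rw [norm_smul, norm_smul, norm_one, Real.norm_of_nonneg hpos.le,
          Real.norm_of_nonneg (by positivity)]
      _ ≤ 1 + h * ‖T‖ + h * ‖U‖ := by gcongr; nlinarith
      _ = h * M + 1 := by simp only [M]; ring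
      _ ≤ _ := Real.add_one_le_exp _
  rw [e1, norm_sub_rev]
  refine (norm_pow_sub_pow_le _ _ _ hb1 hb2 n).trans ?_
  gcongr
  rw [← Real.exp_nat_mul]
  apply Real.exp_le_exp.mpr
  have : (n : ℝ) * h ≤ 1 := by
    rw [hh, ← div_eq_mul_inv, div_le_one hn]; linarith
  nlinarith

end BanachExp

end

section

open scoped Matrix.Norms.Operator
open NormedSpace Filter Topology

section LogMean

/-- The logarithmic mean of `e ^ a` and `e ^ b`. -/
noncomputable def expMean (a b : ℝ) : ℝ := ∫ s in (0 : ℝ)..1, Real.exp (s * a + (1 - s) * b)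

theorem expMean_self (a : ℝ) : expMean a a = Real.exp a := by
  have : ∀ s : ℝ, s * a + (1 - s) * a = a := fun s => by ring
  simp [expMean, this]

theorem expMean_mul_sub (a b : ℝ) : expMean a b * (a - b) = Real.exp a - Real.exp b := by
  have hder : ∀ s : ℝ, HasDerivAt (fun s : ℝ => Real.exp (s * a + (1 - s) * b))
      (Real.exp (s * a + (1 - s) * b) * (a - b)) s := by
    intro s
    have h1 : HasDerivAt (fun s : ℝ => s * a + (1 - s) * b) (a - b) s := by
      have := ((hasDerivAt_id s).mul_const a).add (((hasDerivAt_id s).const_sub 1).mul_const b)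
      exact this.congr_deriv (by ring)
    exact h1.exp
  have := intervalIntegral.integral_eq_sub_of_hasDerivAt (a := 0) (b := 1) (fun s _ => hder s)
    (by apply Continuous.intervalIntegrable; fun_prop)
  rw [intervalIntegral.integral_mul_const] at this
  simpa [expMean] using this

theorem expMean_nonneg (a b : ℝ) : 0 ≤ expMean a b :=
  intervalIntegral.integral_nonneg (by norm_num) fun s _ => (Real.exp_pos _).le

theorem expMean_comm (a b : ℝ) : expMean a b = expMean b a := by
  rcases eq_or_ne a b with rfl | h
  · rfl
  · have h1 := expMean_mul_sub a b
    have h2 := expMean_mul_sub b a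
    have : (expMean a b - expMean b a) * (a - b) = 0 := by linarith
    rcases mul_eq_zero.mp this with h3 | h3
    · linarith
    · exact absurd (by linarith) h

theorem exp_add_exp_le_expMean (a b : ℝ) :
    (Real.exp a + Real.exp b) / 2 ≤ expMean a b * (1 + |a - b| / 2) := by
  wlog h : b ≤ a generalizing a b
  · rw [expMean_comm, abs_sub_comm, add_comm (Real.exp a)]
    exact this b a (le_of_not_ge h)
  rcases h.eq_or_lt with rfl | h
  · rw [expMean_self]; simp
  have hpos : 0 < a - b := sub_pos.mpr h
  rw [abs_of_pos hpos]
  refine le_of_mul_le_mul_right ?_ hpos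
  have h1 : expMean a b * (1 + (a - b) / 2) * (a - b) =
      (Real.exp a - Real.exp b) * (1 + (a - b) / 2) := by rw [← expMean_mul_sub]; ring
  rw [h1]
  have h2 := Real.add_one_le_exp (a - b)
  have h3 : Real.exp a = Real.exp (a - b) * Real.exp b := by rw [← Real.exp_add]; ring_nf
  rw [h3]
  nlinarith [Real.exp_pos b, mul_le_mul_of_nonneg_right h2 (Real.exp_pos b).le]

/-- The Falk–Bruch inequality, in spectral form. -/
theorem sum_exp_add_exp_le {ι : Type*} (s : Finset ι) (w a b : ι → ℝ) (hw : ∀ i ∈ s, 0 ≤ w i)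
    (D C : ℝ) (hD : ∑ i ∈ s, w i * expMean (a i) (b i) ≤ D)
    (hC : ∑ i ∈ s, w i * ((a i - b i) * (Real.exp (a i) - Real.exp (b i))) ≤ C) :
    ∑ i ∈ s, w i * ((Real.exp (a i) + Real.exp (b i)) / 2) ≤ Real.sqrt (D * C) / 2 + D := by
  have h1 : ∑ i ∈ s, w i * ((Real.exp (a i) + Real.exp (b i)) / 2) ≤
      ∑ i ∈ s, w i * expMean (a i) (b i) +
        (∑ i ∈ s, w i * expMean (a i) (b i) * |a i - b i|) / 2 := by
    rw [Finset.sum_div, ← Finset.sum_add_distrib]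
    refine Finset.sum_le_sum fun i hi => ?_
    calc _ ≤ w i * (expMean (a i) (b i) * (1 + |a i - b i| / 2)) :=
          mul_le_mul_of_nonneg_left (exp_add_exp_le_expMean _ _) (hw i hi)
      _ = _ := by ring
  have h2 : ∑ i ∈ s, w i * expMean (a i) (b i) * |a i - b i| ≤ Real.sqrt (D * C) := by
    refine Real.le_sqrt_of_sq_le ?_
    have hcs := Finset.sum_sq_le_sum_mul_sum_of_sq_le_mul s
      (r := fun i => w i * expMean (a i) (b i) * |a i - b i|)
      (f := fun i => w i * expMean (a i) (b i))
      (g := fun i => w i * ((a i - b i) * (Real.exp (a i) - Real.exp (b i))))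
      (fun i hi => mul_nonneg (hw i hi) (expMean_nonneg _ _))
      (fun i hi => by
        rw [← expMean_mul_sub]
        have := mul_nonneg (hw i hi) (mul_nonneg (expMean_nonneg (a i) (b i))
          (sq_nonneg (a i - b i)))
        nlinarith)
      (fun i _ => by
        rw [← expMean_mul_sub, mul_pow, sq_abs]; apply le_of_eq; ring)
    refine hcs.trans ?_
    have h0 : 0 ≤ ∑ i ∈ s, w i * expMean (a i) (b i) :=
      Finset.sum_nonneg fun i hi => mul_nonneg (hw i hi) (expMean_nonneg _ _)
    have h0' : 0 ≤ ∑ i ∈ s, w i * ((a i - b i) * (Real.exp (a i) - Real.exp (b i))) :=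
      Finset.sum_nonneg fun i hi => by
        rw [← expMean_mul_sub]
        have := mul_nonneg (hw i hi) (mul_nonneg (expMean_nonneg (a i) (b i))
          (sq_nonneg (a i - b i)))
        nlinarith
    exact mul_le_mul hD hC h0' (h0.trans hD)
  linarith

end LogMean

section SecondOrder

/-- If `f t ≤ f 0 * exp (c t ^ 2)`, then `f'' 0 ≤ 2 c f 0`. -/
theorem deriv_deriv_le_of_le_gaussian (f f' : ℝ → ℝ) (f'' c : ℝ) (hf : ∀ t, HasDerivAt f (f' t) t)
    (hf' : HasDerivAt f' f'' 0) (hle : ∀ t, f t ≤ f 0 * Real.exp (c * t ^ 2)) :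
    f'' ≤ 2 * c * f 0 := by
  set g : ℝ → ℝ := fun t => f 0 * Real.exp (c * t ^ 2) - f t with hg
  set g' : ℝ → ℝ := fun t => f 0 * (Real.exp (c * t ^ 2) * (c * (2 * t))) - f' t with hg'
  have hgd : ∀ t, HasDerivAt g (g' t) t := by
    intro t
    have h1 : HasDerivAt (fun t : ℝ => c * t ^ 2) (c * (2 * t)) t := by
      simpa using (hasDerivAt_pow 2 t).const_mul c
    exact ((h1.exp).const_mul (f 0)).sub (hf t)
  have hg0 : ∀ t, g 0 ≤ g t := by
    intro t; simp only [hg]; have := hle t; simp; linarith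
  have hd : deriv g = g' := funext fun t => (hgd t).deriv
  have hg'd : HasDerivAt g' (f 0 * (2 * c) - f'') 0 := by
    have h1 : HasDerivAt (fun t : ℝ => c * t ^ 2) (c * (2 * (0 : ℝ))) 0 := by
      simpa using (hasDerivAt_pow 2 (0 : ℝ)).const_mul c
    have h2 : HasDerivAt (fun t : ℝ => c * (2 * t)) (c * (2 * 1)) 0 :=
      ((hasDerivAt_id (0 : ℝ)).const_mul 2).const_mul c
    have h3 := ((h1.exp.mul h2).const_mul (f 0)).sub hf'
    refine h3.congr_deriv ?_
    simp [mul_comm]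
  by_contra hcon
  have hlt : f 0 * (2 * c) - f'' < 0 := by linarith
  have hmin : IsLocalMin g 0 := Eventually.of_forall hg0
  have hz : g' 0 = 0 := by rw [← hd]; exact hmin.deriv_eq_zero
  have hneg : deriv (deriv g) 0 < 0 := by rw [hd, hg'd.deriv]; exact hlt
  have hmax : IsLocalMax g 0 := by
    have := isLocalMin_of_deriv_deriv_pos (f := fun t => -g t) (x₀ := 0)
    have h1 : deriv (fun t => -g t) = fun t => -g' t := funext fun t => ((hgd t).neg).deriv
    have h2 := this (by rw [h1, hg'd.fun_neg.deriv]; linarith) (by rw [h1]; simp [hz])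
      (hgd 0).continuousAt.neg
    simpa [IsLocalMin, IsMinFilter, IsLocalMax, IsMaxFilter] using h2
  have hconst : g =ᶠ[𝓝 0] fun _ => g 0 := by
    filter_upwards [hmin, hmax] with t h1 h2 using le_antisymm h2 h1
  have : deriv g =ᶠ[𝓝 0] deriv (fun _ => g 0) := hconst.deriv
  have h4 := this.deriv_eq
  simp at h4
  linarith

end SecondOrder

end

section

set_option linter.unusedSectionVars false
open scoped Matrix.Norms.Operator
open NormedSpace Filter Topology

section MatrixTrace

variable {n : Type*} [Fintype n] [DecidableEq n]

/-- `M ↦ Re Tr (A M)` as a continuous real-linear functional. -/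
noncomputable def reTraceMul (A : Matrix n n ℂ) : Matrix n n ℂ →L[ℝ] ℝ :=
  LinearMap.toContinuousLinearMap
    { toFun := fun M => (A * M).trace.re
      map_add' := fun M N => by simp [mul_add]
      map_smul' := fun r M => by simp }

@[simp] theorem reTraceMul_apply (A M : Matrix n n ℂ) : reTraceMul A M = (A * M).trace.re := rfl

theorem hasDerivAt_trace_mul_exp_add_smul (A X Y : Matrix n n ℂ) :
    HasDerivAt (fun t : ℝ => (A * exp (X + t • Y)).trace.re)
      (∫ s in (0 : ℝ)..1, (A * (exp (s • X) * Y * exp (-(s • X)) * exp X)).trace.re) 0 :=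
  hasDerivAt_map_exp_add_smul (reTraceMul A) X Y

theorem hasDerivAt_trace_exp (X Y : Matrix n n ℂ) (t : ℝ) :
    HasDerivAt (fun t : ℝ => (exp (X + t • Y)).trace.re) ((Y * exp (X + t • Y)).trace.re) t := by
  have h0 := hasDerivAt_trace_mul_exp_add_smul 1 (X + t • Y) Y
  rw [show (0 : ℝ) = t - t by simp] at h0
  have h1 := h0.comp_sub_const t t
  simp only [sub_self] at h1
  refine (h1.congr_deriv ?_).congr_of_eventuallyEq (Eventually.of_forall fun u => ?_)
  · have : ∀ s : ℝ, ((1 : Matrix n n ℂ) *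
        (exp (s • (X + t • Y)) * Y * exp (-(s • (X + t • Y))) * exp (X + t • Y))).trace.re =
          (Y * exp (X + t • Y)).trace.re := by
      intro s
      have hc : Commute (exp (-(s • (X + t • Y)))) (exp (X + t • Y)) :=
        (((Commute.refl (X + t • Y)).smul_left s).neg_left).exp
      rw [one_mul, mul_assoc, hc.eq, mul_assoc, Matrix.trace_mul_comm,
        mul_assoc, mul_assoc, ← Matrix.exp_add_of_commute]
      · simp
      · exact (Commute.refl _).neg_left
    simp only [this]
    simp
  · simp only [one_mul]
    rw [add_assoc, ← add_smul, add_sub_cancel]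

theorem hasDerivAt_trace_mul_exp_diagonal (lam : n → ℝ) (Y : Matrix n n ℂ) (hY : Y.IsHermitian) :
    HasDerivAt
      (fun t : ℝ => (Y * exp (Matrix.diagonal (fun i => (lam i : ℂ)) + t • Y)).trace.re)
      (∑ i, ∑ j, ‖Y i j‖ ^ 2 * expMean (lam i) (lam j)) 0 := by
  set X : Matrix n n ℂ := Matrix.diagonal (fun i => (lam i : ℂ)) with hX
  have h2 := hasDerivAt_trace_mul_exp_add_smul Y X Y
  refine h2.congr_deriv ?_
  have hexp : ∀ s : ℝ, exp (s • X) = Matrix.diagonal (fun i => (Real.exp (s * lam i) : ℂ)) := by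
    intro s
    rw [hX, ← Matrix.diagonal_smul, Matrix.exp_diagonal]
    congr 1
    ext i
    rw [Pi.coe_exp]
    simp [← Complex.exp_eq_exp_ℂ]
  have hexp1 : exp X = Matrix.diagonal (fun i => (Real.exp (lam i) : ℂ)) := by
    simpa using hexp 1
  have : ∀ s : ℝ, (Y * (exp (s • X) * Y * exp (-(s • X)) * exp X)).trace.re =
      ∑ i, ∑ j, ‖Y i j‖ ^ 2 * Real.exp (s * lam j + (1 - s) * lam i) := by
      intro s
      rw [← neg_smul, hexp, hexp, hexp1, ← mul_assoc, Matrix.trace_mul_comm, ← mul_assoc]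
      rw [Matrix.trace, Complex.re_sum]
      refine Finset.sum_congr rfl fun i _ => ?_
      rw [Matrix.diag_apply, Matrix.mul_apply, Complex.re_sum]
      refine Finset.sum_congr rfl fun j _ => ?_
      rw [Matrix.diagonal_mul, Matrix.mul_diagonal, Matrix.diagonal_mul]
      have hy : Y j i = (starRingEnd ℂ) (Y i j) := (hY.apply j i).symm
      have hn : Y i j * (starRingEnd ℂ) (Y i j) = ((‖Y i j‖ ^ 2 : ℝ) : ℂ) := by
        rw [Complex.mul_conj, Complex.normSq_eq_norm_sq]
      rw [hy]
      have : (Real.exp (lam i) : ℂ) * Y i j * ((Real.exp (s * lam j) : ℂ) * (starRingEnd ℂ) (Y i j) *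
          (Real.exp (-s * lam i) : ℂ)) = ((‖Y i j‖ ^ 2 *
            (Real.exp (s * lam j) * Real.exp (lam i) * Real.exp (-s * lam i)) : ℝ) : ℂ) := by
        push_cast
        rw [← Complex.ofReal_pow, ← hn]
        ring
      rw [this, Complex.ofReal_re, ← Real.exp_add, ← Real.exp_add]
      ring_nf
  simp only [this]
  rw [intervalIntegral.integral_finsetSum]
  · refine Finset.sum_congr rfl fun i _ => ?_
    rw [intervalIntegral.integral_finsetSum]
    · refine Finset.sum_congr rfl fun j _ => ?_
      rw [intervalIntegral.integral_const_mul, expMean_comm, expMean]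
    · intro j _
      apply Continuous.intervalIntegrable
      fun_prop
  · intro i _
    apply Continuous.intervalIntegrable
    fun_prop

/-- `-Re Tr (e^X [Y, [X, Y]])`. -/
noncomputable def doubleComm (X Y : Matrix n n ℂ) : ℝ :=
  -(exp X * (Y * (X * Y - Y * X) - (X * Y - Y * X) * Y)).trace.re

theorem exp_diagonal_ofReal (lam : n → ℝ) : exp (Matrix.diagonal fun i => (lam i : ℂ)) =
    Matrix.diagonal (fun i => (Real.exp (lam i) : ℂ)) := by
  rw [Matrix.exp_diagonal]
  congr 1
  ext i
  rw [Pi.coe_exp]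
  simp [← Complex.exp_eq_exp_ℂ]

theorem mul_apply_self_of_isHermitian {Y : Matrix n n ℂ} (hY : Y.IsHermitian) (i j : n) :
    Y i j * Y j i = ((‖Y i j‖ ^ 2 : ℝ) : ℂ) := by
  rw [(hY.apply j i).symm]
  rw [← Complex.normSq_eq_norm_sq, ← Complex.mul_conj]; rfl

theorem norm_apply_comm_of_isHermitian {Y : Matrix n n ℂ} (hY : Y.IsHermitian) (i j : n) :
    ‖Y j i‖ = ‖Y i j‖ := by
  rw [(hY.apply j i).symm, norm_star]

theorem doubleComm_diagonal (lam : n → ℝ) {Y : Matrix n n ℂ} (hY : Y.IsHermitian) :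
    doubleComm (Matrix.diagonal fun i => (lam i : ℂ)) Y =
      ∑ i, ∑ j, ‖Y i j‖ ^ 2 * ((lam i - lam j) * (Real.exp (lam i) - Real.exp (lam j))) := by
  have h1 : doubleComm (Matrix.diagonal fun i => (lam i : ℂ)) Y =
      ∑ i, ∑ j, ‖Y i j‖ ^ 2 * (2 * (lam i - lam j) * Real.exp (lam i)) := by
    rw [doubleComm, exp_diagonal_ofReal, Matrix.trace, Complex.re_sum, ← Finset.sum_neg_distrib]
    refine Finset.sum_congr rfl fun i _ => ?_
    rw [Matrix.diag_apply, Matrix.diagonal_mul, Matrix.sub_apply, Matrix.mul_apply,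
      Matrix.mul_apply, ← Finset.sum_sub_distrib, Complex.re_ofReal_mul, Complex.re_sum,
      Finset.mul_sum, ← Finset.sum_neg_distrib]
    refine Finset.sum_congr rfl fun j _ => ?_
    simp only [Matrix.sub_apply, Matrix.diagonal_mul, Matrix.mul_diagonal]
    have : Y i j * ((lam j : ℂ) * Y j i - Y j i * (lam i : ℂ)) -
        ((lam i : ℂ) * Y i j - Y i j * (lam j : ℂ)) * Y j i =
        ((‖Y i j‖ ^ 2 * (2 * (lam j - lam i)) : ℝ) : ℂ) := by
      push_cast
      rw [← Complex.ofReal_pow, ← mul_apply_self_of_isHermitian hY]; ring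
    rw [this, Complex.ofReal_re]; ring
  have h2 : doubleComm (Matrix.diagonal fun i => (lam i : ℂ)) Y =
      ∑ i, ∑ j, ‖Y i j‖ ^ 2 * (2 * (lam j - lam i) * Real.exp (lam j)) := by
    rw [h1, Finset.sum_comm]
    refine Finset.sum_congr rfl fun i _ => Finset.sum_congr rfl fun j _ => ?_
    rw [norm_apply_comm_of_isHermitian hY]
  have h3 : 2 * doubleComm (Matrix.diagonal fun i => (lam i : ℂ)) Y =
      2 * ∑ i, ∑ j, ‖Y i j‖ ^ 2 * ((lam i - lam j) * (Real.exp (lam i) - Real.exp (lam j))) := by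
    rw [two_mul]
    nth_rw 1 [h1]
    rw [h2, ← Finset.sum_add_distrib, Finset.mul_sum]
    refine Finset.sum_congr rfl fun i _ => ?_
    rw [← Finset.sum_add_distrib, Finset.mul_sum]
    refine Finset.sum_congr rfl fun j _ => ?_
    ring
  linarith

theorem trace_exp_diagonal_mul_sq (lam : n → ℝ) {Y : Matrix n n ℂ} (hY : Y.IsHermitian) :
    (exp (Matrix.diagonal fun i => (lam i : ℂ)) * (Y * Y)).trace.re =
      ∑ i, ∑ j, ‖Y i j‖ ^ 2 * ((Real.exp (lam i) + Real.exp (lam j)) / 2) := by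
  set T := (exp (Matrix.diagonal fun i => (lam i : ℂ)) * (Y * Y)).trace.re with hT
  have h1 : T = ∑ i, ∑ j, ‖Y i j‖ ^ 2 * Real.exp (lam i) := by
    rw [hT, exp_diagonal_ofReal, Matrix.trace, Complex.re_sum]
    refine Finset.sum_congr rfl fun i _ => ?_
    rw [Matrix.diag_apply, Matrix.diagonal_mul, Matrix.mul_apply, Complex.re_ofReal_mul,
      Complex.re_sum, Finset.mul_sum]
    refine Finset.sum_congr rfl fun j _ => ?_
    rw [mul_apply_self_of_isHermitian hY, Complex.ofReal_re, mul_comm]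
  have h2 : T = ∑ i, ∑ j, ‖Y i j‖ ^ 2 * Real.exp (lam j) := by
    rw [h1, Finset.sum_comm]
    refine Finset.sum_congr rfl fun i _ => Finset.sum_congr rfl fun j _ => ?_
    rw [norm_apply_comm_of_isHermitian hY]
  have h3 : 2 * T = 2 * ∑ i, ∑ j, ‖Y i j‖ ^ 2 * ((Real.exp (lam i) + Real.exp (lam j)) / 2) := by
    rw [two_mul]
    nth_rw 1 [h1]
    rw [h2, ← Finset.sum_add_distrib, Finset.mul_sum]
    refine Finset.sum_congr rfl fun i _ => ?_
    rw [← Finset.sum_add_distrib, Finset.mul_sum]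
    refine Finset.sum_congr rfl fun j _ => ?_
    ring
  linarith

theorem falk_bruch_diagonal {κ : Type*} [Fintype κ] (lam : n → ℝ) (Y : κ → Matrix n n ℂ)
    (hY : ∀ a, (Y a).IsHermitian) (c : κ → ℝ)
    (hle : ∀ a, ∀ t : ℝ, (exp (Matrix.diagonal (fun i => (lam i : ℂ)) + t • Y a)).trace.re ≤
      (exp (Matrix.diagonal (fun i => (lam i : ℂ)))).trace.re * Real.exp (c a * t ^ 2)) :
    (∀ a, 0 ≤ doubleComm (Matrix.diagonal fun i => (lam i : ℂ)) (Y a)) ∧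
    ∑ a, (exp (Matrix.diagonal fun i => (lam i : ℂ)) * (Y a * Y a)).trace.re ≤
      Real.sqrt ((∑ a, 2 * c a * (exp (Matrix.diagonal fun i => (lam i : ℂ))).trace.re) *
        ∑ a, doubleComm (Matrix.diagonal fun i => (lam i : ℂ)) (Y a)) / 2 +
      ∑ a, 2 * c a * (exp (Matrix.diagonal fun i => (lam i : ℂ))).trace.re := by
  constructor
  · intro a
    rw [doubleComm_diagonal lam (hY a)]
    refine Finset.sum_nonneg fun i _ => Finset.sum_nonneg fun j _ => ?_
    refine mul_nonneg (sq_nonneg _) ?_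
    rw [← expMean_mul_sub]
    nlinarith [mul_nonneg (expMean_nonneg (lam i) (lam j)) (sq_nonneg (lam i - lam j))]
  · have hD : ∀ a, ∑ i, ∑ j, ‖Y a i j‖ ^ 2 * expMean (lam i) (lam j) ≤
        2 * c a * (exp (Matrix.diagonal fun i => (lam i : ℂ))).trace.re := by
      intro a
      have := deriv_deriv_le_of_le_gaussian
        (fun t : ℝ => (exp (Matrix.diagonal (fun i => (lam i : ℂ)) + t • Y a)).trace.re) _ _ (c a)
        (fun t => hasDerivAt_trace_exp _ _ t)
        (hasDerivAt_trace_mul_exp_diagonal lam (Y a) (hY a)) (by simpa using hle a)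
      simpa using this
    have key := sum_exp_add_exp_le (Finset.univ : Finset (κ × n × n))
      (fun p => ‖Y p.1 p.2.1 p.2.2‖ ^ 2) (fun p => lam p.2.1) (fun p => lam p.2.2)
      (fun p _ => sq_nonneg _)
      (∑ a, 2 * c a * (exp (Matrix.diagonal fun i => (lam i : ℂ))).trace.re)
      (∑ a, doubleComm (Matrix.diagonal fun i => (lam i : ℂ)) (Y a))
      (by
        simp only [Fintype.sum_prod_type]
        exact Finset.sum_le_sum fun a _ => hD a)
      (by
        simp only [Fintype.sum_prod_type]
        exact Finset.sum_le_sum fun a _ => (doubleComm_diagonal lam (hY a)).ge)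
    simp only [Fintype.sum_prod_type] at key
    simpa only [trace_exp_diagonal_mul_sq lam (hY _)] using key

/-- Falk–Bruch bound on `∑ Tr (Y_a² e^X)` for perturbations satisfying Gaussian domination. -/
theorem falk_bruch {κ : Type*} [Fintype κ] (X : Matrix n n ℂ) (hX : X.IsHermitian)
    (Y : κ → Matrix n n ℂ) (hY : ∀ a, (Y a).IsHermitian) (c : κ → ℝ)
    (hle : ∀ a, ∀ t : ℝ, (exp (X + t • Y a)).trace.re ≤
      (exp X).trace.re * Real.exp (c a * t ^ 2)) :
    (∀ a, 0 ≤ doubleComm X (Y a)) ∧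
    ∑ a, (exp X * (Y a * Y a)).trace.re ≤
      Real.sqrt ((∑ a, 2 * c a * (exp X).trace.re) * ∑ a, doubleComm X (Y a)) / 2 +
      ∑ a, 2 * c a * (exp X).trace.re := by
  set U : Matrix n n ℂ := (hX.eigenvectorUnitary).1 with hU
  have hUU : U * star U = 1 := Unitary.coe_mul_star_self hX.eigenvectorUnitary
  have hUU' : star U * U = 1 := Unitary.coe_star_mul_self hX.eigenvectorUnitary
  set L : Matrix n n ℂ := Matrix.diagonal (fun i => (hX.eigenvalues i : ℂ)) with hL
  have hspec : X = U * L * star U := by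
    have := hX.spectral_theorem
    rw [Unitary.conjStarAlgAut_apply] at this
    exact this
  have hinv : U⁻¹ = star U := Matrix.inv_eq_right_inv hUU
  have hunit : IsUnit U := ⟨⟨U, star U, hUU, hUU'⟩, rfl⟩
  set W : κ → Matrix n n ℂ := fun a => star U * Y a * U with hW
  have hYW : ∀ a, Y a = U * W a * star U := by
    intro a
    calc Y a = (U * star U) * Y a * (U * star U) := by rw [hUU]; simp
      _ = _ := by simp only [hW, mul_assoc]
  have hconjexp : ∀ M : Matrix n n ℂ, exp (U * M * star U) = U * exp M * star U := by
    intro M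
    rw [← hinv, Matrix.exp_conj _ _ hunit]
  have htr : ∀ M : Matrix n n ℂ, (U * M * star U).trace = M.trace := by
    intro M
    rw [Matrix.trace_mul_comm, ← mul_assoc, hUU', one_mul]
  have hmul : ∀ M N : Matrix n n ℂ, (U * M * star U) * (U * N * star U) = U * (M * N) * star U := by
    intro M N
    calc _ = U * M * (star U * U) * N * star U := by simp only [mul_assoc]
      _ = _ := by rw [hUU']; simp only [mul_assoc, one_mul]
  have hsub : ∀ M N : Matrix n n ℂ, U * M * star U - U * N * star U = U * (M - N) * star U := by
    intro M N; noncomm_ring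
  have hdc : ∀ a, doubleComm X (Y a) = doubleComm L (W a) := by
    intro a
    rw [doubleComm, doubleComm, hYW a, hspec, hconjexp]
    simp only [hmul, hsub, htr]
  have hWh : ∀ a, (W a).IsHermitian := fun a =>
    Matrix.isHermitian_conjTranspose_mul_mul U (hY a)
  have key := falk_bruch_diagonal hX.eigenvalues W hWh c (fun a t => by
    have := hle a t
    rw [hYW a, hspec, hconjexp, htr] at this
    rw [show U * L * star U + t • (U * W a * star U) = U * (L + t • W a) * star U by
      rw [mul_add, add_mul]; simp, hconjexp, htr] at this
    exact this)
  have hZ : (exp X).trace = (exp L).trace := by rw [hspec, hconjexp, htr]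
  simp only [hdc, hZ]
  refine ⟨key.1, ?_⟩
  have h5 : ∀ a, (exp X * (Y a * Y a)).trace = (exp L * (W a * W a)).trace := by
    intro a
    rw [hYW a, hspec, hconjexp]
    simp only [hmul, htr]
  simp only [h5]
  exact key.2

end MatrixTrace

end

section

set_option linter.unusedSectionVars false
open scoped Matrix.Norms.Operator Kronecker
open NormedSpace Filter Topology

section ReflectionPositivity

variable {m ι : Type*} [Fintype m] [DecidableEq m] [Fintype ι]

theorem sum_kronecker {κ n : Type*} (t : Finset κ) (f : κ → Matrix m m ℂ) (N : Matrix n n ℂ) :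
    (∑ i ∈ t, f i) ⊗ₖ N = ∑ i ∈ t, f i ⊗ₖ N := by
  ext ⟨a, b⟩ ⟨c, d⟩; simp [Matrix.sum_apply, Finset.sum_mul]

theorem kronecker_sum {κ n : Type*} (t : Finset κ) (f : κ → Matrix m m ℂ) (N : Matrix n n ℂ) :
    N ⊗ₖ (∑ i ∈ t, f i) = ∑ i ∈ t, N ⊗ₖ f i := by
  ext ⟨a, b⟩ ⟨c, d⟩; simp [Matrix.sum_apply, Finset.mul_sum]

/-- Entrywise complex conjugation. -/
noncomputable def conjMap : Matrix m m ℂ →+* Matrix m m ℂ := (starRingEnd ℂ).mapMatrix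

theorem conjMap_apply (A : Matrix m m ℂ) (i j : m) : conjMap A i j = (starRingEnd ℂ) (A i j) := rfl

theorem conjMap_smul (r : ℝ) (A : Matrix m m ℂ) : conjMap (r • A) = r • conjMap A := by
  ext i j; simp [conjMap_apply]

theorem trace_conjMap (A : Matrix m m ℂ) : (conjMap A).trace = (starRingEnd ℂ) A.trace := by
  simp [Matrix.trace, conjMap_apply]

/-- The operator `∑ X_i ⊗ conj Y_i`. -/
noncomputable def pairSum {κ : Type*} [Fintype κ] (X Y : κ → Matrix m m ℂ) :
    Matrix (m × m) (m × m) ℂ := ∑ i, X i ⊗ₖ conjMap (Y i)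

theorem pairSum_pow {κ : Type*} [Fintype κ] (X Y : κ → Matrix m m ℂ) (k : ℕ) :
    pairSum X Y ^ k = pairSum (κ := Fin k → κ) (fun w => (List.ofFn fun i => X (w i)).prod)
      (fun w => (List.ofFn fun i => Y (w i)).prod) := by
  induction k with
  | zero => simp [pairSum]
  | succ k ih =>
    rw [pow_succ', ih]
    simp only [pairSum]
    rw [Finset.sum_mul_sum, ← (Fin.consEquiv fun _ : Fin (k + 1) => κ).sum_comp,
      Fintype.sum_prod_type]
    refine Finset.sum_congr rfl fun i _ => Finset.sum_congr rfl fun w _ => ?_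
    simp only [List.ofFn_succ, List.prod_cons, map_mul, Matrix.mul_kronecker_mul,
      Fin.consEquiv_apply, Fin.cons_zero, Fin.cons_succ]

theorem norm_trace_pairSum_sq_le {κ : Type*} [Fintype κ] (X Y : κ → Matrix m m ℂ) :
    ‖(pairSum X Y).trace‖ ^ 2 ≤ (pairSum X X).trace.re * (pairSum Y Y).trace.re := by
  have h : ∀ X Y : κ → Matrix m m ℂ, (pairSum X Y).trace =
      ∑ i, (X i).trace * (starRingEnd ℂ) (Y i).trace := by
    intro X Y
    rw [pairSum, Matrix.trace_sum]
    simp only [Matrix.trace_kronecker, trace_conjMap]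
  have h2 : ∀ X : κ → Matrix m m ℂ, (pairSum X X).trace.re = ∑ i, ‖(X i).trace‖ ^ 2 := by
    intro X
    rw [h, Complex.re_sum]
    refine Finset.sum_congr rfl fun i _ => ?_
    rw [Complex.mul_conj, Complex.ofReal_re, Complex.normSq_eq_norm_sq]
  rw [h, h2, h2]
  calc _ ≤ (∑ i, ‖(X i).trace‖ * ‖(Y i).trace‖) ^ 2 := by
        gcongr
        refine (norm_sum_le _ _).trans (le_of_eq ?_)
        simp
    _ ≤ _ := Finset.sum_mul_sq_le_sq_mul_sq _ _ _

/-- `A ⊗ 1 + 1 ⊗ conj B + ∑ C_i ⊗ conj D_i`. -/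
noncomputable def coupled (A B : Matrix m m ℂ) (C D : ι → Matrix m m ℂ) :
    Matrix (m × m) (m × m) ℂ := A ⊗ₖ 1 + 1 ⊗ₖ conjMap B + pairSum C D

theorem pairSum_option (A B : Matrix m m ℂ) (C D : ι → Matrix m m ℂ) (h : ℝ) (hh : 0 ≤ h) :
    pairSum (κ := Option ι) (fun o => o.elim (1 + h • A) fun i => Real.sqrt h • C i)
      (fun o => o.elim (1 + h • B) fun i => Real.sqrt h • D i) =
    1 + h • coupled A B C D + h ^ 2 • (A ⊗ₖ conjMap B) := by
  rw [pairSum, Fintype.sum_option]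
  simp only [Option.elim, map_add, map_one, conjMap_smul, Matrix.smul_kronecker,
    Matrix.kronecker_smul, smul_smul, Real.mul_self_sqrt hh, Matrix.add_kronecker,
    Matrix.kronecker_add, Matrix.one_kronecker_one, coupled, pairSum, smul_add, Finset.smul_sum]
  rw [← pow_two]
  abel

/-- Reflection positivity as a Cauchy–Schwarz inequality for traces of exponentials. -/
theorem norm_trace_exp_coupled_sq_le [Nonempty m] (A B : Matrix m m ℂ) (C D : ι → Matrix m m ℂ) :
    ‖(exp (coupled A B C D)).trace‖ ^ 2 ≤
      (exp (coupled A A C C)).trace.re * (exp (coupled B B D D)).trace.re := by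
  have lim : ∀ (A B : Matrix m m ℂ) (C D : ι → Matrix m m ℂ),
      Tendsto (fun n : ℕ => (pairSum (κ := Option ι)
        (fun o => o.elim (1 + ((n : ℝ) + 1)⁻¹ • A) fun i => Real.sqrt (((n : ℝ) + 1)⁻¹) • C i)
        (fun o => o.elim (1 + ((n : ℝ) + 1)⁻¹ • B) fun i => Real.sqrt (((n : ℝ) + 1)⁻¹) • D i)
          ^ (n + 1)).trace) atTop (𝓝 (exp (coupled A B C D)).trace) := by
    intro A B C D
    have h1 := tendsto_one_add_pow_exp (coupled A B C D) (A ⊗ₖ conjMap B)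
    have h2 : Continuous fun M : Matrix (m × m) (m × m) ℂ => M.trace :=
      continuous_id.matrix_trace
    refine ((h2.tendsto _).comp h1).congr fun n => ?_
    rw [pairSum_option _ _ _ _ _ (by positivity)]
    rfl
  refine le_of_tendsto_of_tendsto ((lim A B C D).norm.pow 2)
    (((Complex.continuous_re.tendsto _).comp (lim A A C C)).mul
      ((Complex.continuous_re.tendsto _).comp (lim B B D D))) (Eventually.of_forall fun n => ?_)
  simp only [Function.comp, pairSum_pow]
  exact norm_trace_pairSum_sq_le _ _

/-- `A ⊗ 1 + 1 ⊗ conj B + ∑ K_ij C_i ⊗ conj D_j`. -/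
noncomputable def kernelCoupled (K : Matrix ι ι ℝ) (A B : Matrix m m ℂ) (C D : ι → Matrix m m ℂ) :
    Matrix (m × m) (m × m) ℂ :=
  A ⊗ₖ 1 + 1 ⊗ₖ conjMap B + ∑ i, ∑ j, K i j • (C i ⊗ₖ conjMap (D j))

theorem norm_trace_exp_kernelCoupled_sq_le [Nonempty m] {K : Matrix ι ι ℝ} (hK : K.PosSemidef)
    (A B : Matrix m m ℂ) (C D : ι → Matrix m m ℂ) :
    ‖(exp (kernelCoupled K A B C D)).trace‖ ^ 2 ≤
      (exp (kernelCoupled K A A C C)).trace.re * (exp (kernelCoupled K B B D D)).trace.re := by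
  classical
  obtain ⟨p, M, rfl⟩ := Matrix.posSemidef_iff_eq_sum_vecMulVec.mp hK
  have key : ∀ (A B : Matrix m m ℂ) (C D : ι → Matrix m m ℂ),
      kernelCoupled (∑ k, Matrix.vecMulVec (M k) (star (M k))) A B C D =
        coupled A B (fun k => ∑ i, M k i • C i) (fun k => ∑ i, M k i • D i) := by
    intro A B C D
    rw [kernelCoupled, coupled, pairSum]
    congr 1
    have e1 : ∀ k, (∑ i, M k i • C i) ⊗ₖ conjMap (∑ j, M k j • D j) =
        ∑ i, ∑ j, (M k i * M k j) • (C i ⊗ₖ conjMap (D j)) := by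
      intro k
      rw [map_sum]
      simp only [conjMap_smul]
      rw [sum_kronecker]
      refine Finset.sum_congr rfl fun i _ => ?_
      rw [kronecker_sum]
      refine Finset.sum_congr rfl fun j _ => ?_
      rw [Matrix.smul_kronecker, Matrix.kronecker_smul, smul_smul]
    simp only [e1]
    rw [Finset.sum_comm (f := fun k i => ∑ j, (M k i * M k j) • (C i ⊗ₖ conjMap (D j)))]
    refine Finset.sum_congr rfl fun i _ => ?_
    rw [Finset.sum_comm]
    refine Finset.sum_congr rfl fun j _ => ?_
    rw [Matrix.sum_apply, Finset.sum_smul]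
    simp [Matrix.vecMulVec_apply]
  simp only [key]
  exact norm_trace_exp_coupled_sq_le _ _ _ _

end ReflectionPositivity

end

section

set_option linter.unusedSectionVars false
open scoped Matrix.Norms.Operator Kronecker
open NormedSpace Filter Topology

section SiteOperators

variable {q : Type*} [Fintype q] [DecidableEq q] {Λ : Type*} [Fintype Λ] [DecidableEq Λ]

/-- The operator `A` acting on the site `x`. -/
noncomputable def siteOp (A : Matrix q q ℂ) (x : Λ) : Matrix (Λ → q) (Λ → q) ℂ :=
  Matrix.of fun σ τ => if ∀ y, y ≠ x → σ y = τ y then A (σ x) (τ x) else 0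

theorem siteOp_apply (A : Matrix q q ℂ) (x : Λ) (σ τ : Λ → q) :
    siteOp A x σ τ = if ∀ y, y ≠ x → σ y = τ y then A (σ x) (τ x) else 0 := rfl

theorem forall_ne_eq_iff_update_left (x : Λ) (σ τ : Λ → q) :
    (∀ y, y ≠ x → σ y = τ y) ↔ Function.update σ x (τ x) = τ := by
  rw [Function.update_eq_iff]
  simp

theorem siteOp_eq_sum_left (A : Matrix q q ℂ) (x : Λ) (σ τ : Λ → q) :
    siteOp A x σ τ = ∑ a, if Function.update σ x a = τ then A (σ x) a else 0 := by
  simp only [siteOp_apply, forall_ne_eq_iff_update_left]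
  rw [Finset.sum_eq_single (τ x)]
  · intro b _ hb
    rw [if_neg]
    rintro rfl
    simp at hb
  · simp

theorem siteOp_eq_sum_right (A : Matrix q q ℂ) (x : Λ) (σ τ : Λ → q) :
    siteOp A x σ τ = ∑ a, if Function.update τ x a = σ then A a (τ x) else 0 := by
  have h : (∀ y, y ≠ x → σ y = τ y) ↔ Function.update τ x (σ x) = σ := by
    rw [← forall_ne_eq_iff_update_left]
    simp only [eq_comm]
  simp only [siteOp_apply, h]
  rw [Finset.sum_eq_single (σ x)]
  · intro b _ hb
    rw [if_neg]
    rintro rfl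
    simp at hb
  · simp

theorem siteOp_mul_apply (A : Matrix q q ℂ) (x : Λ) (M : Matrix (Λ → q) (Λ → q) ℂ)
    (σ ρ : Λ → q) :
    (siteOp A x * M) σ ρ = ∑ a, A (σ x) a * M (Function.update σ x a) ρ := by
  rw [Matrix.mul_apply]
  simp only [siteOp_eq_sum_left A x σ, Finset.sum_mul, ite_mul, zero_mul]
  rw [Finset.sum_comm]
  simp

theorem mul_siteOp_apply (A : Matrix q q ℂ) (x : Λ) (M : Matrix (Λ → q) (Λ → q) ℂ)
    (σ ρ : Λ → q) :
    (M * siteOp A x) σ ρ = ∑ a, M σ (Function.update ρ x a) * A a (ρ x) := by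
  rw [Matrix.mul_apply]
  simp only [siteOp_eq_sum_right A x _ ρ, Finset.mul_sum, mul_ite, mul_zero]
  rw [Finset.sum_comm]
  simp

theorem siteOp_mul_siteOp (A B : Matrix q q ℂ) (x : Λ) :
    siteOp A x * siteOp B x = siteOp (A * B) x := by
  ext σ ρ
  rw [siteOp_mul_apply]
  simp only [siteOp_apply, Function.update_self, Matrix.mul_apply]
  by_cases h : ∀ y, y ≠ x → σ y = ρ y
  · rw [if_pos h]
    refine Finset.sum_congr rfl fun a _ => ?_
    rw [if_pos]
    intro y hy
    rw [Function.update_of_ne hy, h y hy]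
  · rw [if_neg h]
    refine Finset.sum_eq_zero fun a _ => ?_
    rw [if_neg, mul_zero]
    intro h'
    exact h fun y hy => by rw [← h' y hy, Function.update_of_ne hy]

theorem siteOp_commute (A B : Matrix q q ℂ) {x y : Λ} (hxy : x ≠ y) :
    siteOp A x * siteOp B y = siteOp B y * siteOp A x := by
  ext σ ρ
  rw [siteOp_mul_apply, mul_siteOp_apply, Finset.sum_eq_single (ρ x),
    Finset.sum_eq_single (σ x)]
  · rw [siteOp_apply, siteOp_apply, Function.update_of_ne hxy.symm, Function.update_of_ne hxy.symm,
      mul_comm]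
    congr 1
    have : (∀ z, z ≠ y → Function.update σ x (ρ x) z = ρ z) ↔
        (∀ z, z ≠ y → σ z = Function.update ρ x (σ x) z) := by
      refine forall_congr' fun z => forall_congr' fun _ => ?_
      rcases eq_or_ne z x with rfl | hz
      · simp
      · simp [Function.update_of_ne hz]
    simp only [this]
  · intro b _ hb
    rw [siteOp_apply, if_neg, zero_mul]
    intro h
    have := h x hxy
    simp at this
    exact hb this.symm
  · simp
  · intro b _ hb
    rw [siteOp_apply, if_neg, mul_zero]
    intro h
    have := h x hxy
    simp at this
    exact hb this
  · simp

theorem siteOp_one (x : Λ) : siteOp (1 : Matrix q q ℂ) x = 1 := by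
  ext σ τ
  rw [siteOp_apply, Matrix.one_apply, Matrix.one_apply]
  by_cases h : σ = τ
  · simp [h]
  · rw [if_neg h]
    split_ifs with h1 h2
    · exact absurd (funext fun y => by
        rcases eq_or_ne y x with rfl | hy
        · exact h2
        · exact h1 y hy) h
    · rfl
    · rfl

theorem siteOp_add (A B : Matrix q q ℂ) (x : Λ) :
    siteOp (A + B) x = siteOp A x + siteOp B x := by
  ext σ τ; simp only [siteOp_apply, Matrix.add_apply]; split_ifs <;> simp

theorem siteOp_smul {R : Type*} [SMulZeroClass R ℂ] (r : R) (A : Matrix q q ℂ) (x : Λ) :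
    siteOp (r • A) x = r • siteOp A x := by
  ext σ τ; simp only [siteOp_apply, Matrix.smul_apply]; split_ifs <;> simp

theorem conjTranspose_siteOp (A : Matrix q q ℂ) (x : Λ) :
    (siteOp A x).conjTranspose = siteOp A.conjTranspose x := by
  ext σ τ
  simp only [siteOp_apply, Matrix.conjTranspose_apply, eq_comm (a := τ _)]
  split_ifs <;> simp

theorem conjMap_siteOp (A : Matrix q q ℂ) (x : Λ) :
    conjMap (siteOp A x) = siteOp (conjMap A) x := by
  ext σ τ
  simp only [siteOp_apply, conjMap_apply]
  split_ifs <;> simp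

theorem exp_submatrix_equiv {m n : Type*} [Fintype m] [DecidableEq m] [Fintype n] [DecidableEq n]
    (M : Matrix m m ℂ) (e : n ≃ m) : exp (M.submatrix e e) = (exp M).submatrix e e := by
  let _ : NormedAlgebra ℚ (Matrix m m ℂ) := NormedAlgebra.restrictScalars ℚ ℝ _
  have h := map_exp (Matrix.reindexAlgEquiv ℂ ℂ e.symm) (by
    change Continuous fun M : Matrix m m ℂ => M.submatrix e e
    fun_prop) M
  exact h.symm

theorem trace_submatrix_equiv {m n : Type*} [Fintype m] [Fintype n]
    (M : Matrix m m ℂ) (e : n ≃ m) : (M.submatrix e e).trace = M.trace := by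
  simp only [Matrix.trace, Matrix.diag, Matrix.submatrix_apply]
  exact e.sum_comp fun i => M i i

/-- Relabelling of configurations along a bijection of sites. -/
def relabel {Λ' : Type*} (e : Λ ≃ Λ') : (Λ' → q) ≃ (Λ → q) := e.symm.arrowCongr (Equiv.refl q)

theorem siteOp_submatrix_relabel {Λ' : Type*} [Fintype Λ'] [DecidableEq Λ'] (e : Λ ≃ Λ')
    (A : Matrix q q ℂ) (x : Λ) :
    (siteOp A x).submatrix (relabel e) (relabel e) = siteOp A (e x) := by
  ext σ τ
  simp only [Matrix.submatrix_apply, siteOp_apply, relabel, Equiv.arrowCongr_apply,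
    Equiv.symm_symm, Equiv.coe_refl, Function.comp, id]
  congr 1
  refine propext ⟨fun h y hy => ?_, fun h y hy => h _ (by simpa using hy)⟩
  have := h (e.symm y) (by rintro rfl; simp at hy)
  simpa using this

/-- Configurations on two copies of `L` that make up `Λ`. -/
def splitConfig {L : Type*} (e : L ⊕ L ≃ Λ) : (L → q) × (L → q) ≃ (Λ → q) :=
  (Equiv.sumArrowEquivProdArrow L L q).symm.trans (e.arrowCongr (Equiv.refl q))

@[simp] theorem splitConfig_inl {L : Type*} (e : L ⊕ L ≃ Λ) (σ : (L → q) × (L → q)) (a : L) :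
    splitConfig e σ (e (Sum.inl a)) = σ.1 a := by
  simp [splitConfig, Equiv.arrowCongr_apply, Equiv.sumArrowEquivProdArrow]

@[simp] theorem splitConfig_inr {L : Type*} (e : L ⊕ L ≃ Λ) (σ : (L → q) × (L → q)) (a : L) :
    splitConfig e σ (e (Sum.inr a)) = σ.2 a := by
  simp [splitConfig, Equiv.arrowCongr_apply, Equiv.sumArrowEquivProdArrow]

variable {L : Type*} [Fintype L] [DecidableEq L]

theorem siteOp_submatrix_inl (e : L ⊕ L ≃ Λ) (A : Matrix q q ℂ) (a : L) :
    (siteOp A (e (Sum.inl a))).submatrix (splitConfig e) (splitConfig e) = siteOp A a ⊗ₖ 1 := by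
  ext σ τ
  rw [Matrix.submatrix_apply, siteOp_apply, Matrix.kronecker_apply, siteOp_apply, Matrix.one_apply,
    splitConfig_inl, splitConfig_inl, mul_ite, mul_one, mul_zero]
  have : (∀ y, y ≠ e (Sum.inl a) → splitConfig e σ y = splitConfig e τ y) ↔
      (∀ y, y ≠ a → σ.1 y = τ.1 y) ∧ σ.2 = τ.2 := by
    constructor
    · intro h
      refine ⟨fun y hy => ?_, funext fun y => ?_⟩
      · simpa using h (e (Sum.inl y)) (by simpa using hy)
      · simpa using h (e (Sum.inr y)) (by simp)
    · rintro ⟨h1, h2⟩ y hy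
      obtain ⟨z, rfl⟩ := e.surjective y
      rcases z with z | z
      · simpa using h1 z (by simpa using hy)
      · simp [h2]
  simp only [this]
  split_ifs <;> simp_all

theorem siteOp_submatrix_inr (e : L ⊕ L ≃ Λ) (A : Matrix q q ℂ) (a : L) :
    (siteOp A (e (Sum.inr a))).submatrix (splitConfig e) (splitConfig e) = 1 ⊗ₖ siteOp A a := by
  ext σ τ
  rw [Matrix.submatrix_apply, siteOp_apply, Matrix.kronecker_apply, siteOp_apply, Matrix.one_apply,
    splitConfig_inr, splitConfig_inr, ite_mul, one_mul, zero_mul]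
  have : (∀ y, y ≠ e (Sum.inr a) → splitConfig e σ y = splitConfig e τ y) ↔
      σ.1 = τ.1 ∧ (∀ y, y ≠ a → σ.2 y = τ.2 y) := by
    constructor
    · intro h
      refine ⟨funext fun y => ?_, fun y hy => ?_⟩
      · simpa using h (e (Sum.inl y)) (by simp)
      · simpa using h (e (Sum.inr y)) (by simpa using hy)
    · rintro ⟨h1, h2⟩ y hy
      obtain ⟨z, rfl⟩ := e.surjective y
      rcases z with z | z
      · simp [h1]
      · simpa using h2 z (by simpa using hy)
  simp only [this]
  split_ifs <;> simp_all

end SiteOperators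

end

section

set_option linter.unusedSectionVars false
open scoped Matrix.Norms.Operator Kronecker
open NormedSpace Filter Topology

section Domination

/-- The configuration on `Λ` that equals `f` on both halves. -/
def double {Λ L β : Type*} (e : L ⊕ L ≃ Λ) (f : L → β) (x : Λ) : β := (e.symm x).elim f f

@[simp] theorem double_inl {Λ L β : Type*} (e : L ⊕ L ≃ Λ) (f : L → β) (a : L) :
    double e f (e (Sum.inl a)) = f a := by simp [double]

@[simp] theorem double_inr {Λ L β : Type*} (e : L ⊕ L ≃ Λ) (f : L → β) (a : L) :
    double e f (e (Sum.inr a)) = f a := by simp [double]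

theorem sum_sum_split {Λ L M : Type*} [Fintype Λ] [Fintype L] [AddCommMonoid M] (e : L ⊕ L ≃ Λ)
    (g : Λ → Λ → M) : ∑ x, ∑ y, g x y =
      ((∑ a, ∑ b, g (e (Sum.inl a)) (e (Sum.inl b))) +
        ∑ a, ∑ b, g (e (Sum.inl a)) (e (Sum.inr b))) +
      ((∑ a, ∑ b, g (e (Sum.inr a)) (e (Sum.inl b))) +
        ∑ a, ∑ b, g (e (Sum.inr a)) (e (Sum.inr b))) := by
  have h : ∀ x, ∑ y, g x y = (∑ b, g x (e (Sum.inl b))) + ∑ b, g x (e (Sum.inr b)) := by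
    intro x
    rw [← e.sum_comp, Fintype.sum_sum_type]
  rw [← e.sum_comp, Fintype.sum_sum_type]
  simp only [h, Finset.sum_add_distrib]

/-- The number of ordered adjacent pairs at which `v` takes different values. -/
noncomputable def unequalPairs {Λ : Type*} [Fintype Λ] (adj : Λ → Λ → Prop) (v : Λ → ℝ) : ℕ :=
  open Classical in ∑ x, ∑ y, if adj x y ∧ v x ≠ v y then 1 else 0

theorem unequalPairs_split {Λ L : Type*} [Fintype Λ] [Fintype L] (adj : Λ → Λ → Prop)
    (e : L ⊕ L ≃ Λ)
    (h2 : ∀ a b, adj (e (Sum.inl a)) (e (Sum.inl b)) ↔ adj (e (Sum.inr a)) (e (Sum.inr b)))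
    (h3 : ∀ a b, adj (e (Sum.inl a)) (e (Sum.inr b)) → a = b)
    (h3' : ∀ a b, adj (e (Sum.inr a)) (e (Sum.inl b)) → a = b)
    (v : Λ → ℝ) (a : L) (ha : adj (e (Sum.inl a)) (e (Sum.inr a)))
    (hv : v (e (Sum.inl a)) ≠ v (e (Sum.inr a))) :
    unequalPairs adj (double e fun b => v (e (Sum.inl b))) +
      unequalPairs adj (double e fun b => v (e (Sum.inr b))) < 2 * unequalPairs adj v := by
  classical
  have split : ∀ w : Λ → ℝ, unequalPairs adj w =
      ((∑ a, ∑ b, if adj (e (Sum.inl a)) (e (Sum.inl b)) ∧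
          w (e (Sum.inl a)) ≠ w (e (Sum.inl b)) then 1 else 0) +
        ∑ a, ∑ b, if adj (e (Sum.inl a)) (e (Sum.inr b)) ∧
          w (e (Sum.inl a)) ≠ w (e (Sum.inr b)) then 1 else 0) +
      ((∑ a, ∑ b, if adj (e (Sum.inr a)) (e (Sum.inl b)) ∧
          w (e (Sum.inr a)) ≠ w (e (Sum.inl b)) then 1 else 0) +
        ∑ a, ∑ b, if adj (e (Sum.inr a)) (e (Sum.inr b)) ∧
          w (e (Sum.inr a)) ≠ w (e (Sum.inr b)) then 1 else 0) := by
    intro w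
    rw [unequalPairs, sum_sum_split e]
  rw [split v, split (double e _), split (double e _)]
  simp only [double_inl, double_inr, ← h2]
  have z1 : ∀ f : L → ℝ, (∑ a, ∑ b, if adj (e (Sum.inl a)) (e (Sum.inr b)) ∧ f a ≠ f b
      then 1 else 0) = 0 := by
    intro f
    refine Finset.sum_eq_zero fun a _ => Finset.sum_eq_zero fun b _ => if_neg ?_
    rintro ⟨h, h'⟩
    exact h' (by rw [h3 a b h])
  have z2 : ∀ f : L → ℝ, (∑ a, ∑ b, if adj (e (Sum.inr a)) (e (Sum.inl b)) ∧ f a ≠ f b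
      then 1 else 0) = 0 := by
    intro f
    refine Finset.sum_eq_zero fun a _ => Finset.sum_eq_zero fun b _ => if_neg ?_
    rintro ⟨h, h'⟩
    exact h' (by rw [h3' a b h])
  have pos : 0 < ∑ a, ∑ b, if adj (e (Sum.inl a)) (e (Sum.inr b)) ∧
      v (e (Sum.inl a)) ≠ v (e (Sum.inr b)) then 1 else 0 := by
    refine Finset.sum_pos' (fun _ _ => Nat.zero_le _) ⟨a, Finset.mem_univ _, ?_⟩
    refine Finset.sum_pos' (fun _ _ => Nat.zero_le _) ⟨a, Finset.mem_univ _, ?_⟩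
    rw [if_pos ⟨ha, hv⟩]
    exact one_pos
  rw [z1, z1, z2, z2]
  omega

/-- Reflection positivity implies that constant configurations maximise `Z`. -/
theorem le_const_of_reflections {Λ : Type*} [Fintype Λ] [Nonempty Λ] (Z : (Λ → ℝ) → ℝ)
    (hZ : ∀ v, 0 < Z v) (adj : Λ → Λ → Prop)
    (hrefl : ∀ x y, adj x y → x ≠ y → ∃ (L : Type) (_ : Fintype L) (e : L ⊕ L ≃ Λ),
      (∃ a, e (Sum.inl a) = x ∧ e (Sum.inr a) = y) ∧
      (∀ a b, adj (e (Sum.inl a)) (e (Sum.inl b)) ↔ adj (e (Sum.inr a)) (e (Sum.inr b))) ∧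
      (∀ a b, adj (e (Sum.inl a)) (e (Sum.inr b)) → a = b) ∧
      (∀ a b, adj (e (Sum.inr a)) (e (Sum.inl b)) → a = b) ∧
      ∀ v, Z v ^ 2 ≤ Z (double e fun b => v (e (Sum.inl b))) *
        Z (double e fun b => v (e (Sum.inr b))))
    (hconn : ∀ v : Λ → ℝ, (∀ x y, adj x y → v x = v y) → ∀ x y, v x = v y)
    (hconst : ∀ c, Z (fun _ => c) = Z 0) (v : Λ → ℝ) : Z v ≤ Z 0 := by
  classical
  set S : Finset (Λ → ℝ) := Fintype.piFinset fun _ => Finset.univ.image v with hS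
  have hvS : v ∈ S := by simp [hS, Fintype.mem_piFinset]
  obtain ⟨w₀, hw₀S, hw₀⟩ := S.exists_max_image Z ⟨v, hvS⟩
  set S' := S.filter fun w => Z w = Z w₀ with hS'
  obtain ⟨w, hwS', hw⟩ := S'.exists_min_image (unequalPairs adj)
    ⟨w₀, by simp [hS', hw₀S]⟩
  have hwS : w ∈ S := (Finset.mem_filter.mp hwS').1
  have hwZ : Z w = Z w₀ := (Finset.mem_filter.mp hwS').2
  have heq : ∀ x y, adj x y → w x = w y := by
    intro x y hxy
    by_contra hne
    obtain ⟨L, _, e, ⟨a, rfl, rfl⟩, h2, h3, h3', hRP⟩ := hrefl x y hxy (by rintro rfl; exact hne rfl)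
    have hdS : ∀ f : L → Λ, (double e fun b => w (f b)) ∈ S := by
      intro f
      rw [hS, Fintype.mem_piFinset]
      intro x
      obtain ⟨z, rfl⟩ := e.surjective x
      have : ∀ y, w y ∈ Finset.univ.image v := fun y => (Fintype.mem_piFinset.mp hwS) y
      rcases z with z | z <;> simp only [double_inl, double_inr, this]
    have h1 := hw₀ _ (hdS fun b => e (Sum.inl b))
    have h1' := hw₀ _ (hdS fun b => e (Sum.inr b))
    have hR := hRP w
    rw [hwZ] at hR
    have hp := hZ w₀
    have e1 : Z (double e fun b => w (e (Sum.inl b))) = Z w₀ := by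
      refine le_antisymm h1 ?_
      nlinarith [hZ (double e fun b => w (e (Sum.inl b)))]
    have e2 : Z (double e fun b => w (e (Sum.inr b))) = Z w₀ := by
      refine le_antisymm h1' ?_
      nlinarith [hZ (double e fun b => w (e (Sum.inr b)))]
    have m1 := hw _ (Finset.mem_filter.mpr ⟨hdS _, e1⟩)
    have m2 := hw _ (Finset.mem_filter.mpr ⟨hdS _, e2⟩)
    have := unequalPairs_split adj e h2 h3 h3' w a hxy hne
    omega
  have hc : w = fun _ => w (Classical.arbitrary Λ) := funext fun x => hconn w heq _ _
  calc Z v ≤ Z w₀ := hw₀ v hvS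
    _ = Z w := hwZ.symm
    _ = Z 0 := by rw [hc, hconst]

end Domination

section FieldEnergy

variable {q : Type*} [Fintype q] [DecidableEq q] {Λ : Type*} [Fintype Λ] [DecidableEq Λ]
  {ι : Type*} [Fintype ι] [DecidableEq ι]

/-- Two-body interactions with couplings `K` of the one-site operators `T i (v x)`,
plus one-body terms `W (v x)`. -/
noncomputable def fieldEnergy (K : ι → Λ → Λ → ℝ) (T : ι → ℝ → Matrix q q ℂ)
    (W : ℝ → Matrix q q ℂ) (v : Λ → ℝ) : Matrix (Λ → q) (Λ → q) ℂ :=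
  ∑ i, ∑ x, ∑ y, K i x y • (siteOp (T i (v x)) x * siteOp (T i (v y)) y) + ∑ x, siteOp (W (v x)) x

theorem conjMap_fieldEnergy (K : ι → Λ → Λ → ℝ) (T : ι → ℝ → Matrix q q ℂ)
    (W : ℝ → Matrix q q ℂ) (s : ι → ℝ) (hs : ∀ i, s i * s i = 1)
    (hT : ∀ i r, conjMap (T i r) = s i • T i r) (hW : ∀ r, conjMap (W r) = W r) (v : Λ → ℝ) :
    conjMap (fieldEnergy K T W v) = fieldEnergy K T W v := by
  simp only [fieldEnergy, map_add, map_sum, conjMap_smul, map_mul, conjMap_siteOp, hT, hW,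
    siteOp_smul, smul_mul_smul_comm, hs, one_smul]

variable {L : Type*} [Fintype L] [DecidableEq L]

/-- The coupling matrix across a reflection. -/
def crossKernel (s : ι → ℝ) (KC : ι → L → L → ℝ) : Matrix (ι × L) (ι × L) ℝ :=
  Matrix.of fun p p' => if p.1 = p'.1 then 2 * s p.1 * KC p.1 p.2 p'.2 else 0

theorem crossKernel_posSemidef (s : ι → ℝ) (KC : ι → L → L → ℝ)
    (hsymm : ∀ i a b, KC i a b = KC i b a)
    (hpos : ∀ i (f : L → ℝ), 0 ≤ ∑ a, ∑ b, f a * f b * (s i * KC i a b)) :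
    (crossKernel s KC).PosSemidef := by
  refine Matrix.PosSemidef.of_dotProduct_mulVec_nonneg ?_ fun f => ?_
  · ext ⟨i, a⟩ ⟨j, b⟩
    simp only [crossKernel, Matrix.conjTranspose_apply, Matrix.of_apply, star_trivial]
    by_cases h : i = j
    · subst h; simp [hsymm i a b]
    · rw [if_neg h, if_neg (Ne.symm h)]
  · have : star f ⬝ᵥ (crossKernel s KC).mulVec f =
        ∑ i, 2 * ∑ a, ∑ b, f (i, a) * f (i, b) * (s i * KC i a b) := by
      simp only [dotProduct, Matrix.mulVec, crossKernel, Matrix.of_apply, Fintype.sum_prod_type,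
        Pi.star_apply, star_trivial, ite_mul, zero_mul]
      refine Finset.sum_congr rfl fun i _ => ?_
      rw [Finset.mul_sum]
      refine Finset.sum_congr rfl fun a _ => ?_
      rw [Finset.sum_eq_single i]
      · simp only [if_true, Finset.mul_sum]
        refine Finset.sum_congr rfl fun b _ => ?_
        ring
      · intro j _ hj
        simp [Ne.symm hj]
      · simp
    rw [this]
    exact Finset.sum_nonneg fun i _ => mul_nonneg two_pos.le (hpos i fun a => f (i, a))

theorem fieldEnergy_submatrix (e : L ⊕ L ≃ Λ) (K : ι → Λ → Λ → ℝ) (KL KC : ι → L → L → ℝ)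
    (hLL : ∀ i a b, K i (e (Sum.inl a)) (e (Sum.inl b)) = KL i a b)
    (hRR : ∀ i a b, K i (e (Sum.inr a)) (e (Sum.inr b)) = KL i a b)
    (hLR : ∀ i a b, K i (e (Sum.inl a)) (e (Sum.inr b)) = KC i a b)
    (hRL : ∀ i a b, K i (e (Sum.inr a)) (e (Sum.inl b)) = KC i b a)
    (T : ι → ℝ → Matrix q q ℂ) (W : ℝ → Matrix q q ℂ) (s : ι → ℝ) (hs : ∀ i, s i * s i = 1)
    (hT : ∀ i r, conjMap (T i r) = s i • T i r) (hW : ∀ r, conjMap (W r) = W r) (v : Λ → ℝ) :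
    (fieldEnergy K T W v).submatrix (splitConfig e) (splitConfig e) =
      kernelCoupled (crossKernel s KC) (fieldEnergy KL T W fun a => v (e (Sum.inl a)))
        (fieldEnergy KL T W fun a => v (e (Sum.inr a)))
        (fun p => siteOp (T p.1 (v (e (Sum.inl p.2)))) p.2)
        (fun p => siteOp (T p.1 (v (e (Sum.inr p.2)))) p.2) := by
  set R : Matrix (Λ → q) (Λ → q) ℂ →+* Matrix ((L → q) × (L → q)) ((L → q) × (L → q)) ℂ :=
    RingHomClass.toRingHom (Matrix.reindexAlgEquiv ℝ ℂ (splitConfig e).symm) with hR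
  have hRap : ∀ M, M.submatrix (splitConfig e) (splitConfig e) = R M := fun M => rfl
  have hRs : ∀ (r : ℝ) M, R (r • M) = r • R M := fun r M => rfl
  have hl : ∀ A a, R (siteOp A (e (Sum.inl a))) = siteOp A a ⊗ₖ 1 :=
    fun A a => siteOp_submatrix_inl e A a
  have hr : ∀ A a, R (siteOp A (e (Sum.inr a))) = 1 ⊗ₖ siteOp A a :=
    fun A a => siteOp_submatrix_inr e A a
  rw [kernelCoupled, conjMap_fieldEnergy KL T W s hs hT hW]
  have hcross : ∑ p, ∑ p', crossKernel s KC p p' •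
      (siteOp (T p.1 (v (e (Sum.inl p.2)))) p.2 ⊗ₖ
        conjMap (siteOp (T p'.1 (v (e (Sum.inr p'.2)))) p'.2)) =
      ∑ i, ∑ a, ∑ b, (2 * KC i a b) • (siteOp (T i (v (e (Sum.inl a)))) a ⊗ₖ
        siteOp (T i (v (e (Sum.inr b)))) b) := by
    rw [Fintype.sum_prod_type]
    refine Finset.sum_congr rfl fun i _ => Finset.sum_congr rfl fun a _ => ?_
    rw [Fintype.sum_prod_type, Finset.sum_eq_single i]
    · refine Finset.sum_congr rfl fun b _ => ?_
      rw [conjMap_siteOp, hT, siteOp_smul, Matrix.kronecker_smul, smul_smul]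
      congr 1
      simp only [crossKernel, Matrix.of_apply, if_true]
      rw [mul_right_comm, mul_assoc 2, hs]
      ring
    · intro j _ hj
      refine Finset.sum_eq_zero fun b _ => ?_
      simp [crossKernel, Ne.symm hj]
    · simp
  rw [hcross, hRap]
  simp only [fieldEnergy, map_add, map_sum, hRs, map_mul]
  have hsite : ∑ x, R (siteOp (W (v x)) x) =
      ∑ a, siteOp (W (v (e (Sum.inl a)))) a ⊗ₖ 1 + ∑ a, 1 ⊗ₖ siteOp (W (v (e (Sum.inr a)))) a := by
    rw [← e.sum_comp, Fintype.sum_sum_type]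
    simp only [hl, hr]
  have hpair : ∀ i, ∑ x, ∑ y, K i x y • (R (siteOp (T i (v x)) x) * R (siteOp (T i (v y)) y)) =
      ∑ a, ∑ b, KL i a b • ((siteOp (T i (v (e (Sum.inl a)))) a *
          siteOp (T i (v (e (Sum.inl b)))) b) ⊗ₖ 1) +
      ∑ a, ∑ b, KL i a b • (1 ⊗ₖ (siteOp (T i (v (e (Sum.inr a)))) a *
          siteOp (T i (v (e (Sum.inr b)))) b)) +
      ∑ a, ∑ b, (2 * KC i a b) • (siteOp (T i (v (e (Sum.inl a)))) a ⊗ₖ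
        siteOp (T i (v (e (Sum.inr b)))) b) := by
    intro i
    rw [sum_sum_split e]
    simp only [hl, hr, hLL, hRR, hLR, hRL, ← Matrix.mul_kronecker_mul, one_mul,
      mul_one, Finset.sum_add_distrib, two_mul, add_smul]
    rw [Finset.sum_comm (f := fun a b => KC i b a • (siteOp (T i (v (e (Sum.inl b)))) b ⊗ₖ
      siteOp (T i (v (e (Sum.inr a)))) a))]
    abel
  rw [hsite]
  simp only [hpair, Matrix.add_kronecker, Matrix.kronecker_add, sum_kronecker, kronecker_sum, Matrix.smul_kronecker,
    Matrix.kronecker_smul, Finset.sum_add_distrib]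
  abel

theorem trace_exp_fieldEnergy_sq_le [Nonempty q] (e : L ⊕ L ≃ Λ) (K : ι → Λ → Λ → ℝ)
    (hLR : ∀ i a b, K i (e (Sum.inl a)) (e (Sum.inl b)) = K i (e (Sum.inr a)) (e (Sum.inr b)))
    (hsymm : ∀ i x y, K i x y = K i y x)
    (hcross : ∀ i a b, K i (e (Sum.inl a)) (e (Sum.inr b)) = K i (e (Sum.inl b)) (e (Sum.inr a)))
    (T : ι → ℝ → Matrix q q ℂ) (W : ℝ → Matrix q q ℂ) (s : ι → ℝ) (hs : ∀ i, s i * s i = 1)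
    (hT : ∀ i r, conjMap (T i r) = s i • T i r) (hW : ∀ r, conjMap (W r) = W r)
    (hpos : ∀ i (f : L → ℝ),
      0 ≤ ∑ a, ∑ b, f a * f b * (s i * K i (e (Sum.inl a)) (e (Sum.inr b))))
    (v : Λ → ℝ) :
    (exp (fieldEnergy K T W v)).trace.re ^ 2 ≤
      (exp (fieldEnergy K T W (double e fun a => v (e (Sum.inl a))))).trace.re *
      (exp (fieldEnergy K T W (double e fun a => v (e (Sum.inr a))))).trace.re := by
  set KL : ι → L → L → ℝ := fun i a b => K i (e (Sum.inl a)) (e (Sum.inl b)) with hKL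
  set KC : ι → L → L → ℝ := fun i a b => K i (e (Sum.inl a)) (e (Sum.inr b)) with hKC
  have hsplit : ∀ w : Λ → ℝ, (exp (fieldEnergy K T W w)).trace =
      (exp (kernelCoupled (crossKernel s KC) (fieldEnergy KL T W fun a => w (e (Sum.inl a)))
        (fieldEnergy KL T W fun a => w (e (Sum.inr a)))
        (fun p => siteOp (T p.1 (w (e (Sum.inl p.2)))) p.2)
        (fun p => siteOp (T p.1 (w (e (Sum.inr p.2)))) p.2))).trace := by
    intro w
    rw [← fieldEnergy_submatrix e K KL KC (fun _ _ _ => rfl) (fun i a b => (hLR i a b).symm)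
      (fun _ _ _ => rfl) (fun i a b => hsymm _ _ _) T W s hs hT hW w, exp_submatrix_equiv,
      trace_submatrix_equiv]
  have key := norm_trace_exp_kernelCoupled_sq_le
    (crossKernel_posSemidef s KC (fun i a b => hcross i a b) hpos)
    (fieldEnergy KL T W fun a => v (e (Sum.inl a)))
    (fieldEnergy KL T W fun a => v (e (Sum.inr a)))
    (fun p : ι × L => siteOp (T p.1 (v (e (Sum.inl p.2)))) p.2)
    (fun p : ι × L => siteOp (T p.1 (v (e (Sum.inr p.2)))) p.2)
  rw [← hsplit v] at key
  rw [hsplit (double e _), hsplit (double e _)]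
  simp only [double_inl, double_inr]
  refine le_trans ?_ key
  exact sq_le_sq' (by linarith [neg_abs_le (exp (fieldEnergy K T W v)).trace.re,
    Complex.abs_re_le_norm (exp (fieldEnergy K T W v)).trace])
    (Complex.re_le_norm _)

end FieldEnergy

end

section

set_option linter.unusedSectionVars false
open Filter Topology

section Averaging

variable {κ : Type*} [Fintype κ] [DecidableEq κ]

/-- The cube `{0, …, R-1}^κ`. -/
noncomputable def cube (κ : Type*) [Fintype κ] [DecidableEq κ] (R : ℕ) : Finset (κ → ℤ) :=
  Fintype.piFinset fun _ => Finset.Ico (0 : ℤ) R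

theorem card_cube (R : ℕ) : (cube κ R).card = R ^ Fintype.card κ := by
  simp [cube, Fintype.card_piFinset]

theorem tendsto_cube_inter (w : κ → ℤ) :
    Tendsto (fun R : ℕ => (((cube κ (R + 1)).filter fun z => z - w ∈ cube κ (R + 1)).card : ℝ) /
      (cube κ (R + 1)).card) atTop (𝓝 1) := by
  have hfil : ∀ R : ℕ, (cube κ R).filter (fun z => z - w ∈ cube κ R) =
      Fintype.piFinset fun i => Finset.Ico (max 0 (w i)) (min (R : ℤ) (R + w i)) := by
    intro R
    ext z
    simp only [cube, Finset.mem_filter, Fintype.mem_piFinset, Finset.mem_Ico, Pi.sub_apply,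
      max_le_iff, lt_min_iff]
    constructor
    · rintro ⟨h1, h2⟩ i
      have := h1 i; have := h2 i
      omega
    · intro h
      exact ⟨fun i => by have := h i; omega, fun i => by have := h i; omega⟩
  have h1 : ∀ R : ℕ, (((cube κ (R + 1)).filter fun z => z - w ∈ cube κ (R + 1)).card : ℝ) /
      (cube κ (R + 1)).card = ∏ i, (((R : ℤ) + 1 - |w i|).toNat : ℝ) / ((R : ℝ) + 1) := by
    intro R
    rw [hfil, card_cube, Fintype.card_piFinset, Finset.prod_div_distrib]
    push_cast
    congr 1
    · refine Finset.prod_congr rfl fun i _ => ?_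
      rw [Int.card_Ico]
      congr 2
      rcases abs_cases (w i) with h | h <;> omega
    · simp
  simp only [h1]
  suffices key : Tendsto (fun R : ℕ => ∏ i, (((R : ℤ) + 1 - |w i|).toNat : ℝ) / ((R : ℝ) + 1))
      atTop (𝓝 (∏ _i : κ, (1 : ℝ))) by simpa using key
  refine tendsto_finsetProd _ fun i _ => ?_
  have h2 : Tendsto (fun R : ℕ => 1 - (|w i| : ℤ) * (1 / ((R : ℝ) + 1))) atTop (𝓝 1) := by
    simpa using (tendsto_one_div_add_atTop_nhds_zero_nat (𝕜 := ℝ)).const_mul ((|w i| : ℤ) : ℝ)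
      |>.const_sub 1
  refine h2.congr' ?_
  filter_upwards [eventually_ge_atTop (|w i|.toNat)] with R hR
  have h3 : ((((R : ℤ) + 1 - |w i|).toNat : ℤ) : ℝ) = (((R : ℤ) + 1 - |w i| : ℤ) : ℝ) := by
    congr 1
    omega
  have h4 : ((((R : ℤ) + 1 - |w i|).toNat : ℕ) : ℝ) = (R : ℝ) + 1 - ((|w i| : ℤ) : ℝ) := by
    rw [← Int.cast_natCast (R := ℝ), h3]; push_cast; ring
  rw [h4]
  have : (R : ℝ) + 1 ≠ 0 := by positivity
  field_simp

/-- A summable function on `ℤ^κ` that is nonnegative on average over cubes has nonnegative sum. -/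
theorem tsum_nonneg_of_cube_sums (g : (κ → ℤ) → ℝ) (hg : Summable g)
    (h : ∀ R : ℕ, 0 ≤ ∑ z ∈ cube κ R, ∑ z' ∈ cube κ R, g (z - z')) : 0 ≤ ∑' z, g z := by
  set c : ℕ → (κ → ℤ) → ℝ := fun R w =>
    (((cube κ (R + 1)).filter fun z => z - w ∈ cube κ (R + 1)).card : ℝ) / (cube κ (R + 1)).card
    with hc
  have hc1 : ∀ R w, c R w ≤ 1 := by
    intro R w
    refine div_le_one_of_le₀ ?_ (Nat.cast_nonneg _)
    exact_mod_cast Finset.card_filter_le _ _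
  have hc0 : ∀ R w, 0 ≤ c R w := fun R w => by positivity
  have hlim : Tendsto (fun R => ∑' w, c R w * g w) atTop (𝓝 (∑' w, g w)) := by
    refine tendsto_tsum_of_dominated_convergence (bound := fun w => ‖g w‖) hg.norm
      (fun w => ?_) (Eventually.of_forall fun R w => ?_)
    · simpa using (tendsto_cube_inter w).mul_const (g w)
    · rw [norm_mul, Real.norm_of_nonneg (hc0 R w)]
      exact mul_le_of_le_one_left (norm_nonneg _) (hc1 R w)
  refine ge_of_tendsto' hlim fun R => ?_
  set B := cube κ (R + 1) with hB
  have h1 : ∀ z, ∑ z' ∈ B, g (z - z') = ∑' w, if z - w ∈ B then g w else 0 := by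
    intro z
    have e1 : ∑ z' ∈ B, g (z - z') = ∑ z' ∈ B, if z' ∈ B then g (z - z') else 0 :=
      Finset.sum_congr rfl fun z' hz' => by rw [if_pos hz']
    rw [e1, ← (Equiv.subLeft z).tsum_eq, tsum_eq_sum (s := B)]
    · refine Finset.sum_congr rfl fun z' _ => ?_
      simp
    · intro b hb; simp [hb]
  have hs : ∀ z, Summable fun w => if z - w ∈ B then g w else 0 := by
    intro z
    exact hg.indicator {w | z - w ∈ B} |>.congr fun w => by simp [Set.indicator]
  have h2 : ∑ z ∈ B, ∑ z' ∈ B, g (z - z') =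
      ∑' w, ((B.filter fun z => z - w ∈ B).card : ℝ) * g w := by
    simp only [h1]
    rw [← Summable.tsum_finsetSum fun z _ => hs z]
    refine tsum_congr fun w => ?_
    rw [Finset.card_filter, Nat.cast_sum, Finset.sum_mul]
    refine Finset.sum_congr rfl fun z _ => ?_
    split_ifs <;> simp
  have h3 : ∑' w, c R w * g w = (B.card : ℝ)⁻¹ * ∑ z ∈ B, ∑ z' ∈ B, g (z - z') := by
    rw [h2, ← tsum_mul_left]
    refine tsum_congr fun w => ?_
    simp only [hc]
    ring
  rw [h3]
  exact mul_nonneg (by positivity) (h (R + 1))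

end Averaging

section TorusReflection

variable {d : ℕ}

/-- The difference of `x` and the reflection of `y` in the hyperplane `x_j = -1/2`, up to sign
of the `j`-th coordinate. -/
def reflDiff (j : Fin d) (x y : Fin d → ℤ) : Fin d → ℤ :=
  fun i => if i = j then x i + y i + 1 else x i - y i

/-- Reflection positivity of a translation-invariant coupling on `ℤ^d`. -/
def LatticeRP (J : (Fin d → ℤ) → ℝ) : Prop :=
  ∀ (j : Fin d) (α : Type) [Fintype α] (X : α → Fin d → ℤ), (∀ a, 0 ≤ X a j) →
    ∀ f : α → ℝ, 0 ≤ ∑ a, ∑ b, f a * f b * J (reflDiff j (X a) (X b))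

/-- Invariance under `x_j ↦ -x_j`. -/
def FlipInvariant (J : (Fin d → ℤ) → ℝ) : Prop :=
  ∀ (j : Fin d) (x : Fin d → ℤ), J (Function.update x j (-x j)) = J x

theorem injective_add_smul {ℓ : ℕ} (hℓ : 0 < ℓ) (u : Fin d → ℤ) :
    Function.Injective fun z : Fin d → ℤ => u + (ℓ : ℤ) • z := by
  intro z z' h
  have h : (ℓ : ℤ) • z = (ℓ : ℤ) • z' := add_left_cancel h
  have hne : (ℓ : ℤ) ≠ 0 := by exact_mod_cast hℓ.ne'
  funext i
  have := congrFun h i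
  simp only [Pi.smul_apply, smul_eq_mul] at this
  exact mul_left_cancel₀ hne this

theorem summable_periodise {J : (Fin d → ℤ) → ℝ} (hs : Summable J) {ℓ : ℕ} (hℓ : 0 < ℓ)
    (u : Fin d → ℤ) : Summable fun z : Fin d → ℤ => J (u + (ℓ : ℤ) • z) :=
  hs.comp_injective (injective_add_smul hℓ u)

/-- The lattice point with `j`-th coordinate `n` and other coordinates `z`. -/
def extendAt (j : Fin d) (n : ℤ) (z : {i // i ≠ j} → ℤ) : Fin d → ℤ :=
  (Equiv.funSplitAt j ℤ).symm (n, z)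

theorem extendAt_self (j : Fin d) (n : ℤ) (z : {i // i ≠ j} → ℤ) : extendAt j n z j = n := by
  simp [extendAt]

theorem extendAt_of_ne (j : Fin d) (n : ℤ) (z : {i // i ≠ j} → ℤ) {i : Fin d} (hi : i ≠ j) :
    extendAt j n z i = z ⟨i, hi⟩ := by
  simp [extendAt, hi]

theorem layer_nonneg {J : (Fin d → ℤ) → ℝ} (hs : Summable J) (hRP : LatticeRP J) {h : ℕ}
    (hh : 0 < h) (j : Fin d) {α : Type} [Fintype α] (X : α → Fin d → ℤ) (hX : ∀ a, 0 ≤ X a j)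
    (f : α → ℝ) (n : ℤ) (hn : 0 ≤ n) :
    0 ≤ ∑' z : {i // i ≠ j} → ℤ, ∑ a, ∑ b,
      f a * f b * J (reflDiff j (X a) (X b) + ((h + h : ℕ) : ℤ) • extendAt j n z) := by
  have hinj : Function.Injective (extendAt j n) := by
    intro z z' hz
    have := (Equiv.funSplitAt j ℤ).symm.injective hz
    simpa using this
  apply tsum_nonneg_of_cube_sums
  · refine summable_sum fun a _ => summable_sum fun b _ => Summable.mul_left _ ?_
    exact (summable_periodise hs (by omega : 0 < h + h) _).comp_injective hinj
  · intro R
    set B := cube {i // i ≠ j} R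
    have key := hRP j (α × B) (fun p => extendAt j (X p.1 j + h * n)
      fun i => X p.1 i + (h + h : ℕ) * (p.2 : {i // i ≠ j} → ℤ) i)
      (fun p => by rw [extendAt_self]; have := hX p.1; positivity) (fun p => f p.1)
    have e1 : ∀ (a b : α) (z z' : {i // i ≠ j} → ℤ), reflDiff j
        (extendAt j (X a j + h * n) fun i => X a i + (h + h : ℕ) * z i)
        (extendAt j (X b j + h * n) fun i => X b i + (h + h : ℕ) * z' i) =
        reflDiff j (X a) (X b) + ((h + h : ℕ) : ℤ) • extendAt j n (z - z') := by
      intro a b z z'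
      funext i
      by_cases hi : i = j
      · subst hi
        simp only [reflDiff, extendAt_self, if_true, Pi.add_apply, Pi.smul_apply, smul_eq_mul]
        push_cast; ring
      · simp only [reflDiff, if_neg hi, extendAt_of_ne j _ _ hi, Pi.add_apply, Pi.smul_apply,
          smul_eq_mul, Pi.sub_apply]
        push_cast; ring
    simp only [e1] at key
    refine key.trans (le_of_eq ?_)
    rw [Fintype.sum_prod_type_right]
    simp only [Fintype.sum_prod_type_right (f := fun p : α × B => _)]
    rw [← Finset.sum_coe_sort B]
    refine Finset.sum_congr rfl fun z _ => ?_
    rw [← Finset.sum_coe_sort B, Finset.sum_comm]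

/-- Reflection positivity of the periodised coupling on an even torus. -/
theorem periodise_reflDiff_nonneg {J : (Fin d → ℤ) → ℝ} (hs : Summable J) (hRP : LatticeRP J)
    (hflip : FlipInvariant J) {h : ℕ} (hh : 0 < h) (j : Fin d) {α : Type} [Fintype α]
    (X : α → Fin d → ℤ) (hX : ∀ a, 0 ≤ X a j) (hX' : ∀ a, X a j < h) (f : α → ℝ) :
    0 ≤ ∑ a, ∑ b, f a * f b * QSpin.periodise (h + h) J (reflDiff j (X a) (X b)) := by
  have hℓ : 0 < h + h := by omega
  set G : (Fin d → ℤ) → ℝ := fun z => ∑ a, ∑ b,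
    f a * f b * J (reflDiff j (X a) (X b) + ((h + h : ℕ) : ℤ) • z) with hG
  have hGs : Summable G := summable_sum fun a _ => summable_sum fun b _ =>
    Summable.mul_left _ (summable_periodise hs hℓ _)
  have e1 : ∑ a, ∑ b, f a * f b * QSpin.periodise (h + h) J (reflDiff j (X a) (X b)) =
      ∑' z, G z := by
    simp only [hG, QSpin.periodise]
    rw [Summable.tsum_finsetSum fun a _ => summable_sum fun b _ =>
      Summable.mul_left _ (summable_periodise hs hℓ _)]
    refine Finset.sum_congr rfl fun a _ => ?_
    rw [Summable.tsum_finsetSum fun b _ => Summable.mul_left _ (summable_periodise hs hℓ _)]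
    refine Finset.sum_congr rfl fun b _ => ?_
    rw [tsum_mul_left]
  rw [e1, ← (Equiv.funSplitAt j ℤ).symm.tsum_eq]
  have hGs' : Summable fun p : ℤ × ({i // i ≠ j} → ℤ) => G ((Equiv.funSplitAt j ℤ).symm p) :=
    (Equiv.funSplitAt j ℤ).symm.summable_iff.mpr hGs
  rw [hGs'.tsum_prod]
  refine tsum_nonneg fun n => ?_
  rcases le_or_gt 0 n with hn | hn
  · exact layer_nonneg hs hRP hh j X hX f n hn
  · have key := layer_nonneg hs hRP hh j (fun a => Function.update (X a) j (h - 1 - X a j))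
      (fun a => by have := hX' a; simp; omega) f (-n - 1) (by omega)
    refine key.trans (le_of_eq (tsum_congr fun z => ?_))
    simp only [hG]
    refine Finset.sum_congr rfl fun a _ => Finset.sum_congr rfl fun b _ => ?_
    congr 1
    rw [← hflip j (_ + _)]
    congr 1
    funext i
    change _ = (reflDiff j (X a) (X b) + ((h + h : ℕ) : ℤ) • extendAt j n z) i
    by_cases hi : i = j
    · subst hi
      simp only [reflDiff, extendAt_self, if_true, Pi.add_apply, Pi.smul_apply, smul_eq_mul,
        Function.update_self]
      push_cast; ring
    · simp only [reflDiff, if_neg hi, extendAt_of_ne j _ _ hi, Pi.add_apply, Pi.smul_apply,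
        smul_eq_mul, Function.update_of_ne hi]

end TorusReflection

end

section

set_option linter.unusedSectionVars false
open Filter Topology MeasureTheory

section PositiveKernels

variable {α : Type*} [Fintype α]

/-- A real symmetric positive semidefinite kernel on a finite set. -/
def PSDKernel (M : α → α → ℝ) : Prop := (Matrix.of M).PosSemidef

theorem PSDKernel.quad_nonneg {M : α → α → ℝ} (h : PSDKernel M) (f : α → ℝ) :
    0 ≤ ∑ a, ∑ b, f a * f b * M a b := by
  have := h.dotProduct_mulVec_nonneg f
  simp only [dotProduct, Matrix.mulVec, Pi.star_apply, star_trivial, Matrix.of_apply,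
    Finset.mul_sum] at this
  refine this.trans (le_of_eq ?_)
  refine Finset.sum_congr rfl fun a _ => Finset.sum_congr rfl fun b _ => ?_
  ring

theorem PSDKernel.of_quad {M : α → α → ℝ} (hs : ∀ a b, M a b = M b a)
    (h : ∀ f : α → ℝ, 0 ≤ ∑ a, ∑ b, f a * f b * M a b) : PSDKernel M := by
  refine Matrix.PosSemidef.of_dotProduct_mulVec_nonneg ?_ fun f => ?_
  · ext a b
    simp [Matrix.conjTranspose_apply, hs a b]
  · simp only [dotProduct, Matrix.mulVec, Pi.star_apply, star_trivial, Matrix.of_apply,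
      Finset.mul_sum]
    refine (h f).trans (le_of_eq ?_)
    refine Finset.sum_congr rfl fun a _ => Finset.sum_congr rfl fun b _ => ?_
    ring

theorem PSDKernel.symm {M : α → α → ℝ} (h : PSDKernel M) (a b : α) : M a b = M b a := by
  have := h.isHermitian.apply a b
  simpa using this.symm

theorem PSDKernel.rankOne (g : α → ℝ) : PSDKernel fun a b => g a * g b := by
  refine PSDKernel.of_quad (fun a b => mul_comm _ _) fun f => ?_
  have : ∑ a, ∑ b, f a * f b * (g a * g b) = (∑ a, f a * g a) * ∑ b, f b * g b := by
    rw [Finset.sum_mul_sum]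
    refine Finset.sum_congr rfl fun a _ => Finset.sum_congr rfl fun b _ => ?_
    ring
  rw [this]
  exact mul_self_nonneg _

theorem PSDKernel.mul {M N : α → α → ℝ} (hM : PSDKernel M) (hN : PSDKernel N) :
    PSDKernel fun a b => M a b * N a b := Matrix.PosSemidef.hadamard hM hN

theorem PSDKernel.add {M N : α → α → ℝ} (hM : PSDKernel M) (hN : PSDKernel N) :
    PSDKernel fun a b => M a b + N a b := Matrix.PosSemidef.add hM hN

theorem PSDKernel.const_mul {M : α → α → ℝ} (hM : PSDKernel M) {c : ℝ} (hc : 0 ≤ c) :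
    PSDKernel fun a b => c * M a b := by
  have := (PSDKernel.rankOne fun _ : α => Real.sqrt c).mul hM
  simpa [Real.mul_self_sqrt hc] using this

theorem PSDKernel.prod {ι : Type*} (s : Finset ι) {M : ι → α → α → ℝ}
    (h : ∀ i ∈ s, PSDKernel (M i)) : PSDKernel fun a b => ∏ i ∈ s, M i a b := by
  classical
  induction s using Finset.induction_on with
  | empty => simpa using PSDKernel.rankOne fun _ : α => (1 : ℝ)
  | insert i s hi ih =>
    simp only [Finset.prod_insert hi]
    exact (h i (Finset.mem_insert_self _ _)).mul
      (ih fun j hj => h j (Finset.mem_insert_of_mem hj))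

theorem PSDKernel.integral {T : Type*} [MeasurableSpace T] {μ : Measure T} {M : T → α → α → ℝ}
    (hi : ∀ a b, Integrable (fun t => M t a b) μ) (h : ∀ᵐ t ∂μ, PSDKernel (M t)) :
    PSDKernel fun a b => ∫ t, M t a b ∂μ := by
  refine PSDKernel.of_quad (fun a b => ?_) fun f => ?_
  · refine integral_congr_ae ?_
    filter_upwards [h] with t ht using ht.symm a b
  · have : ∑ a, ∑ b, f a * f b * ∫ t, M t a b ∂μ = ∫ t, ∑ a, ∑ b, f a * f b * M t a b ∂μ := by
      rw [integral_finsetSum _ fun a _ => integrable_finsetSum _ fun b _ => (hi a b).const_mul _]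
      refine Finset.sum_congr rfl fun a _ => ?_
      rw [integral_finsetSum _ fun b _ => (hi a b).const_mul _]
      refine Finset.sum_congr rfl fun b _ => ?_
      rw [integral_const_mul]
    rw [this]
    refine integral_nonneg_of_ae ?_
    filter_upwards [h] with t ht using ht.quad_nonneg f

theorem PSDKernel.exp_min (s : α → ℝ) : PSDKernel fun a b => Real.exp (min (s a) (s b)) := by
  have h : ∀ a b, Real.exp (min (s a) (s b)) = ∫ t, (Set.Iic (s a)).indicator 1 t *
      (Set.Iic (s b)).indicator 1 t * Real.exp t := by
    intro a b
    rw [← integral_exp_Iic, ← integral_indicator measurableSet_Iic]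
    refine integral_congr_ae (Eventually.of_forall fun t => ?_)
    simp only [Set.indicator, Set.mem_Iic, le_min_iff]
    by_cases h1 : t ≤ s a <;> by_cases h2 : t ≤ s b <;> simp [h1, h2]
  simp only [h]
  refine PSDKernel.integral (fun a b => ?_) (Eventually.of_forall fun t => ?_)
  · have := (integrable_indicator_iff measurableSet_Iic).mpr
      (integrableOn_exp_Iic (min (s a) (s b)))
    refine this.congr (Eventually.of_forall fun t => ?_)
    simp only [Set.indicator, Set.mem_Iic, le_min_iff]
    by_cases h1 : t ≤ s a <;> by_cases h2 : t ≤ s b <;> simp [h1, h2]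
  · have := (PSDKernel.rankOne fun a => (Set.Iic (s a)).indicator (1 : ℝ → ℝ) t).const_mul
      (Real.exp_pos t).le
    simpa [mul_comm] using this

theorem PSDKernel.exp_neg_abs_sub (s : α → ℝ) :
    PSDKernel fun a b => Real.exp (-|s a - s b|) := by
  have h : ∀ a b, Real.exp (-|s a - s b|) =
      (Real.exp (-s a) * Real.exp (-s b)) * Real.exp (min (2 * s a) (2 * s b)) := by
    intro a b
    rw [← Real.exp_add, ← Real.exp_add]
    congr 1
    rcases le_total (s a) (s b) with h | h
    · rw [min_eq_left (by linarith), abs_of_nonpos (by linarith)]; ring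
    · rw [min_eq_right (by linarith), abs_of_nonneg (by linarith)]; ring
  simp only [h]
  exact (PSDKernel.rankOne fun a => Real.exp (-s a)).mul (PSDKernel.exp_min fun a => 2 * s a)

theorem PSDKernel.exp_neg_mul_add (x : α → ℝ) (t : ℝ) :
    PSDKernel fun a b => Real.exp (-(t * (x a + x b))) := by
  have := PSDKernel.rankOne fun a => Real.exp (-(t * x a))
  refine (congrArg PSDKernel ?_).mp this
  funext a b
  rw [← Real.exp_add]; ring_nf

theorem integrableOn_rpow_mul_exp {s r : ℝ} (hs : 0 < s) (hr : 0 < r) :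
    IntegrableOn (fun t : ℝ => t ^ (s - 1) * Real.exp (-(r * t))) (Set.Ioi 0) := by
  have := integrableOn_rpow_mul_exp_neg_mul_rpow (p := 1) (s := s - 1) (b := r) (by linarith)
    one_pos hr
  simpa using this

/-- `k ^ (-s)` is positive semidefinite if all `exp (-t k)` are. -/
theorem PSDKernel.rpow_neg {k : α → α → ℝ} (hk : ∀ a b, 0 < k a b) {s : ℝ} (hs : 0 < s)
    (h : ∀ t : ℝ, 0 < t → PSDKernel fun a b => Real.exp (-(k a b * t))) :
    PSDKernel fun a b => k a b ^ (-s) := by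
  have e : ∀ a b, k a b ^ (-s) =
      (Real.Gamma s)⁻¹ * ∫ t in Set.Ioi (0 : ℝ), t ^ (s - 1) * Real.exp (-(k a b * t)) := by
    intro a b
    rw [Real.integral_rpow_mul_exp_neg_mul_Ioi hs (hk a b), one_div, Real.inv_rpow (hk a b).le,
      Real.rpow_neg (hk a b).le]
    have := (Real.Gamma_pos_of_pos hs).ne'
    field_simp
  simp only [e]
  refine PSDKernel.const_mul (PSDKernel.integral (fun a b => integrableOn_rpow_mul_exp hs (hk a b))
    ?_) (inv_nonneg.mpr (Real.Gamma_pos_of_pos hs).le)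
  filter_upwards [ae_restrict_mem measurableSet_Ioi] with t ht
  exact (h t ht).const_mul (Real.rpow_nonneg (le_of_lt ht) _)

theorem PSDKernel.add_rpow_neg (x : α → ℝ) (hx : ∀ a, 0 < x a) {s : ℝ} (hs : 0 < s) :
    PSDKernel fun a b => (x a + x b) ^ (-s) := by
  refine PSDKernel.rpow_neg (fun a b => add_pos (hx a) (hx b)) hs fun t _ => ?_
  have := PSDKernel.exp_neg_mul_add x t
  refine (congrArg PSDKernel ?_).mp this
  funext a b
  rw [mul_comm]

/-- `∫ t ^ (ν - 1) exp (-t X² - E² / 4t) dt`, a Bessel-type integral. -/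
noncomputable def besselIntegral (ν E X : ℝ) : ℝ :=
  ∫ t in Set.Ioi (0 : ℝ), t ^ (ν - 1) * Real.exp (-(X ^ 2 * t) - E ^ 2 / (4 * t))

theorem besselIntegral_eq {ν E X : ℝ} (hE : 0 < E) (hX : 0 < X) :
    besselIntegral ν E X = (E / 2) ^ ν * (X ^ (-ν) *
      ∫ t in Set.Ioi (0 : ℝ), t ^ (ν - 1) * Real.exp (-(E / 2 * (t + 1 / t) * X))) := by
  have hb : 0 < E / (2 * X) := by positivity
  have h := integral_comp_mul_left_Ioi
    (fun t : ℝ => t ^ (ν - 1) * Real.exp (-(X ^ 2 * t) - E ^ 2 / (4 * t))) 0 hb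
  rw [mul_zero, smul_eq_mul, ← besselIntegral] at h
  have h2 : besselIntegral ν E X = (E / (2 * X)) * ∫ t in Set.Ioi (0 : ℝ),
      (E / (2 * X) * t) ^ (ν - 1) *
        Real.exp (-(X ^ 2 * (E / (2 * X) * t)) - E ^ 2 / (4 * (E / (2 * X) * t))) := by
    rw [h]; field_simp
  rw [h2, ← integral_const_mul, ← integral_const_mul, ← integral_const_mul]
  refine setIntegral_congr_fun measurableSet_Ioi fun t ht => ?_
  have ht : 0 < t := ht
  have e1 : -(X ^ 2 * (E / (2 * X) * t)) - E ^ 2 / (4 * (E / (2 * X) * t)) =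
      -(E / 2 * (t + 1 / t) * X) := by field_simp; ring
  have e2 : (E / (2 * X) * t) ^ (ν - 1) = (E / (2 * X)) ^ ν / (E / (2 * X)) * t ^ (ν - 1) := by
    rw [Real.mul_rpow hb.le ht.le, Real.rpow_sub_one hb.ne']
  have e3 : (E / (2 * X)) ^ ν = (E / 2) ^ ν * X ^ (-ν) := by
    rw [← div_div, Real.div_rpow (by positivity) hX.le, Real.rpow_neg hX.le, div_eq_mul_inv]
  simp only [e1, e2, e3]
  field_simp

theorem PSDKernel.bessel (x : α → ℝ) (hx : ∀ a, 0 < x a) {ν : ℝ} (hν : 0 < ν) {E : ℝ}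
    (hE : 0 ≤ E) : PSDKernel fun a b => besselIntegral ν E (x a + x b) := by
  have hX : ∀ a b, 0 < x a + x b := fun a b => add_pos (hx a) (hx b)
  rcases hE.eq_or_lt with rfl | hE
  · have : ∀ a b, besselIntegral ν 0 (x a + x b) =
        Real.Gamma ν * ((x a + x b) ^ (-ν) * (x a + x b) ^ (-ν)) := by
      intro a b
      have h := Real.integral_rpow_mul_exp_neg_mul_Ioi hν (pow_pos (hX a b) 2)
      simp only [besselIntegral, ne_eq, OfNat.ofNat_ne_zero, not_false_eq_true, zero_pow, zero_div,
        sub_zero]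
      rw [h, one_div, mul_comm, Real.inv_rpow (by positivity), ← Real.rpow_natCast,
        ← Real.rpow_mul (hX a b).le, ← Real.rpow_add (hX a b), ← Real.rpow_neg (hX a b).le]
      congr 2
      push_cast; ring
    simp only [this]
    exact ((PSDKernel.add_rpow_neg x hx hν).mul (PSDKernel.add_rpow_neg x hx hν)).const_mul
      (Real.Gamma_pos_of_pos hν).le
  · simp only [besselIntegral_eq hE (hX _ _)]
    refine PSDKernel.const_mul ((PSDKernel.add_rpow_neg x hx hν).mul ?_) (by positivity)
    refine PSDKernel.integral (fun a b => ?_) ?_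
    · refine (integrableOn_rpow_mul_exp hν (mul_pos (half_pos hE) (hX a b))).mono' ?_ ?_
      · exact (Measurable.mul (measurable_id.pow_const _) (by fun_prop)).aestronglyMeasurable
      · filter_upwards [ae_restrict_mem measurableSet_Ioi] with t ht
        have ht : 0 < t := ht
        rw [Real.norm_of_nonneg (by positivity)]
        refine mul_le_mul_of_nonneg_left (Real.exp_le_exp.mpr ?_) (by positivity)
        have h1 : 0 ≤ E / 2 * (x a + x b) * (1 / t) := by have := hX a b; positivity
        nlinarith
    · filter_upwards [ae_restrict_mem measurableSet_Ioi] with t ht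
      exact (PSDKernel.exp_neg_mul_add x _).const_mul (Real.rpow_nonneg (le_of_lt ht) _)

theorem PSDKernel.cos_inner {V : Type*} [NormedAddCommGroup V] [InnerProductSpace ℝ V]
    (r : α → V) (p : V) : PSDKernel fun a b => Real.cos (inner ℝ (r a - r b) p) := by
  simp only [inner_sub_left, Real.cos_sub]
  exact (PSDKernel.rankOne fun a => Real.cos (inner ℝ (r a) p)).add
    (PSDKernel.rankOne fun a => Real.sin (inner ℝ (r a) p))

end PositiveKernels

end

section

set_option linter.unusedSectionVars false
open Filter Topology MeasureTheory

section EuclideanKernel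

variable {V : Type*} [NormedAddCommGroup V] [InnerProductSpace ℝ V] [FiniteDimensional ℝ V]
  [MeasurableSpace V] [BorelSpace V]

theorem integral_gaussian_cos {t : ℝ} (ht : 0 < t) (r : V) :
    ∫ p : V, Real.exp (-(‖p‖ ^ 2 / (4 * t))) * Real.cos (inner ℝ r p) =
      (4 * Real.pi * t) ^ ((Module.finrank ℝ V : ℝ) / 2) * Real.exp (-(t * ‖r‖ ^ 2)) := by
  have hb : 0 < ((1 / (4 * t) : ℝ) : ℂ).re := by rw [Complex.ofReal_re]; positivity
  have h := GaussianFourier.integral_cexp_neg_mul_sq_norm_add hb Complex.I r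
  have hi := GaussianFourier.integrable_cexp_neg_mul_sq_norm_add hb Complex.I r
  have hre := congrArg Complex.re h
  rw [← RCLike.re_eq_complex_re, ← integral_re hi] at hre
  have e1 : ∀ p : V, RCLike.re (Complex.exp (-((1 / (4 * t) : ℝ) : ℂ) * (‖p‖ : ℂ) ^ 2 +
      Complex.I * (inner ℝ r p : ℂ))) =
      Real.exp (-(‖p‖ ^ 2 / (4 * t))) * Real.cos (inner ℝ r p) := by
    intro p
    rw [RCLike.re_eq_complex_re, Complex.exp_re]
    have a1 : (-((1 / (4 * t) : ℝ) : ℂ) * (‖p‖ : ℂ) ^ 2 + Complex.I * (inner ℝ r p : ℂ)) =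
        ((-(‖p‖ ^ 2 / (4 * t)) : ℝ) : ℂ) + (inner ℝ r p : ℂ) * Complex.I := by
      push_cast; ring
    rw [a1, Complex.add_re, Complex.add_im, Complex.ofReal_re, Complex.ofReal_im,
      Complex.re_ofReal_mul, Complex.im_ofReal_mul, Complex.I_re, Complex.I_im, mul_zero, mul_one,
      add_zero, zero_add]
  simp only [e1] at hre
  rw [hre, RCLike.re_eq_complex_re]
  have e2 : ((Real.pi : ℂ) / ((1 / (4 * t) : ℝ) : ℂ)) ^ ((Module.finrank ℝ V : ℂ) / 2) *
      Complex.exp (Complex.I ^ 2 * (‖r‖ : ℂ) ^ 2 / (4 * ((1 / (4 * t) : ℝ) : ℂ))) =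
      (((4 * Real.pi * t) ^ ((Module.finrank ℝ V : ℝ) / 2) * Real.exp (-(t * ‖r‖ ^ 2)) : ℝ) : ℂ) := by
    rw [Complex.ofReal_mul, Complex.ofReal_cpow (by positivity), Complex.ofReal_exp, Complex.I_sq]
    congr 2
    · push_cast; field_simp
    · push_cast; rfl
    · push_cast; field_simp
  rw [e2, Complex.ofReal_re]

theorem integrable_gaussian_norm {t : ℝ} (ht : 0 < t) :
    Integrable fun p : V => Real.exp (-(‖p‖ ^ 2 / (4 * t))) := by
  have hb : 0 < ((1 / (4 * t) : ℝ) : ℂ).re := by rw [Complex.ofReal_re]; positivity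
  have hi := (GaussianFourier.integrable_cexp_neg_mul_sq_norm_add hb 0 (0 : V)).norm
  refine hi.congr (Eventually.of_forall fun p => ?_)
  beta_reduce
  rw [Complex.norm_exp]
  congr 1
  have : (-((1 / (4 * t) : ℝ) : ℂ) * (‖p‖ : ℂ) ^ 2 + 0 * ((inner ℝ (0 : V) p : ℝ) : ℂ)) =
      ((-(‖p‖ ^ 2 / (4 * t)) : ℝ) : ℂ) := by push_cast; ring
  rw [this, Complex.ofReal_re]

theorem integrable_bessel_gaussian {ν X : ℝ} (hν : 0 < ν) (hX : 0 < X) (r : V) :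
    Integrable (Function.uncurry fun (t : ℝ) (p : V) =>
      t ^ (ν - 1) * Real.exp (-(X ^ 2 * t) - ‖p‖ ^ 2 / (4 * t)) * Real.cos (inner ℝ r p))
      ((volume.restrict (Set.Ioi (0 : ℝ))).prod (volume : Measure V)) := by
  have hmeas : AEStronglyMeasurable (Function.uncurry fun (t : ℝ) (p : V) =>
      t ^ (ν - 1) * Real.exp (-(X ^ 2 * t) - ‖p‖ ^ 2 / (4 * t)))
      ((volume.restrict (Set.Ioi (0 : ℝ))).prod (volume : Measure V)) := by
    refine Measurable.aestronglyMeasurable (Measurable.mul (measurable_fst.pow_const _) ?_)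
    fun_prop
  have hexp : ∀ (t : ℝ) (p : V), t ^ (ν - 1) * Real.exp (-(X ^ 2 * t) - ‖p‖ ^ 2 / (4 * t)) =
      t ^ (ν - 1) * Real.exp (-(X ^ 2 * t)) * Real.exp (-(‖p‖ ^ 2 / (4 * t))) := by
    intro t p
    rw [mul_assoc, ← Real.exp_add]; ring_nf
  have hmain : Integrable (Function.uncurry fun (t : ℝ) (p : V) =>
      t ^ (ν - 1) * Real.exp (-(X ^ 2 * t) - ‖p‖ ^ 2 / (4 * t)))
      ((volume.restrict (Set.Ioi (0 : ℝ))).prod (volume : Measure V)) := by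
    rw [integrable_prod_iff hmeas]
    constructor
    · filter_upwards [ae_restrict_mem measurableSet_Ioi] with t ht
      simp only [Function.uncurry, hexp]
      exact (integrable_gaussian_norm ht).const_mul _
    · set n : ℝ := (Module.finrank ℝ V : ℝ) / 2 with hn
      have hn0 : 0 ≤ n := by positivity
      have h1 := ((integrableOn_rpow_mul_exp (add_pos_of_pos_of_nonneg hν hn0)
        (pow_pos hX 2))).const_mul ((4 * Real.pi) ^ n)
      refine h1.congr ?_
      filter_upwards [ae_restrict_mem measurableSet_Ioi] with t ht
      have ht : 0 < t := ht
      have h2 := integral_gaussian_cos ht (0 : V)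
      simp only [inner_zero_left, Real.cos_zero, mul_one, norm_zero, ne_eq, OfNat.ofNat_ne_zero,
        not_false_eq_true, zero_pow, mul_zero, neg_zero, Real.exp_zero] at h2
      have h3 : ∀ p : V, ‖t ^ (ν - 1) * Real.exp (-(X ^ 2 * t) - ‖p‖ ^ 2 / (4 * t))‖ =
          t ^ (ν - 1) * Real.exp (-(X ^ 2 * t)) * Real.exp (-(‖p‖ ^ 2 / (4 * t))) := by
        intro p
        rw [Real.norm_of_nonneg (by positivity), hexp]
      simp only [Function.uncurry, h3]
      rw [integral_const_mul, h2, Real.mul_rpow (by positivity) ht.le, ← hn,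
        show ν + n - 1 = (ν - 1) + n by ring, Real.rpow_add ht]
      ring
  refine hmain.mono (hmeas.mul ?_) (Eventually.of_forall fun p => ?_)
  · refine Continuous.aestronglyMeasurable ?_
    fun_prop
  · simp only [Function.uncurry]
    rw [norm_mul]
    exact mul_le_of_le_one_right (norm_nonneg _) (Real.abs_cos_le_one _)

theorem rpow_neg_eq_integral {s X : ℝ} (hs : (Module.finrank ℝ V : ℝ) < s) (hX : 0 < X) (r : V) :
    (X ^ 2 + ‖r‖ ^ 2) ^ (-(s / 2)) =
      ((4 * Real.pi) ^ ((Module.finrank ℝ V : ℝ) / 2) * Real.Gamma (s / 2))⁻¹ *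
      ∫ p : V, Real.cos (inner ℝ r p) *
        besselIntegral ((s - Module.finrank ℝ V) / 2) ‖p‖ X := by
  set n : ℝ := (Module.finrank ℝ V : ℝ) with hn
  have hn0 : 0 ≤ n := by positivity
  have hν : 0 < (s - n) / 2 := by linarith
  have hs0 : 0 < s / 2 := by linarith
  have hpos : 0 < X ^ 2 + ‖r‖ ^ 2 := by positivity
  have hcpos : 0 < (4 * Real.pi) ^ (n / 2) := by positivity
  have hG := Real.Gamma_pos_of_pos hs0
  have h1 : ∫ p : V, Real.cos (inner ℝ r p) * besselIntegral ((s - n) / 2) ‖p‖ X =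
      ∫ p : V, ∫ t in Set.Ioi (0 : ℝ), t ^ ((s - n) / 2 - 1) *
        Real.exp (-(X ^ 2 * t) - ‖p‖ ^ 2 / (4 * t)) * Real.cos (inner ℝ r p) := by
    refine integral_congr_ae (Eventually.of_forall fun p => ?_)
    simp only [besselIntegral]
    rw [mul_comm, integral_mul_const]
  rw [h1, ← integral_integral_swap (integrable_bessel_gaussian hν hX r)]
  have h2 : ∫ t in Set.Ioi (0 : ℝ), ∫ p : V, t ^ ((s - n) / 2 - 1) *
        Real.exp (-(X ^ 2 * t) - ‖p‖ ^ 2 / (4 * t)) * Real.cos (inner ℝ r p) =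
      ∫ t in Set.Ioi (0 : ℝ), (4 * Real.pi) ^ (n / 2) *
        (t ^ (s / 2 - 1) * Real.exp (-((X ^ 2 + ‖r‖ ^ 2) * t))) := by
    refine setIntegral_congr_fun measurableSet_Ioi fun t ht => ?_
    have ht : 0 < t := ht
    have h3 : ∀ p : V, t ^ ((s - n) / 2 - 1) *
        Real.exp (-(X ^ 2 * t) - ‖p‖ ^ 2 / (4 * t)) * Real.cos (inner ℝ r p) =
        (t ^ ((s - n) / 2 - 1) * Real.exp (-(X ^ 2 * t))) *
          (Real.exp (-(‖p‖ ^ 2 / (4 * t))) * Real.cos (inner ℝ r p)) := by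
      intro p
      rw [sub_eq_add_neg (-(X ^ 2 * t)), Real.exp_add]; ring
    simp only [h3]
    rw [integral_const_mul, integral_gaussian_cos ht, ← hn, Real.mul_rpow (by positivity) ht.le,
      show s / 2 - 1 = ((s - n) / 2 - 1) + n / 2 by ring, Real.rpow_add ht,
      show -((X ^ 2 + ‖r‖ ^ 2) * t) = -(X ^ 2 * t) + -(t * ‖r‖ ^ 2) by ring, Real.exp_add]
    ring
  rw [h2, integral_const_mul, Real.integral_rpow_mul_exp_neg_mul_Ioi hs0 hpos, one_div,
    Real.inv_rpow hpos.le, Real.rpow_neg hpos.le]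
  field_simp

theorem PSDKernel.euclidean {α : Type*} [Fintype α] {s : ℝ} (hs : (Module.finrank ℝ V : ℝ) < s)
    (x : α → ℝ) (hx : ∀ a, 0 < x a) (r : α → V) :
    PSDKernel fun a b => ((x a + x b) ^ 2 + ‖r a - r b‖ ^ 2) ^ (-(s / 2)) := by
  have hX : ∀ a b, 0 < x a + x b := fun a b => add_pos (hx a) (hx b)
  have hν : 0 < (s - Module.finrank ℝ V) / 2 := by linarith
  simp only [rpow_neg_eq_integral hs (hX _ _)]
  have hs0 : 0 < s / 2 := by
    have : (0 : ℝ) ≤ Module.finrank ℝ V := Nat.cast_nonneg _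
    linarith
  refine PSDKernel.const_mul (PSDKernel.integral (fun a b => ?_) (Eventually.of_forall fun p => ?_))
    (inv_nonneg.mpr (mul_nonneg (by positivity) (Real.Gamma_pos_of_pos hs0).le))
  · have := (integrable_bessel_gaussian hν (hX a b) (r a - r b)).integral_prod_right
    refine this.congr (Eventually.of_forall fun p => ?_)
    simp only [Function.uncurry, besselIntegral]
    rw [mul_comm, integral_mul_const]
  · exact (PSDKernel.cos_inner r p).mul (PSDKernel.bessel x hx hν (norm_nonneg p))

end EuclideanKernel

end

section

set_option linter.unusedSectionVars false
open Filter Topology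

section BasicReflectionPositivity

open QSpin

variable {d : ℕ}

theorem PSDKernel.sum {α ι : Type*} [Fintype α] (s : Finset ι) {M : ι → α → α → ℝ}
    (h : ∀ i ∈ s, PSDKernel (M i)) : PSDKernel fun a b => ∑ i ∈ s, M i a b := by
  classical
  induction s using Finset.induction_on with
  | empty => simpa using PSDKernel.rankOne fun _ : α => (0 : ℝ)
  | insert i s hi ih =>
    simp only [Finset.sum_insert hi]
    exact (h i (Finset.mem_insert_self _ _)).add
      (ih fun j hj => h j (Finset.mem_insert_of_mem hj))

theorem norm1_reflDiff (j : Fin d) (x y : Fin d → ℤ) (hx : 0 ≤ x j) (hy : 0 ≤ y j) :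
    norm1 (reflDiff j x y) = ((x j + 1 / 2 : ℝ) + (y j + 1 / 2 : ℝ)) +
      ∑ i ∈ Finset.univ.erase j, |(x i : ℝ) - y i| := by
  rw [norm1, ← Finset.add_sum_erase _ _ (Finset.mem_univ j)]
  have hx' : (0 : ℝ) ≤ x j := by exact_mod_cast hx
  have hy' : (0 : ℝ) ≤ y j := by exact_mod_cast hy
  congr 1
  · simp only [reflDiff, if_true]
    push_cast
    rw [abs_of_nonneg (by linarith)]; ring
  · refine Finset.sum_congr rfl fun i hi => ?_
    simp only [reflDiff, if_neg (Finset.ne_of_mem_erase hi)]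
    push_cast; rfl

theorem sum_sq_reflDiff (j : Fin d) (x y : Fin d → ℤ) :
    ∑ i, (reflDiff j x y i : ℝ) ^ 2 = ((x j + 1 / 2 : ℝ) + (y j + 1 / 2 : ℝ)) ^ 2 +
      ‖WithLp.toLp 2 (fun i => if i = j then (0 : ℝ) else x i) -
        WithLp.toLp 2 (fun i => if i = j then (0 : ℝ) else y i)‖ ^ 2 := by
  rw [EuclideanSpace.norm_sq_eq, ← Finset.add_sum_erase _ _ (Finset.mem_univ j),
    ← Finset.add_sum_erase _ (fun i => ‖_‖ ^ 2) (Finset.mem_univ j)]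
  simp only [PiLp.sub_apply, if_true, sub_self, norm_zero, ne_eq, OfNat.ofNat_ne_zero,
    not_false_eq_true, zero_pow, zero_add]
  congr 1
  · simp only [reflDiff, if_true]
    push_cast; ring
  · refine Finset.sum_congr rfl fun i hi => ?_
    simp only [reflDiff, if_neg (Finset.ne_of_mem_erase hi)]
    push_cast
    rw [Real.norm_eq_abs, sq_abs]

theorem reflDiff_ne_zero (j : Fin d) (x y : Fin d → ℤ) (hx : 0 ≤ x j) (hy : 0 ≤ y j) :
    reflDiff j x y ≠ 0 := by
  intro h
  have := congrFun h j
  simp [reflDiff] at this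
  omega

theorem psdKernel_exp_norm1 (j : Fin d) {α : Type*} [Fintype α] (X : α → Fin d → ℤ)
    (hX : ∀ a, 0 ≤ X a j) {t : ℝ} (ht : 0 ≤ t) :
    PSDKernel fun a b => Real.exp (-(norm1 (reflDiff j (X a) (X b)) * t)) := by
  have h : ∀ a b, Real.exp (-(norm1 (reflDiff j (X a) (X b)) * t)) =
      Real.exp (-(t * ((X a j + 1 / 2 : ℝ) + (X b j + 1 / 2 : ℝ)))) *
      ∏ i ∈ Finset.univ.erase j, Real.exp (-|t * (X a i : ℝ) - t * X b i|) := by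
    intro a b
    rw [norm1_reflDiff j _ _ (hX a) (hX b), ← Real.exp_sum, ← Real.exp_add, add_mul, neg_add,
      Finset.sum_mul, ← Finset.sum_neg_distrib]
    congr 2
    · ring
    · refine Finset.sum_congr rfl fun i _ => ?_
      rw [← mul_sub, abs_mul, abs_of_nonneg ht, mul_comm]
  simp only [h]
  exact (PSDKernel.exp_neg_mul_add (fun a => (X a j + 1 / 2 : ℝ)) t).mul
    (PSDKernel.prod _ fun i _ => PSDKernel.exp_neg_abs_sub fun a => t * (X a i : ℝ))

theorem norm1_reflDiff_pos (j : Fin d) (x y : Fin d → ℤ) (hx : 0 ≤ x j) (hy : 0 ≤ y j) :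
    0 < norm1 (reflDiff j x y) := by
  rw [norm1_reflDiff j x y hx hy]
  have hx' : (0 : ℝ) ≤ x j := by exact_mod_cast hx
  have hy' : (0 : ℝ) ≤ y j := by exact_mod_cast hy
  have : 0 ≤ ∑ i ∈ Finset.univ.erase j, |(x i : ℝ) - y i| :=
    Finset.sum_nonneg fun _ _ => abs_nonneg _
  linarith

theorem latticeRP_of_psdKernel {J : (Fin d → ℤ) → ℝ}
    (h : ∀ (j : Fin d) (α : Type) [Fintype α] (X : α → Fin d → ℤ), (∀ a, 0 ≤ X a j) →
      PSDKernel fun a b => J (reflDiff j (X a) (X b))) : LatticeRP J :=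
  fun j α _ X hX f => (h j α X hX).quad_nonneg f

theorem latticeRP_yukawa {a b : ℝ} (ha : 0 ≤ a) (hb : 0 < b) : LatticeRP (yukawa d a b) := by
  refine latticeRP_of_psdKernel fun j α _ X hX => ?_
  have := (psdKernel_exp_norm1 j X hX hb.le).const_mul ha
  refine (congrArg PSDKernel ?_).mp this
  funext x y
  simp only [yukawa]
  congr 2
  ring

theorem latticeRP_powerLaw1 {a s : ℝ} (ha : 0 ≤ a) (hs : (d : ℝ) < s) :
    LatticeRP (powerLaw1 d a s) := by
  refine latticeRP_of_psdKernel fun j α _ X hX => ?_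
  have hs0 : 0 < s := lt_of_le_of_lt (Nat.cast_nonneg d) hs
  have := (PSDKernel.rpow_neg (k := fun a b => norm1 (reflDiff j (X a) (X b)))
    (fun a b => norm1_reflDiff_pos j _ _ (hX a) (hX b)) hs0
    (fun t ht => psdKernel_exp_norm1 j X hX ht.le)).const_mul ha
  refine (congrArg PSDKernel ?_).mp this
  funext x y
  rw [powerLaw1, if_neg (reflDiff_ne_zero j _ _ (hX x) (hX y))]

theorem latticeRP_powerLaw2 {a s : ℝ} (ha : 0 ≤ a) (hs : (d : ℝ) < s) :
    LatticeRP (powerLaw2 d a s) := by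
  refine latticeRP_of_psdKernel fun j α _ X hX => ?_
  have hx : ∀ a, (0 : ℝ) < X a j + 1 / 2 := by
    intro a
    have : (0 : ℝ) ≤ X a j := by exact_mod_cast hX a
    linarith
  have := (PSDKernel.euclidean (V := EuclideanSpace ℝ (Fin d)) (s := s) (by simpa using hs)
    (fun a => (X a j + 1 / 2 : ℝ)) hx
    (fun a => WithLp.toLp 2 (fun i => if i = j then (0 : ℝ) else X a i))).const_mul ha
  refine (congrArg PSDKernel ?_).mp this
  funext x y
  rw [powerLaw2, if_neg (reflDiff_ne_zero j _ _ (hX x) (hX y)), norm2, sum_sq_reflDiff,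
    Real.sqrt_eq_rpow, ← Real.rpow_mul (by positivity)]
  congr 2
  ring

theorem latticeRP_nearestNeighbour {a : ℝ} (ha : 0 ≤ a) : LatticeRP (nearestNeighbour d a) := by
  classical
  refine latticeRP_of_psdKernel fun j α _ X hX => ?_
  have key := (PSDKernel.sum (Finset.univ.image X) (M := fun v x y =>
    (if X x = v ∧ v j = 0 then (1 : ℝ) else 0) * (if X y = v ∧ v j = 0 then (1 : ℝ) else 0))
    fun v _ => PSDKernel.rankOne fun x => if X x = v ∧ v j = 0 then (1 : ℝ) else 0).const_mul ha
  refine (congrArg PSDKernel ?_).mp key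
  funext x y
  have hiff : norm1 (reflDiff j (X x) (X y)) = 1 ↔ X y = X x ∧ X x j = 0 := by
    rw [norm1_reflDiff j _ _ (hX x) (hX y)]
    have hx' : (0 : ℝ) ≤ X x j := by exact_mod_cast hX x
    have hy' : (0 : ℝ) ≤ X y j := by exact_mod_cast hX y
    have hS : 0 ≤ ∑ i ∈ Finset.univ.erase j, |(X x i : ℝ) - X y i| :=
      Finset.sum_nonneg fun _ _ => abs_nonneg _
    constructor
    · intro h
      have h1 : (X x j : ℝ) = 0 := by linarith
      have h2 : (X y j : ℝ) = 0 := by linarith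
      have h3 : ∑ i ∈ Finset.univ.erase j, |(X x i : ℝ) - X y i| = 0 := by linarith
      rw [Finset.sum_eq_zero_iff_of_nonneg fun _ _ => abs_nonneg _] at h3
      refine ⟨funext fun i => ?_, by exact_mod_cast h1⟩
      by_cases hi : i = j
      · subst hi
        exact_mod_cast h2.trans h1.symm
      · have := h3 i (Finset.mem_erase.mpr ⟨hi, Finset.mem_univ _⟩)
        have := abs_eq_zero.mp this
        exact_mod_cast (sub_eq_zero.mp this).symm
    · rintro ⟨h1, h2⟩
      simp [h1, h2]
      norm_num
  rw [nearestNeighbour]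
  simp only [hiff]
  rw [Finset.sum_eq_single (X x)]
  · by_cases h0 : X x j = 0 <;> by_cases h1 : X y = X x <;> simp [h0, h1]
  · intro v _ hv
    rw [if_neg, zero_mul]
    rintro ⟨rfl, -⟩
    exact hv rfl
  · intro h; simp at h

end BasicReflectionPositivity

end

section

set_option linter.unusedSectionVars false
open Filter Topology
open scoped Matrix.Norms.Operator

section KilledWalk

variable {T : Type*} [Fintype T] [DecidableEq T]

theorem norm_le_one_of_substochastic (P : Matrix T T ℝ) (hP0 : ∀ x y, 0 ≤ P x y)
    (hP1 : ∀ x, ∑ y, P x y ≤ 1) : ‖P‖ ≤ 1 := by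
  rw [Matrix.linfty_opNorm_def]
  rw [← NNReal.coe_one, NNReal.coe_le_coe]
  refine Finset.sup_le fun x _ => ?_
  rw [← NNReal.coe_le_coe]
  push_cast
  refine le_trans (le_of_eq ?_) (hP1 x)
  exact Finset.sum_congr rfl fun y _ => Real.norm_of_nonneg (hP0 x y)

/-- The Green function `∑ λ^n P^n`. -/
noncomputable def green (lam : ℝ) (P : Matrix T T ℝ) : Matrix T T ℝ := ∑' n : ℕ, (lam • P) ^ n

theorem norm_smul_lt_one {lam : ℝ} (h0 : 0 ≤ lam) (h1 : lam < 1) {P : Matrix T T ℝ}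
    (hP0 : ∀ x y, 0 ≤ P x y) (hP1 : ∀ x, ∑ y, P x y ≤ 1) : ‖lam • P‖ < 1 := by
  rw [norm_smul, Real.norm_of_nonneg h0]
  exact lt_of_le_of_lt (mul_le_of_le_one_right h0 (norm_le_one_of_substochastic P hP0 hP1)) h1

theorem summable_green {lam : ℝ} (h0 : 0 ≤ lam) (h1 : lam < 1) {P : Matrix T T ℝ}
    (hP0 : ∀ x y, 0 ≤ P x y) (hP1 : ∀ x, ∑ y, P x y ≤ 1) :
    Summable fun n : ℕ => (lam • P) ^ n :=
  summable_geometric_of_norm_lt_one (norm_smul_lt_one h0 h1 hP0 hP1)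

theorem green_apply {lam : ℝ} (h0 : 0 ≤ lam) (h1 : lam < 1) {P : Matrix T T ℝ}
    (hP0 : ∀ x y, 0 ≤ P x y) (hP1 : ∀ x, ∑ y, P x y ≤ 1) (x y : T) :
    green lam P x y = ∑' n : ℕ, lam ^ n * (P ^ n) x y := by
  have h := (summable_green h0 h1 hP0 hP1).hasSum
  have h2 := (Pi.hasSum.mp (Pi.hasSum.mp h x)) y
  rw [green, ← h2.tsum_eq]
  refine tsum_congr fun n => ?_
  rw [smul_pow, Matrix.smul_apply, smul_eq_mul]

theorem quad_le_of_substochastic (P : Matrix T T ℝ) (hP0 : ∀ x y, 0 ≤ P x y)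
    (hPs : ∀ x y, P x y = P y x) (hP1 : ∀ x, ∑ y, P x y ≤ 1) (w : T → ℝ) :
    ∑ x, ∑ y, w x * w y * P x y ≤ ∑ x, w x ^ 2 := by
  have h1 : ∑ x, ∑ y, w x * w y * P x y ≤
      ∑ x, ∑ y, (w x ^ 2 * P x y + w y ^ 2 * P x y) / 2 := by
    refine Finset.sum_le_sum fun x _ => Finset.sum_le_sum fun y _ => ?_
    nlinarith [mul_nonneg (hP0 x y) (sq_nonneg (w x - w y))]
  have h2 : ∑ x, ∑ y, w x ^ 2 * P x y ≤ ∑ x, w x ^ 2 := by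
    refine Finset.sum_le_sum fun x _ => ?_
    rw [← Finset.mul_sum]
    exact mul_le_of_le_one_right (sq_nonneg _) (hP1 x)
  have h3 : ∑ x, ∑ y, w y ^ 2 * P x y = ∑ x, ∑ y, w x ^ 2 * P x y := by
    rw [Finset.sum_comm]
    simp only [hPs]
  simp only [← Finset.sum_div, Finset.sum_add_distrib] at h1
  linarith

/-- Reflection positivity of the Green function of a killed symmetric walk whose steps across
the reflection plane join mirror images. -/
theorem green_reflection_nonneg {lam : ℝ} (h0 : 0 ≤ lam) (h1 : lam < 1) (P : Matrix T T ℝ)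
    (hP0 : ∀ x y, 0 ≤ P x y) (hPs : ∀ x y, P x y = P y x) (hP1 : ∀ x, ∑ y, P x y ≤ 1)
    (θ : T → T) (hθ : ∀ x, θ (θ x) = x) (hPθ : ∀ x y, P (θ x) (θ y) = P x y)
    (Lf : T → Prop) (hL : ∀ x, Lf x → ¬ Lf (θ x)) (hC : ∀ x, ¬ Lf x → ¬ Lf (θ x) → θ x = x)
    (hcross : ∀ x y, Lf x → Lf (θ y) → P x y ≠ 0 → y = θ x)
    (f : T → ℝ) (hf : ∀ x, ¬ Lf x → f x = 0) :
    0 ≤ ∑ x, ∑ y, f x * f y * green lam P x (θ y) := by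
  classical
  set M : Matrix T T ℝ := 1 - lam • P with hM
  set S := green lam P with hS
  have hsum := norm_smul_lt_one h0 h1 hP0 hP1
  have hSM : S * M = 1 := geom_series_mul_neg (lam • P) hsum
  have hMS : M * S = 1 := mul_neg_geom_series (lam • P) hsum
  have hMt : M.transpose = M := by
    rw [hM, Matrix.transpose_sub, Matrix.transpose_one, Matrix.transpose_smul]
    congr 2
    ext x y; exact hPs y x
  have hSt : S.transpose = S := by
    have : S.transpose * M = 1 := by
      rw [← hMt, ← Matrix.transpose_mul, hMS, Matrix.transpose_one]
    calc S.transpose = S.transpose * (M * S) := by rw [hMS, mul_one]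
      _ = S := by rw [← mul_assoc, this, one_mul]
  have hSs : ∀ u v : T → ℝ, u ⬝ᵥ S.mulVec v = v ⬝ᵥ S.mulVec u := by
    intro u v
    rw [Matrix.dotProduct_mulVec, ← Matrix.mulVec_transpose, hSt, dotProduct_comm]
  have hMs : ∀ u v : T → ℝ, u ⬝ᵥ M.mulVec v = v ⬝ᵥ M.mulVec u := by
    intro u v
    rw [Matrix.dotProduct_mulVec, ← Matrix.mulVec_transpose, hMt, dotProduct_comm]
  have hMquad : ∀ w : T → ℝ, w ⬝ᵥ M.mulVec w =
      ∑ x, w x ^ 2 - lam * ∑ x, ∑ y, w x * w y * P x y := by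
    intro w
    rw [hM, Matrix.sub_mulVec, Matrix.one_mulVec, dotProduct_sub, Matrix.smul_mulVec,
      dotProduct_smul, smul_eq_mul]
    congr 1
    · simp [dotProduct, sq]
    · congr 1
      simp only [dotProduct, Matrix.mulVec, Finset.mul_sum]
      refine Finset.sum_congr rfl fun x _ => Finset.sum_congr rfl fun y _ => ?_
      ring
  have hMpos : ∀ w : T → ℝ, 0 ≤ w ⬝ᵥ M.mulVec w := by
    intro w
    rw [hMquad]
    have h2 := quad_le_of_substochastic P hP0 hPs hP1 w
    have h3 : 0 ≤ ∑ x, w x ^ 2 := Finset.sum_nonneg fun _ _ => sq_nonneg _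
    nlinarith [mul_le_mul_of_nonneg_left h2 h0, mul_nonneg (sub_nonneg.mpr h1.le) h3]
  let e : T ≃ T := ⟨θ, θ, hθ, hθ⟩
  have hMθ : ∀ w : T → ℝ, M.mulVec (fun x => w (θ x)) = fun x => M.mulVec w (θ x) := by
    intro w
    funext x
    have hMe : ∀ x y, M (θ x) (θ y) = M x y := by
      intro x y
      simp only [hM, Matrix.sub_apply, Matrix.smul_apply, hPθ, Matrix.one_apply]
      congr 2
      exact propext e.injective.eq_iff
    simp only [Matrix.mulVec, dotProduct]
    rw [← e.sum_comp (fun y => M (θ x) y * w y)]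
    refine Finset.sum_congr rfl fun y _ => ?_
    change _ = M (θ x) (θ y) * w (θ y)
    rw [hMe]
  set fp : T → ℝ := fun x => f x + f (θ x) with hfp
  set fm : T → ℝ := fun x => f x - f (θ x) with hfm
  set g : T → ℝ := S.mulVec fm with hg
  have hMg : M.mulVec g = fm := by rw [hg, Matrix.mulVec_mulVec, hMS, Matrix.one_mulVec]
  have hgodd : ∀ x, g (θ x) = -g x := by
    have h2 : M.mulVec (fun x => g (θ x)) = M.mulVec (-g) := by
      rw [hMθ, hMg, Matrix.mulVec_neg, hMg]
      funext x
      simp [hfm, hθ]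
    have h3 := congrArg S.mulVec h2
    rw [Matrix.mulVec_mulVec, Matrix.mulVec_mulVec, hSM, Matrix.one_mulVec,
      Matrix.one_mulVec] at h3
    exact fun x => congrFun h3 x
  set h : T → ℝ := fun x => if Lf (θ x) then -g x else g x with hh
  have hhg : fp ⬝ᵥ h = fm ⬝ᵥ g := by
    simp only [dotProduct]
    refine Finset.sum_congr rfl fun x _ => ?_
    by_cases hx : Lf (θ x)
    · have : ¬ Lf x := fun h' => hL x h' hx
      simp [hfp, hfm, hh, hx, hf x this]
    · simp [hfp, hfm, hh, hx, hf _ hx]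
  have hhM : h ⬝ᵥ M.mulVec h ≤ g ⬝ᵥ M.mulVec g := by
    rw [hMquad, hMquad]
    have e1 : ∑ x, h x ^ 2 = ∑ x, g x ^ 2 := by
      refine Finset.sum_congr rfl fun x _ => ?_
      simp only [hh]; split_ifs <;> ring
    have hC0 : ∀ x, ¬ Lf x → ¬ Lf (θ x) → g x = 0 := by
      intro x hx hx'
      have := hgodd x
      rw [hC x hx hx'] at this
      linarith
    have e2 : ∑ x, ∑ y, g x * g y * P x y ≤ ∑ x, ∑ y, h x * h y * P x y := by
      refine Finset.sum_le_sum fun x _ => Finset.sum_le_sum fun y _ => ?_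
      have crossing : ∀ x y, Lf x → Lf (θ y) → g x * g y * P x y ≤ 0 := by
        intro x y hx hy
        by_cases hp : P x y = 0
        · rw [hp, mul_zero]
        · rw [hcross x y hx hy hp, hgodd]
          nlinarith [mul_nonneg (hP0 x (θ x)) (sq_nonneg (g x))]
      by_cases hx : Lf (θ x) <;> by_cases hy : Lf (θ y)
      · simp [hh, hx, hy]
      · by_cases hy' : Lf y
        · have h2 := crossing y x hy' hx
          rw [hPs y x] at h2
          simp only [hh, hx, hy, if_true, if_false]
          linarith
        · simp [hh, hC0 y hy' hy]
      · by_cases hx' : Lf x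
        · have h2 := crossing x y hx' hy
          simp only [hh, hx, hy, if_true, if_false]
          linarith
        · simp [hh, hC0 x hx' hx]
      · simp [hh, hx, hy]
    rw [e1]
    have := mul_le_mul_of_nonneg_left e2 h0
    linarith
  have hkey : fm ⬝ᵥ S.mulVec fm ≤ fp ⬝ᵥ S.mulVec fp := by
    have h2 := hMpos (S.mulVec fp - h)
    have h3 : M.mulVec (S.mulVec fp - h) = fp - M.mulVec h := by
      rw [Matrix.mulVec_sub, Matrix.mulVec_mulVec, hMS, Matrix.one_mulVec]
    rw [h3, sub_dotProduct, dotProduct_sub, dotProduct_sub] at h2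
    have h4 : S.mulVec fp ⬝ᵥ M.mulVec h = h ⬝ᵥ fp := by
      rw [hMs, Matrix.mulVec_mulVec, hMS, Matrix.one_mulVec]
    have h5 : g ⬝ᵥ M.mulVec g = fm ⬝ᵥ S.mulVec fm := by rw [hMg, dotProduct_comm]
    rw [h4, dotProduct_comm h fp, dotProduct_comm (S.mulVec fp) fp, hhg] at h2
    rw [h5] at hhM
    have h6 : fm ⬝ᵥ g = fm ⬝ᵥ S.mulVec fm := rfl
    linarith
  set fθ : T → ℝ := fun x => f (θ x) with hfθ
  have e1 : fp = f + fθ := rfl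
  have e2 : fm = f - fθ := rfl
  rw [e1, e2, Matrix.mulVec_add, Matrix.mulVec_sub, sub_dotProduct, add_dotProduct, dotProduct_sub,
    dotProduct_sub, dotProduct_add, dotProduct_add, hSs fθ f] at hkey
  have e3 : ∑ x, ∑ y, f x * f y * S x (θ y) = f ⬝ᵥ S.mulVec fθ := by
    simp only [dotProduct, Matrix.mulVec, Finset.mul_sum]
    refine Finset.sum_congr rfl fun x _ => ?_
    rw [← e.sum_comp (fun y => f x * (S x y * fθ y))]
    refine Finset.sum_congr rfl fun y _ => ?_
    change _ = f x * (S x (θ y) * f (θ (θ y)))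
    rw [hθ]; ring
  rw [e3]
  linarith

theorem pow_apply_le_one (P : Matrix T T ℝ) (hP0 : ∀ x y, 0 ≤ P x y)
    (hP1 : ∀ x, ∑ y, P x y ≤ 1) (n : ℕ) (x y : T) : 0 ≤ (P ^ n) x y ∧ (P ^ n) x y ≤ 1 := by
  have h : ∀ x, (∀ y, 0 ≤ (P ^ n) x y) ∧ ∑ y, (P ^ n) x y ≤ 1 := by
    induction n with
    | zero =>
      intro x
      refine ⟨fun y => ?_, ?_⟩
      · rw [pow_zero, Matrix.one_apply]; split_ifs <;> norm_num
      · simp [Matrix.one_apply]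
    | succ n ih =>
      intro x
      simp only [pow_succ', Matrix.mul_apply]
      refine ⟨fun y => Finset.sum_nonneg fun z _ => mul_nonneg (hP0 x z) ((ih z).1 y), ?_⟩
      rw [Finset.sum_comm]
      refine le_trans (Finset.sum_le_sum fun z _ => ?_) (hP1 x)
      rw [← Finset.mul_sum]
      exact mul_le_of_le_one_right (hP0 x z) (ih z).2
  exact ⟨(h x).1 y, (Finset.single_le_sum (fun z _ => (h x).1 z) (Finset.mem_univ y)).trans (h x).2⟩

end KilledWalk

end

section

set_option linter.unusedSectionVars false
open Filter Topology QSpin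

section WalkCount

variable {d : ℕ}

theorem walkCount_eq_sum (n : ℕ) (x : Fin d → ℤ) :
    walkCount n x = ∑ w : Fin n → Fin d × Bool, if ∑ t, step (w t) = x then 1 else 0 := by
  rw [walkCount, Fintype.card_subtype, Finset.card_filter]

theorem walkCount_zero (x : Fin d → ℤ) : walkCount 0 x = if x = 0 then 1 else 0 := by
  rw [walkCount_eq_sum]
  simp [eq_comm]

theorem walkCount_succ (n : ℕ) (x : Fin d → ℤ) :
    walkCount (n + 1) x = ∑ p : Fin d × Bool, walkCount n (x - step p) := by
  simp only [walkCount_eq_sum]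
  rw [← (Fin.consEquiv fun _ : Fin (n + 1) => Fin d × Bool).sum_comp, Fintype.sum_prod_type]
  refine Finset.sum_congr rfl fun p _ => Finset.sum_congr rfl fun w _ => ?_
  simp only [Fin.consEquiv_apply, Fin.sum_univ_succ, Fin.cons_zero, Fin.cons_succ]
  congr 1
  rw [eq_sub_iff_add_eq']

/-- The step in the opposite direction. -/
def negStep : Fin d × Bool ≃ Fin d × Bool :=
  ⟨fun p => (p.1, !p.2), fun p => (p.1, !p.2), fun p => by simp, fun p => by simp⟩

theorem step_negStep (p : Fin d × Bool) : step (negStep p) = -step p := by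
  obtain ⟨i, b⟩ := p
  cases b <;> simp [step, negStep]

/-- The step reflected in direction `j`. -/
def flipStep (j : Fin d) : Fin d × Bool ≃ Fin d × Bool :=
  ⟨fun p => (p.1, if p.1 = j then !p.2 else p.2), fun p => (p.1, if p.1 = j then !p.2 else p.2),
    fun p => by obtain ⟨i, b⟩ := p; by_cases h : i = j <;> simp [h],
    fun p => by obtain ⟨i, b⟩ := p; by_cases h : i = j <;> simp [h]⟩

theorem step_flipStep (j : Fin d) (p : Fin d × Bool) :
    step (flipStep j p) = Function.update (step p) j (-step p j) := by
  obtain ⟨i, b⟩ := p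
  by_cases h : i = j
  · subst h
    funext l
    by_cases hl : l = i
    · subst hl; cases b <;> simp [step, flipStep]
    · cases b <;> simp [step, flipStep, hl]
  · funext l
    by_cases hl : l = j
    · subst hl; cases b <;> simp [step, flipStep, h, Ne.symm h]
    · cases b <;> simp [step, flipStep, hl, h]

theorem walkCount_neg (n : ℕ) (x : Fin d → ℤ) : walkCount n (-x) = walkCount n x := by
  induction n generalizing x with
  | zero => simp [walkCount_zero]
  | succ n ih =>
    rw [walkCount_succ, walkCount_succ, ← negStep.sum_comp]
    refine Finset.sum_congr rfl fun p _ => ?_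
    rw [← ih, step_negStep]
    congr 1
    abel

theorem flip_add (j : Fin d) (x y : Fin d → ℤ) :
    Function.update (x + y) j (-(x + y) j) =
      Function.update x j (-x j) + Function.update y j (-y j) := by
  funext i
  by_cases h : i = j
  · subst h; simp; ring
  · simp [h]

theorem walkCount_flip (j : Fin d) (n : ℕ) (x : Fin d → ℤ) :
    walkCount n (Function.update x j (-x j)) = walkCount n x := by
  induction n generalizing x with
  | zero =>
    rw [walkCount_zero, walkCount_zero]
    congr 1
    refine propext ⟨fun h => ?_, fun h => by simp [h]⟩
    funext i
    have := congrFun h i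
    by_cases hi : i = j
    · subst hi; simpa using this
    · simpa [hi] using this
  | succ n ih =>
    rw [walkCount_succ, walkCount_succ, ← (flipStep j).sum_comp]
    refine Finset.sum_congr rfl fun p _ => ?_
    rw [← ih (x - step p), step_flipStep]
    congr 1
    have := flip_add j (x - step p) (step p)
    rw [sub_add_cancel] at this
    rw [this, add_sub_cancel_right]

end WalkCount

section KilledWalkOnBox

variable {d : ℕ}

/-- The transition matrix of the simple random walk killed outside of `B`. -/
noncomputable def killedWalk (B : Finset (Fin d → ℤ)) : Matrix B B ℝ :=
  fun U V => ∑ p : Fin d × Bool, if (U : Fin d → ℤ) + step p = V then (2 * (d : ℝ))⁻¹ else 0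

theorem killedWalk_nonneg (B : Finset (Fin d → ℤ)) (U V : B) : 0 ≤ killedWalk B U V :=
  Finset.sum_nonneg fun p _ => by split_ifs <;> positivity

theorem killedWalk_symm (B : Finset (Fin d → ℤ)) (U V : B) :
    killedWalk B U V = killedWalk B V U := by
  rw [killedWalk, killedWalk, ← negStep.sum_comp]
  refine Finset.sum_congr rfl fun p _ => ?_
  rw [step_negStep]
  congr 1
  rw [← sub_eq_add_neg, sub_eq_iff_eq_add]
  exact propext eq_comm

theorem sum_killedWalk_le_one (B : Finset (Fin d → ℤ)) (U : B) : ∑ V, killedWalk B U V ≤ 1 := by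
  simp only [killedWalk]
  rw [Finset.sum_comm]
  have h : ∀ p : Fin d × Bool,
      (∑ V : B, if (U : Fin d → ℤ) + step p = V then (2 * (d : ℝ))⁻¹ else 0) ≤ (2 * (d : ℝ))⁻¹ := by
    intro p
    by_cases hp : (U : Fin d → ℤ) + step p ∈ B
    · rw [Finset.sum_eq_single (⟨_, hp⟩ : B)]
      · simp
      · intro V _ hV
        rw [if_neg]
        exact fun h => hV (Subtype.ext h.symm)
      · simp
    · rw [Finset.sum_eq_zero]
      · positivity
      · intro V _
        rw [if_neg]
        exact fun h => hp (h ▸ V.2)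
  refine (Finset.sum_le_sum fun p _ => h p).trans ?_
  rw [Finset.sum_const, Finset.card_univ, Fintype.card_prod, Fintype.card_fin, Fintype.card_bool,
    nsmul_eq_mul]
  push_cast
  rw [mul_comm (d : ℝ) 2]
  exact mul_inv_le_one

theorem killedWalk_pow_apply (B : Finset (Fin d → ℤ)) (n : ℕ) (U V : B)
    (hU : ∀ Z : Fin d → ℤ, (∀ i, |Z i - (U : Fin d → ℤ) i| ≤ n) → Z ∈ B) :
    (killedWalk B ^ n) U V =
      (2 * (d : ℝ))⁻¹ ^ n * walkCount n ((V : Fin d → ℤ) - (U : Fin d → ℤ)) := by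
  induction n generalizing U with
  | zero =>
    rw [pow_zero, pow_zero, one_mul, Matrix.one_apply, walkCount_zero]
    by_cases h : U = V
    · simp [h]
    · have h' : (V : Fin d → ℤ) - (U : Fin d → ℤ) ≠ 0 := by
        rw [sub_ne_zero]
        exact fun h' => h (Subtype.ext h'.symm)
      simp [h, h']
  | succ n ih =>
    have hstep : ∀ p : Fin d × Bool, ∀ i, |step p i| ≤ 1 := by
      rintro ⟨l, b⟩ i
      by_cases h : i = l
      · subst h; cases b <;> simp [step]
      · cases b <;> simp [step, h]
    have hmem : ∀ p, (U : Fin d → ℤ) + step p ∈ B := by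
      intro p
      refine hU _ fun i => ?_
      rw [Pi.add_apply, add_sub_cancel_left]
      have := hstep p i
      push_cast
      omega
    rw [pow_succ', Matrix.mul_apply]
    simp only [killedWalk, Finset.sum_mul]
    rw [Finset.sum_comm, walkCount_succ, Nat.cast_sum, Finset.mul_sum]
    refine Finset.sum_congr rfl fun p _ => ?_
    rw [Finset.sum_eq_single (⟨_, hmem p⟩ : B)]
    · rw [if_pos rfl]
      change _ * (killedWalk B ^ n) _ _ = _
      rw [ih]
      · rw [pow_succ', mul_assoc]
        rw [sub_sub]
      · intro Z hZ
        refine hU Z fun i => ?_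
        have h1 := hZ i
        have h2 := hstep p i
        simp only [Pi.add_apply] at h1
        push_cast
        rw [abs_le] at *
        omega
    · intro Z _ hZ
      rw [if_neg, zero_mul]
      exact fun h => hZ (Subtype.ext h.symm)
    · simp

/-- A box symmetric under `z_j ↦ -m - z_j`. -/
noncomputable def reflBox (j : Fin d) (m : ℤ) (R : ℕ) : Finset (Fin d → ℤ) :=
  Fintype.piFinset fun i => if i = j then Finset.Icc (-m - R) R else Finset.Icc (-(R : ℤ)) R

theorem mem_reflBox {j : Fin d} {m : ℤ} {R : ℕ} {z : Fin d → ℤ} :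
    z ∈ reflBox j m R ↔ ∀ i, (if i = j then -m - R else -(R : ℤ)) ≤ z i ∧ z i ≤ R := by
  simp only [reflBox, Fintype.mem_piFinset]
  refine forall_congr' fun i => ?_
  split_ifs <;> simp

/-- The reflection `z_j ↦ -m - z_j`. -/
def reflAt (j : Fin d) (m : ℤ) (z : Fin d → ℤ) : Fin d → ℤ := Function.update z j (-m - z j)

theorem reflAt_self (j : Fin d) (m : ℤ) (z : Fin d → ℤ) : reflAt j m z j = -m - z j := by
  simp [reflAt]

theorem reflAt_of_ne (j : Fin d) (m : ℤ) (z : Fin d → ℤ) {i : Fin d} (h : i ≠ j) :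
    reflAt j m z i = z i := by
  simp [reflAt, h]

theorem reflAt_reflAt (j : Fin d) (m : ℤ) (z : Fin d → ℤ) : reflAt j m (reflAt j m z) = z := by
  funext i
  by_cases h : i = j
  · subst h; rw [reflAt_self, reflAt_self]; ring
  · rw [reflAt_of_ne _ _ _ h, reflAt_of_ne _ _ _ h]

theorem reflAt_mem {j : Fin d} {m : ℤ} {R : ℕ} {z : Fin d → ℤ} (hz : z ∈ reflBox j m R) :
    reflAt j m z ∈ reflBox j m R := by
  rw [mem_reflBox] at *
  intro i
  have := hz i
  by_cases h : i = j
  · subst h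
    rw [reflAt_self]
    simp only [if_true] at *
    omega
  · rw [reflAt_of_ne _ _ _ h]
    exact this

theorem killedWalk_green_nonneg {lam : ℝ} (h0 : 0 ≤ lam) (h1 : lam < 1) (j : Fin d) (m : ℤ)
    (hm : 0 < m) (R : ℕ) {α : Type} [Fintype α] (u : α → reflBox j m R)
    (hu : ∀ a, 0 ≤ (u a : Fin d → ℤ) j) (f : α → ℝ) :
    0 ≤ ∑ a, ∑ b, f a * f b *
      green lam (killedWalk (reflBox j m R)) (u a) ⟨reflAt j m (u b), reflAt_mem (u b).2⟩ := by
  let B := reflBox j m R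
  let θ : B → B := fun z => ⟨reflAt j m z, reflAt_mem z.2⟩
  let F : B → ℝ := fun z => ∑ a, if u a = z then f a else 0
  have hkey := green_reflection_nonneg h0 h1 (killedWalk B) (killedWalk_nonneg B)
    (killedWalk_symm B) (sum_killedWalk_le_one B) θ
    (fun x => Subtype.ext (reflAt_reflAt j m x)) ?_
    (fun z => 0 < 2 * (z : Fin d → ℤ) j + m) ?_ ?_ ?_ F ?_
  · refine hkey.trans_eq ?_
    have e : ∀ (g : B → ℝ), ∑ x, F x * g x = ∑ a, f a * g (u a) := by
      intro g
      simp only [F, Finset.sum_mul]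
      rw [Finset.sum_comm]
      refine Finset.sum_congr rfl fun a _ => ?_
      simp [ite_mul]
    calc ∑ x, ∑ y, F x * F y * green lam (killedWalk B) x (θ y)
        = ∑ x, F x * ∑ y, F y * green lam (killedWalk B) x (θ y) := by
          simp only [Finset.mul_sum, mul_assoc]
      _ = ∑ a, f a * ∑ b, f b * green lam (killedWalk B) (u a) (θ (u b)) := by
          rw [e]
          simp only [e]
      _ = _ := by simp only [Finset.mul_sum, mul_assoc]; rfl
  · intro x y
    simp only [killedWalk]
    rw [← (flipStep j).sum_comp]
    refine Finset.sum_congr rfl fun p _ => ?_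
    congr 1
    refine propext ?_
    rw [step_flipStep]
    simp only [θ, funext_iff, Pi.add_apply]
    refine forall_congr' fun i => ?_
    by_cases h : i = j
    · subst h
      rw [reflAt_self, reflAt_self, Function.update_self]
      omega
    · rw [reflAt_of_ne _ _ _ h, reflAt_of_ne _ _ _ h, Function.update_of_ne h]
  · intro x hx
    simp only [θ, reflAt_self]
    omega
  · intro x hx hx'
    simp only [θ, reflAt_self] at hx'
    refine Subtype.ext ?_
    funext i
    change reflAt j m x i = _
    by_cases h : i = j
    · subst h
      rw [reflAt_self]
      omega
    · rw [reflAt_of_ne _ _ _ h]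
  · intro x y hx hy hP
    simp only [θ, reflAt_self] at hy
    obtain ⟨p, -, hp⟩ := Finset.exists_ne_zero_of_sum_ne_zero hP
    have hp : (x : Fin d → ℤ) + step p = y := by
      by_contra h
      simp [h] at hp
    obtain ⟨l, b⟩ := p
    have hj := congrFun hp j
    simp only [Pi.add_apply] at hj
    by_cases h : l = j
    · subst h
      cases b
      · refine Subtype.ext ?_
        funext i
        change _ = reflAt l m x i
        by_cases h : i = l
        · subst h
          simp [step] at hj
          rw [reflAt_self]
          omega
        · rw [reflAt_of_ne _ _ _ h, ← hp]
          simp [step, h]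
      · simp [step] at hj
        omega
    · exfalso
      have : step (l, b) j = 0 := by cases b <;> simp [step, Ne.symm h]
      omega
  · intro x hx
    refine Finset.sum_eq_zero fun a _ => ?_
    rw [if_neg]
    intro h
    rw [← h] at hx
    have := hu a
    omega

theorem latticeRP_randomWalk {m : ℕ} {c lam : ℝ} (hm : 1 ≤ m) (hc : 0 ≤ c) (h0 : 0 ≤ lam)
    (h1 : lam < 1) : LatticeRP (randomWalk d m c lam) := by
  intro j α _ X hX f
  have hmem : ∃ R₀ : ℕ, ∀ a i, |((m : ℤ) • X a) i| ≤ R₀ := by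
    refine ⟨∑ a, ∑ i, (((m : ℤ) • X a) i).natAbs, fun a i => ?_⟩
    rw [Int.abs_eq_natAbs]
    exact_mod_cast (Finset.single_le_sum (f := fun i => (((m : ℤ) • X a) i).natAbs)
      (fun _ _ => Nat.zero_le _) (Finset.mem_univ i)).trans
      (Finset.single_le_sum (f := fun a => ∑ i, (((m : ℤ) • X a) i).natAbs)
        (fun _ _ => Nat.zero_le _) (Finset.mem_univ a))
  obtain ⟨R₀, hR₀⟩ := hmem
  have hmem : ∀ R a, (m : ℤ) • X a ∈ reflBox j m (R₀ + R) := by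
    intro R a
    rw [mem_reflBox]
    intro i
    have := abs_le.mp (hR₀ a i)
    split_ifs <;> (push_cast; omega)
  let u : ∀ R, α → reflBox j m (R₀ + R) := fun R a => ⟨_, hmem R a⟩
  let v : ∀ R, α → reflBox j m (R₀ + R) := fun R a => ⟨reflAt j m (u R a), reflAt_mem (u R a).2⟩
  have hdiff : ∀ R a b, ((v R b : Fin d → ℤ) - (u R a : Fin d → ℤ)) =
      -((m : ℤ) • reflDiff j (X a) (X b)) := by
    intro R a b
    funext i
    change reflAt j m ((m : ℤ) • X b) i - ((m : ℤ) • X a) i = _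
    by_cases h : i = j
    · subst h
      rw [reflAt_self]
      simp [reflDiff]; ring
    · rw [reflAt_of_ne _ _ _ h]
      simp [reflDiff, h]; ring
  have hlim : ∀ a b, Tendsto (fun R => green lam (killedWalk (reflBox j m (R₀ + R))) (u R a) (v R b))
      atTop (𝓝 (∑' n : ℕ, (lam / (2 * d)) ^ n * (walkCount n ((m : ℤ) • reflDiff j (X a) (X b)) : ℝ))) := by
    intro a b
    have hg : ∀ R, green lam (killedWalk (reflBox j m (R₀ + R))) (u R a) (v R b) =
        ∑' n : ℕ, lam ^ n * (killedWalk (reflBox j m (R₀ + R)) ^ n) (u R a) (v R b) := fun R =>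
      green_apply h0 h1 (killedWalk_nonneg _) (sum_killedWalk_le_one _) _ _
    simp only [hg]
    refine tendsto_tsum_of_dominated_convergence (bound := fun n => lam ^ n)
      (summable_geometric_of_lt_one h0 h1) (fun n => ?_) (Eventually.of_forall fun R n => ?_)
    · refine tendsto_const_nhds.congr' ?_
      filter_upwards [eventually_ge_atTop n] with R hR
      rw [killedWalk_pow_apply, hdiff, walkCount_neg, div_eq_mul_inv, mul_pow, mul_assoc]
      intro Z hZ
      rw [mem_reflBox]
      intro i
      have h2 := abs_le.mp (hR₀ a i)
      have h3 : |Z i - ((m : ℤ) • X a) i| ≤ n := hZ i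
      rw [abs_le] at h3
      split_ifs <;> (push_cast; omega)
    · have h2 := pow_apply_le_one (killedWalk (reflBox j m (R₀ + R))) (killedWalk_nonneg _)
        (sum_killedWalk_le_one _) n (u R a) (v R b)
      rw [Real.norm_of_nonneg (mul_nonneg (pow_nonneg h0 n) h2.1)]
      exact mul_le_of_le_one_right (pow_nonneg h0 n) h2.2
  have hlim2 := tendsto_finsetSum Finset.univ fun a (_ : a ∈ Finset.univ) =>
    tendsto_finsetSum Finset.univ fun b (_ : b ∈ Finset.univ) => (hlim a b).const_mul (f a * f b)
  have hpos := ge_of_tendsto' hlim2 fun R =>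
    killedWalk_green_nonneg h0 h1 j m (by exact_mod_cast hm) (R₀ + R) (u R)
      (fun a => by
        change 0 ≤ (m : ℤ) * X a j
        exact mul_nonneg (by positivity) (hX a)) f
  refine (mul_nonneg hc hpos).trans_eq ?_
  simp only [randomWalk, Finset.mul_sum]
  refine Finset.sum_congr rfl fun a _ => Finset.sum_congr rfl fun b _ => ?_
  ring

end KilledWalkOnBox

end

section

set_option linter.unusedSectionVars false
open Filter Topology QSpin

section Summability

variable {d : ℕ}

theorem intVec_mem_span (x : Fin d → ℤ) : (fun i => (x i : ℝ)) ∈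
    Submodule.span ℤ (Set.range (Pi.basisFun ℝ (Fin d))) := by
  have : (fun i => (x i : ℝ)) = ∑ i, x i • (Pi.basisFun ℝ (Fin d)) i := by
    funext l
    simp [Finset.sum_apply, Pi.single_apply]
  rw [this]
  exact Submodule.sum_mem _ fun i _ => Submodule.smul_mem _ _
    (Submodule.subset_span (Set.mem_range_self i))

theorem summable_supNorm_rpow {s : ℝ} (hs : (d : ℝ) < s) :
    Summable fun x : Fin d → ℤ => ‖(fun i => (x i : ℝ) : Fin d → ℝ)‖ ^ (-s) := by
  have hrank : Module.finrank ℤ (Submodule.span ℤ (Set.range (Pi.basisFun ℝ (Fin d)))) = d := by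
    rw [ZLattice.rank ℝ, Module.finrank_fin_fun]
  have h := ZLattice.summable_norm_rpow (Submodule.span ℤ (Set.range (Pi.basisFun ℝ (Fin d))))
    (-s) (by rw [hrank]; linarith)
  have hφ : Function.Injective fun x : Fin d → ℤ =>
      (⟨_, intVec_mem_span x⟩ : Submodule.span ℤ (Set.range (Pi.basisFun ℝ (Fin d)))) := by
    intro x y hxy
    funext i
    have h2 : (fun i => (x i : ℝ)) = fun i => (y i : ℝ) := congrArg Subtype.val hxy
    exact Int.cast_injective (congrFun h2 i)
  exact (h.comp_injective hφ).congr fun x => rfl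

theorem norm1_nonneg (x : Fin d → ℤ) : 0 ≤ norm1 x := Finset.sum_nonneg fun _ _ => abs_nonneg _

theorem supNorm_le_norm1 (x : Fin d → ℤ) : ‖(fun i => (x i : ℝ) : Fin d → ℝ)‖ ≤ norm1 x := by
  refine (pi_norm_le_iff_of_nonneg (norm1_nonneg x)).mpr fun i => ?_
  exact Finset.single_le_sum (f := fun j => |(x j : ℝ)|) (fun _ _ => abs_nonneg _)
    (Finset.mem_univ i)

theorem supNorm_le_norm2 (x : Fin d → ℤ) : ‖(fun i => (x i : ℝ) : Fin d → ℝ)‖ ≤ norm2 x := by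
  refine (pi_norm_le_iff_of_nonneg (Real.sqrt_nonneg _)).mpr fun i => ?_
  refine Real.le_sqrt_of_sq_le ?_
  rw [Real.norm_eq_abs, sq_abs]
  exact Finset.single_le_sum (f := fun j => (x j : ℝ) ^ 2) (fun _ _ => sq_nonneg _)
    (Finset.mem_univ i)

theorem supNorm_pos {x : Fin d → ℤ} (hx : x ≠ 0) : 0 < ‖(fun i => (x i : ℝ) : Fin d → ℝ)‖ := by
  rw [norm_pos_iff]
  intro h
  apply hx
  funext i
  have : (x i : ℝ) = 0 := congrFun h i
  exact_mod_cast this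

theorem summable_of_le_rpow {J : (Fin d → ℤ) → ℝ} {C s : ℝ} (hs : (d : ℝ) < s)
    (h : ∀ x, x ≠ 0 → |J x| ≤ C * ‖(fun i => (x i : ℝ) : Fin d → ℝ)‖ ^ (-s)) : Summable J := by
  refine Summable.of_norm_bounded_eventually ((summable_supNorm_rpow hs).mul_left C) ?_
  refine (Set.finite_singleton (0 : Fin d → ℤ)).subset ?_
  intro x hx
  by_contra h0
  exact hx (h x h0)

theorem summable_powerLaw1 {a s : ℝ} (ha : 0 ≤ a) (hs : (d : ℝ) < s) :
    Summable (powerLaw1 d a s) := by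
  refine summable_of_le_rpow (C := a) hs fun x hx => ?_
  rw [powerLaw1, if_neg hx, abs_of_nonneg
    (mul_nonneg ha (Real.rpow_nonneg (norm1_nonneg x) _))]
  exact mul_le_mul_of_nonneg_left (Real.rpow_le_rpow_of_nonpos (supNorm_pos hx)
    (supNorm_le_norm1 x) (by linarith [Nat.cast_nonneg (α := ℝ) d])) ha

theorem summable_powerLaw2 {a s : ℝ} (ha : 0 ≤ a) (hs : (d : ℝ) < s) :
    Summable (powerLaw2 d a s) := by
  refine summable_of_le_rpow (C := a) hs fun x hx => ?_
  have h0 : 0 ≤ norm2 x := Real.sqrt_nonneg _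
  rw [powerLaw2, if_neg hx, abs_of_nonneg (mul_nonneg ha (Real.rpow_nonneg h0 _))]
  exact mul_le_mul_of_nonneg_left (Real.rpow_le_rpow_of_nonpos (supNorm_pos hx)
    (supNorm_le_norm2 x) (by linarith [Nat.cast_nonneg (α := ℝ) d])) ha

theorem summable_yukawa {a b : ℝ} (ha : 0 ≤ a) (hb : 0 < b) : Summable (yukawa d a b) := by
  refine summable_of_le_rpow (C := a * ((d + 1).factorial / b ^ (d + 1))) (s := (d + 1 : ℕ))
    (by push_cast; linarith) fun x hx => ?_
  have hpos := supNorm_pos hx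
  set r := ‖(fun i => (x i : ℝ) : Fin d → ℝ)‖
  have hr : r ≤ norm1 x := supNorm_le_norm1 x
  rw [yukawa, abs_of_nonneg (mul_nonneg ha (Real.exp_pos _).le), mul_assoc]
  refine mul_le_mul_of_nonneg_left ?_ ha
  have h1 := Real.pow_div_factorial_le_exp (b * r) (by positivity) (d + 1)
  rw [Real.rpow_neg hpos.le, Real.rpow_natCast]
  have h2 : Real.exp (-b * norm1 x) ≤ (Real.exp (b * r))⁻¹ := by
    rw [← Real.exp_neg]
    refine Real.exp_le_exp.mpr ?_
    nlinarith
  refine h2.trans ?_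
  have h3 : (0 : ℝ) < (b * r) ^ (d + 1) / (d + 1).factorial := by positivity
  refine (inv_anti₀ h3 h1).trans (le_of_eq ?_)
  rw [mul_pow]
  field_simp

theorem summable_nearestNeighbour {a : ℝ} (ha : 0 ≤ a) : Summable (nearestNeighbour d a) := by
  refine Summable.of_nonneg_of_le (fun x => ?_) (fun x => ?_)
    (summable_yukawa (d := d) (mul_nonneg ha (Real.exp_pos 1).le) one_pos)
  · rw [nearestNeighbour]; split_ifs <;> simp [ha]
  · rw [nearestNeighbour, yukawa]
    split_ifs with h
    · rw [h, mul_assoc, ← Real.exp_add]; simp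
    · exact mul_nonneg (mul_nonneg ha (Real.exp_pos 1).le) (Real.exp_pos _).le

theorem hasSum_walkCount (n : ℕ) :
    HasSum (fun x : Fin d → ℤ => (walkCount n x : ℝ)) ((2 * (d : ℝ)) ^ n) := by
  have h : HasSum (fun x : Fin d → ℤ => ∑ w : Fin n → Fin d × Bool,
      if x = ∑ t, step (w t) then (1 : ℝ) else 0) (∑ _w : Fin n → Fin d × Bool, 1) :=
    hasSum_sum fun w _ => hasSum_ite_eq _ _
  convert h using 1
  · funext x
    rw [walkCount_eq_sum]
    push_cast
    simp only [eq_comm]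
  · simp [mul_comm]

theorem summable_walks {lam : ℝ} (h0 : 0 ≤ lam) (h1 : lam < 1) :
    Summable fun q : (Fin d → ℤ) × ℕ => (lam / (2 * d)) ^ q.2 * (walkCount q.2 q.1 : ℝ) := by
  set r := lam / (2 * (d : ℝ)) with hrdef
  have hr : 0 ≤ r := by positivity
  have hr1 : r * (2 * d) < 1 := by
    rcases eq_or_ne (2 * (d : ℝ)) 0 with h | h
    · rw [h, mul_zero]; exact one_pos
    · rwa [hrdef, div_mul_cancel₀ _ h]
  clear_value r
  have hpos : ∀ q : ℕ × (Fin d → ℤ), 0 ≤ r ^ q.1 * (walkCount q.1 q.2 : ℝ) :=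
    fun q => mul_nonneg (pow_nonneg hr _) (Nat.cast_nonneg _)
  have hS : Summable fun q : ℕ × (Fin d → ℤ) => r ^ q.1 * (walkCount q.1 q.2 : ℝ) := by
    rw [summable_prod_of_nonneg hpos]
    dsimp only
    refine ⟨fun n => Summable.mul_left (r ^ n) (hasSum_walkCount n).summable, ?_⟩
    have e : ∀ n : ℕ, ∑' x : Fin d → ℤ, r ^ n * (walkCount n x : ℝ) = (r * (2 * d)) ^ n :=
      fun n => by rw [tsum_mul_left, (hasSum_walkCount n).tsum_eq, ← mul_pow]
    exact (summable_geometric_of_lt_one (by positivity) hr1).congr fun n => (e n).symm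
  exact hS.prod_symm

theorem summable_randomWalk {m : ℕ} {c lam : ℝ} (hm : 1 ≤ m) (h0 : 0 ≤ lam) (h1 : lam < 1) :
    Summable (randomWalk d m c lam) := by
  have h := (summable_walks (d := d) h0 h1).prod.comp_injective
    (injective_add_smul (ℓ := m) hm 0)
  refine (h.mul_left c).congr fun x => ?_
  simp [randomWalk]

end Summability

section GoodCouplings

variable {d : ℕ}

/-- The properties of convex combinations of basic interactions used below. -/
structure GoodCoupling (J : (Fin d → ℤ) → ℝ) : Prop where
  summable : Summable J
  nonneg : ∀ x, 0 ≤ J x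
  flip : FlipInvariant J
  even : ∀ x, J (-x) = J x
  rp : LatticeRP J
  far : (∀ x, x ≠ 0 → J x = 0) ∨ ∀ j, 0 < J (Pi.single j 1)

theorem convex_goodCoupling : Convex ℝ {J : (Fin d → ℤ) → ℝ | GoodCoupling J} := by
  intro J hJ K hK a b ha hb _
  refine ⟨(hJ.summable.mul_left a).add (hK.summable.mul_left b), fun x => ?_, fun j x => ?_,
    fun x => ?_, fun j α _ X hX f => ?_, ?_⟩
  · exact add_nonneg (mul_nonneg ha (hJ.nonneg x)) (mul_nonneg hb (hK.nonneg x))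
  · simp [hJ.flip j x, hK.flip j x]
  · simp [hJ.even x, hK.even x]
  · have h := add_nonneg (mul_nonneg ha (hJ.rp j α X hX f)) (mul_nonneg hb (hK.rp j α X hX f))
    refine h.trans_eq ?_
    simp only [Finset.mul_sum, ← Finset.sum_add_distrib, Pi.add_apply, Pi.smul_apply, smul_eq_mul]
    refine Finset.sum_congr rfl fun x _ => Finset.sum_congr rfl fun y _ => ?_
    ring
  · rcases ha.eq_or_lt with rfl | ha
    · rcases hb.eq_or_lt with rfl | hb
      · left; simp
      · refine hK.far.imp (fun h x hx => ?_) fun h j => ?_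
        · simp [h x hx]
        · simpa using mul_pos hb (h j)
    · rcases hJ.far with h | h
      · rcases hb.eq_or_lt with rfl | hb
        · left; intro x hx; simp [h x hx]
        · refine hK.far.imp (fun h' x hx => ?_) fun h' j => ?_
          · simp [h x hx, h' x hx]
          · exact add_pos_of_nonneg_of_pos (mul_nonneg ha.le (hJ.nonneg _)) (mul_pos hb (h' j))
      · right
        intro j
        exact add_pos_of_pos_of_nonneg (mul_pos ha (h j)) (mul_nonneg hb (hK.nonneg _))

theorem abs_update_neg (j : Fin d) (x : Fin d → ℤ) (i : Fin d) :
    |((Function.update x j (-x j) i : ℤ) : ℝ)| = |(x i : ℝ)| := by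
  by_cases h : i = j
  · subst h; simp
  · simp [h]

theorem norm1_flip (j : Fin d) (x : Fin d → ℤ) :
    norm1 (Function.update x j (-x j)) = norm1 x := by
  simp only [norm1, abs_update_neg]

theorem norm2_flip (j : Fin d) (x : Fin d → ℤ) :
    norm2 (Function.update x j (-x j)) = norm2 x := by
  simp only [norm2, ← sq_abs ((_ : ℤ) : ℝ), abs_update_neg]

theorem norm1_neg (x : Fin d → ℤ) : norm1 (-x) = norm1 x := by simp [norm1]

theorem norm2_neg (x : Fin d → ℤ) : norm2 (-x) = norm2 x := by simp [norm2]

theorem update_neg_eq_zero_iff (j : Fin d) (x : Fin d → ℤ) :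
    Function.update x j (-x j) = 0 ↔ x = 0 := by
  refine ⟨fun h => ?_, fun h => by simp [h]⟩
  funext i
  have := congrFun h i
  by_cases hi : i = j
  · subst hi; simpa using this
  · simpa [hi] using this

theorem norm1_single (j : Fin d) : norm1 (Pi.single j 1 : Fin d → ℤ) = 1 := by
  rw [norm1, Finset.sum_eq_single j] <;> simp +contextual

theorem norm2_single (j : Fin d) : norm2 (Pi.single j 1 : Fin d → ℤ) = 1 := by
  rw [norm2, Finset.sum_eq_single j] <;> simp +contextual

theorem goodCoupling_nearestNeighbour {a : ℝ} (ha : 0 ≤ a) :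
    GoodCoupling (nearestNeighbour d a) := by
  refine ⟨summable_nearestNeighbour ha, fun x => ?_, fun j x => ?_, fun x => ?_,
    latticeRP_nearestNeighbour ha, ?_⟩
  · rw [nearestNeighbour]; split_ifs <;> simp [ha]
  · simp only [nearestNeighbour, norm1_flip]
  · simp only [nearestNeighbour, norm1_neg]
  · rcases ha.eq_or_lt with rfl | ha
    · left; intro x _; simp [nearestNeighbour]
    · right; intro j; simpa [nearestNeighbour, norm1_single] using ha

theorem goodCoupling_yukawa {a b : ℝ} (ha : 0 ≤ a) (hb : 0 < b) :
    GoodCoupling (yukawa d a b) := by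
  refine ⟨summable_yukawa ha hb, fun x => mul_nonneg ha (Real.exp_pos _).le, fun j x => ?_,
    fun x => ?_, latticeRP_yukawa ha hb, ?_⟩
  · simp only [yukawa, norm1_flip]
  · simp only [yukawa, norm1_neg]
  · rcases ha.eq_or_lt with rfl | ha
    · left; intro x _; simp [yukawa]
    · right; intro j; exact mul_pos ha (Real.exp_pos _)

theorem goodCoupling_powerLaw1 {a s : ℝ} (ha : 0 ≤ a) (hs : (d : ℝ) < s) :
    GoodCoupling (powerLaw1 d a s) := by
  refine ⟨summable_powerLaw1 ha hs, fun x => ?_, fun j x => ?_, fun x => ?_,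
    latticeRP_powerLaw1 ha hs, ?_⟩
  · rw [powerLaw1]
    split_ifs
    · exact le_rfl
    · exact mul_nonneg ha (Real.rpow_nonneg (norm1_nonneg x) _)
  · simp only [powerLaw1, norm1_flip, update_neg_eq_zero_iff]
  · simp only [powerLaw1, norm1_neg, neg_eq_zero]
  · rcases ha.eq_or_lt with rfl | ha
    · left; intro x _; simp [powerLaw1]
    · right; intro j; simpa [powerLaw1, norm1_single] using ha

theorem goodCoupling_powerLaw2 {a s : ℝ} (ha : 0 ≤ a) (hs : (d : ℝ) < s) :
    GoodCoupling (powerLaw2 d a s) := by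
  refine ⟨summable_powerLaw2 ha hs, fun x => ?_, fun j x => ?_, fun x => ?_,
    latticeRP_powerLaw2 ha hs, ?_⟩
  · rw [powerLaw2]
    split_ifs
    · exact le_rfl
    · exact mul_nonneg ha (Real.rpow_nonneg (Real.sqrt_nonneg _) _)
  · simp only [powerLaw2, norm2_flip, update_neg_eq_zero_iff]
  · simp only [powerLaw2, norm2_neg, neg_eq_zero]
  · rcases ha.eq_or_lt with rfl | ha
    · left; intro x _; simp [powerLaw2]
    · right; intro j; simpa [powerLaw2, norm2_single] using ha

theorem walkCount_straight_pos (m : ℕ) (j : Fin d) :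
    0 < walkCount m ((m : ℤ) • (Pi.single j 1 : Fin d → ℤ)) := by
  rw [walkCount, Fintype.card_pos_iff]
  exact ⟨⟨fun _ => (j, true), by simp [step]⟩⟩

theorem goodCoupling_randomWalk {m : ℕ} {c lam : ℝ} (hm : 1 ≤ m) (hc : 0 ≤ c) (h0 : 0 ≤ lam)
    (h1 : lam < 1) : GoodCoupling (randomWalk d m c lam) := by
  refine ⟨summable_randomWalk hm h0 h1, fun x => ?_, fun j x => ?_, fun x => ?_,
    latticeRP_randomWalk hm hc h0 h1, ?_⟩
  · exact mul_nonneg hc (tsum_nonneg fun n => by positivity)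
  · have : (m : ℤ) • Function.update x j (-x j) =
        Function.update ((m : ℤ) • x) j (-((m : ℤ) • x) j) := by
      funext i
      by_cases h : i = j
      · subst h; simp
      · simp [h]
    simp only [randomWalk, this, walkCount_flip]
  · simp only [randomWalk, smul_neg, walkCount_neg]
  · rcases hc.eq_or_lt with rfl | hc
    · left; intro x _; simp [randomWalk]
    rcases h0.eq_or_lt with rfl | h0
    · left
      intro x hx
      have hmx : (m : ℤ) • x ≠ 0 := smul_ne_zero (by exact_mod_cast (by omega : m ≠ 0)) hx
      rw [randomWalk]
      have : ∀ n : ℕ, ((0 : ℝ) / (2 * d)) ^ n * (walkCount n ((m : ℤ) • x) : ℝ) = 0 := by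
        intro n
        cases n with
        | zero => rw [walkCount_zero, if_neg hmx]; simp
        | succ n => simp
      simp only [this, tsum_zero, mul_zero]
    · right
      intro j
      have hd : 0 < d := j.pos
      refine mul_pos hc ?_
      refine Summable.tsum_pos ((summable_walks (d := d) h0.le h1).prod_factor _)
        (fun n => by positivity) m ?_
      have := walkCount_straight_pos m j
      positivity

theorem GoodCoupling.of_mem_convexHull {J : (Fin d → ℤ) → ℝ}
    (hJ : J ∈ convexHull ℝ (basicCouplings d)) : GoodCoupling J := by
  refine convexHull_min ?_ convex_goodCoupling hJ
  rintro J (⟨a, ha, rfl⟩ | ⟨a, b, ha, hb, rfl⟩ | ⟨a, s, ha, hs, rfl⟩ |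
    ⟨m, c, lam, hm, hc, h0, h1, rfl⟩ | ⟨a, s, ha, hs, rfl⟩)
  · exact goodCoupling_nearestNeighbour ha
  · exact goodCoupling_yukawa ha hb
  · exact goodCoupling_powerLaw1 ha hs
  · exact goodCoupling_randomWalk hm hc h0 h1
  · exact goodCoupling_powerLaw2 ha hs

end GoodCouplings

end

section

set_option linter.unusedSectionVars false
open scoped Matrix.Norms.Operator ComplexOrder
open Filter Topology QSpin

section PeriodicCoupling

variable {d : ℕ}

theorem periodise_congr {ℓ : ℕ} (J : (Fin d → ℤ) → ℝ) {u v : Fin d → ℤ}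
    (h : ∀ i, (u i : ZMod ℓ) = v i) : periodise ℓ J u = periodise ℓ J v := by
  have h' : ∀ i, ∃ c, v i - u i = ℓ * c := fun i =>
    (ZMod.intCast_eq_intCast_iff_dvd_sub _ _ _).mp (h i)
  choose c hc using h'
  have hv : v = u + (ℓ : ℤ) • c := by
    funext i
    have := hc i
    simp only [Pi.add_apply, Pi.smul_apply, smul_eq_mul]
    linarith
  rw [periodise, periodise, ← (Equiv.addLeft c).tsum_eq]
  refine tsum_congr fun z => ?_
  rw [hv, Equiv.coe_addLeft, smul_add, add_assoc]

theorem periodise_flip {ℓ : ℕ} {J : (Fin d → ℤ) → ℝ} (hJ : FlipInvariant J) (j : Fin d)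
    (u : Fin d → ℤ) : periodise ℓ J (Function.update u j (-u j)) = periodise ℓ J u := by
  let e : (Fin d → ℤ) ≃ (Fin d → ℤ) :=
    ⟨fun z => Function.update z j (-z j), fun z => Function.update z j (-z j),
      fun z => by simp, fun z => by simp⟩
  rw [periodise, periodise, ← e.tsum_eq]
  refine tsum_congr fun z => ?_
  rw [← hJ j (u + (ℓ : ℤ) • z)]
  congr 1
  funext i
  by_cases h : i = j
  · subst h; simp [e]; ring
  · simp [e, h]

theorem periodise_neg {ℓ : ℕ} {J : (Fin d → ℤ) → ℝ} (hJ : ∀ x, J (-x) = J x) (u : Fin d → ℤ) :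
    periodise ℓ J (-u) = periodise ℓ J u := by
  rw [periodise, periodise, ← (Equiv.neg (Fin d → ℤ)).tsum_eq]
  refine tsum_congr fun z => ?_
  rw [← hJ]
  congr 1
  simp [add_comm]

theorem periodise_eq_of_reflect {ℓ : ℕ} {J : (Fin d → ℤ) → ℝ} (hJ : FlipInvariant J) (j : Fin d)
    {u v : Fin d → ℤ} (h : ∀ i, i ≠ j → (u i : ZMod ℓ) = v i)
    (hj : (u j : ZMod ℓ) = v j ∨ (u j : ZMod ℓ) = -v j) : periodise ℓ J u = periodise ℓ J v := by
  rcases hj with hj | hj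
  · exact periodise_congr J fun i => if hi : i = j then hi ▸ hj else h i hi
  · rw [← periodise_flip hJ j v]
    refine periodise_congr J fun i => ?_
    by_cases hi : i = j
    · subst hi; simpa using hj
    · simpa [hi] using h i hi

/-- The coordinates of the torus as residues. -/
def residue {ℓ : ℕ} (a : Fin ℓ) : ZMod ℓ := ((a : ℕ) : ZMod ℓ)

theorem residue_injective {ℓ : ℕ} : Function.Injective (residue (ℓ := ℓ)) := by
  intro a b h
  rw [residue, residue, ZMod.natCast_eq_natCast_iff'] at h
  rw [Nat.mod_eq_of_lt a.2, Nat.mod_eq_of_lt b.2] at h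
  exact Fin.ext h

theorem residue_add {ℓ : ℕ} (a b : Fin ℓ) : residue (a + b) = residue a + residue b := by
  rw [residue, Fin.val_add, ZMod.natCast_mod, Nat.cast_add]; rfl

theorem residue_sub {ℓ : ℕ} [NeZero ℓ] (a b : Fin ℓ) : residue (a - b) = residue a - residue b := by
  rw [eq_sub_iff_add_eq, ← residue_add, sub_add_cancel]

theorem residue_zero {ℓ : ℕ} [NeZero ℓ] : residue (0 : Fin ℓ) = 0 := by simp [residue]

theorem residue_one {ℓ : ℕ} [NeZero ℓ] : residue (1 : Fin ℓ) = 1 := by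
  rw [residue, Fin.val_one', ZMod.natCast_mod, Nat.cast_one]

theorem cast_pos {ℓ : ℕ} (x : Box d ℓ) (i : Fin d) : ((pos x i : ℤ) : ZMod ℓ) = residue (x i) := by
  simp [pos, residue]

end PeriodicCoupling

section TorusReflections

variable {d : ℕ}

/-- The two halves of `Λ` exchanged by an involution. -/
noncomputable def halves {Λ : Type*} (θ : Λ → Λ) (hθ : ∀ z, θ (θ z) = z) (p : Λ → Prop)
    (hp : ∀ z, p (θ z) ↔ ¬ p z) : {z // p z} ⊕ {z // p z} ≃ Λ :=
  Equiv.ofBijective (Sum.elim (fun z => z.1) fun z => θ z.1) (by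
    constructor
    · have hθi : Function.Injective θ := fun a b h => by rw [← hθ a, h, hθ]
      rintro (a | a) (b | b) h
      · exact congrArg Sum.inl (Subtype.ext h)
      · have h : a.1 = θ b.1 := h
        exact absurd b.2 ((hp _).mp (h ▸ a.2))
      · have h : θ a.1 = b.1 := h
        exact absurd a.2 ((hp _).mp (h ▸ b.2))
      · exact congrArg Sum.inr (Subtype.ext (hθi h))
    · intro z
      by_cases hz : p z
      · exact ⟨Sum.inl ⟨z, hz⟩, rfl⟩
      · exact ⟨Sum.inr ⟨θ z, (hp z).mpr hz⟩, hθ z⟩)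

/-- Nearest neighbours on the torus. -/
def torusAdj {ℓ : ℕ} [NeZero ℓ] (x y : Box d ℓ) : Prop :=
  ∃ j, (∀ i, i ≠ j → x i = y i) ∧ (y j = x j + 1 ∨ x j = y j + 1)

theorem torusAdj.symm {ℓ : ℕ} [NeZero ℓ] {x y : Box d ℓ} (h : torusAdj x y) : torusAdj y x := by
  obtain ⟨j, h1, h2⟩ := h
  exact ⟨j, fun i hi => (h1 i hi).symm, h2.symm⟩

theorem eq_of_torusAdj {ℓ : ℕ} [NeZero ℓ] {β : Type*} (v : Box d ℓ → β)
    (h : ∀ x y, torusAdj x y → v x = v y) (x y : Box d ℓ) : v x = v y := by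
  have h1 : ∀ (x : Box d ℓ) (j : Fin d) (n : ℕ) (hn : n < ℓ),
      v (Function.update x j ⟨n, hn⟩) = v (Function.update x j 0) := by
    intro x j n
    induction n with
    | zero => intro hn; rfl
    | succ n ih =>
      intro hn
      rw [← ih (by omega)]
      refine (h _ _ ⟨j, fun i hi => by simp [hi], Or.inl ?_⟩).symm
      rw [Function.update_self, Function.update_self]
      apply Fin.ext
      rw [Fin.val_add, Fin.val_one', Nat.mod_eq_of_lt (a := 1) (by omega),
        Nat.mod_eq_of_lt (by simpa using hn)]
  have h2 : ∀ (x : Box d ℓ) (j : Fin d) (c : Fin ℓ), v (Function.update x j c) = v x := by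
    intro x j c
    have h3 := h1 x j c c.2
    have h4 := h1 x j (x j) (x j).2
    rw [Fin.eta, Function.update_eq_self] at h4
    rw [h4, ← h3]
  have h3 : ∀ s : Finset (Fin d), v (s.piecewise y x) = v x := by
    intro s
    induction s using Finset.induction_on with
    | empty => simp
    | insert j s _ ih => rw [Finset.piecewise_insert, h2, ih]
  have h4 := h3 Finset.univ
  rw [Finset.piecewise_univ] at h4
  exact h4.symm

/-- A reflection of the torus in direction `j`, in terms of a coordinate `t` in which it is
`t ↦ -1 - t`. -/
structure TorusReflection (d ℓ : ℕ) [NeZero ℓ] where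
  j : Fin d
  ρ : Fin ℓ → Fin ℓ
  t : Fin ℓ → Fin ℓ
  ρ_ρ : ∀ c, ρ (ρ c) = c
  t_ρ : ∀ c, residue (t (ρ c)) = -1 - residue (t c)
  t_sub : (∀ a b, residue (t a) - residue (t b) = residue a - residue b) ∨
    ∀ a b, residue (t a) - residue (t b) = residue b - residue a

namespace TorusReflection

variable {ℓ : ℕ} [NeZero ℓ] (r : TorusReflection d ℓ)

/-- The action on the box. -/
def θ (x : Box d ℓ) : Box d ℓ := Function.update x r.j (r.ρ (x r.j))

theorem θ_self (x : Box d ℓ) : r.θ x r.j = r.ρ (x r.j) := by simp [θ]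

theorem θ_of_ne (x : Box d ℓ) {i : Fin d} (h : i ≠ r.j) : r.θ x i = x i := by simp [θ, h]

theorem θ_θ (x : Box d ℓ) : r.θ (r.θ x) = x := by
  funext i
  by_cases h : i = r.j
  · rw [h, θ_self, θ_self, ρ_ρ]
  · rw [θ_of_ne _ _ h, θ_of_ne _ _ h]

theorem t_injective : Function.Injective r.t := by
  intro a b h
  apply residue_injective
  rcases r.t_sub with h' | h'
  · have := h' a b; rw [h, sub_self] at this; exact (sub_eq_zero.mp this.symm)
  · have := h' a b; rw [h, sub_self] at this; exact (sub_eq_zero.mp this.symm).symm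

theorem residue_ρ_sub (a b : Fin ℓ) :
    residue (r.ρ a) - residue (r.ρ b) = -(residue a - residue b) := by
  rcases r.t_sub with h | h
  · have h1 := h (r.ρ a) (r.ρ b); have h2 := h a b
    rw [r.t_ρ, r.t_ρ] at h1
    linear_combination -h1 - h2
  · have h1 := h (r.ρ a) (r.ρ b); have h2 := h a b
    rw [r.t_ρ, r.t_ρ] at h1
    linear_combination h1 + h2

theorem residue_t_ρ_sub (a b : Fin ℓ) :
    residue a - residue (r.ρ b) = residue (r.t a) + residue (r.t b) + 1 ∨
    residue a - residue (r.ρ b) = -(residue (r.t a) + residue (r.t b) + 1) := by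
  rcases r.t_sub with h | h
  · left
    have h1 := h a (r.ρ b)
    rw [r.t_ρ] at h1
    linear_combination -h1
  · right
    have h1 := h a (r.ρ b)
    rw [r.t_ρ] at h1
    linear_combination h1

theorem torusAdj_θ {x y : Box d ℓ} (h : torusAdj x y) : torusAdj (r.θ x) (r.θ y) := by
  obtain ⟨l, h1, h2⟩ := h
  refine ⟨l, fun i hi => ?_, ?_⟩
  · by_cases hij : i = r.j
    · rw [hij, θ_self, θ_self, h1 _ (hij ▸ hi)]
    · rw [θ_of_ne _ _ hij, θ_of_ne _ _ hij, h1 i hi]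
  · by_cases hlj : l = r.j
    · subst hlj
      rw [θ_self, θ_self]
      have h3 := r.residue_ρ_sub (x r.j) (y r.j)
      refine h2.symm.imp (fun h => ?_) fun h => ?_
      · apply residue_injective
        rw [h, residue_add, residue_one] at h3
        rw [residue_add, residue_one, h]
        linear_combination -h3
      · apply residue_injective
        rw [h, residue_add, residue_one] at h3
        rw [residue_add, residue_one, h]
        linear_combination h3
    · rw [θ_of_ne _ _ hlj, θ_of_ne _ _ hlj]
      exact h2

theorem val_t_ρ (c : Fin ℓ) : (r.t (r.ρ c) : ℕ) + r.t c + 1 = ℓ := by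
  have h := r.t_ρ c
  have h1 : (((r.t (r.ρ c) : ℕ) + r.t c + 1 : ℕ) : ZMod ℓ) = 0 := by
    push_cast
    change residue _ + residue _ + 1 = 0
    rw [h]; ring
  rw [ZMod.natCast_eq_zero_iff] at h1
  obtain ⟨k, hk⟩ := h1
  have h2 := (r.t (r.ρ c)).2
  have h3 := (r.t c).2
  have h4 : k = 1 := by
    have : k < 2 := by
      by_contra hk2
      have : ℓ * 2 ≤ ℓ * k := Nat.mul_le_mul_left _ (by omega)
      omega
    rcases Nat.eq_zero_or_pos k with h0 | h0
    · subst h0; omega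
    · omega
  rw [hk, h4, mul_one]

/-- The half of the torus where `t < h`. -/
def Left (h : ℕ) (x : Box d ℓ) : Prop := (r.t (x r.j) : ℕ) < h

theorem left_θ {h : ℕ} (hℓ : ℓ = h + h) (x : Box d ℓ) : r.Left h (r.θ x) ↔ ¬ r.Left h x := by
  rw [Left, Left, θ_self]
  have := r.val_t_ρ (x r.j)
  omega

theorem eq_of_torusAdj_θ {h : ℕ} (hℓ : ℓ = h + h) {a b : Box d ℓ} (ha : r.Left h a)
    (hb : r.Left h b) (hab : torusAdj a (r.θ b)) : a = b := by
  obtain ⟨l, h1, h2⟩ := hab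
  by_cases hl : l = r.j
  · subst hl
    have hne : ∀ i, i ≠ r.j → a i = b i := fun i hi => (h1 i hi).trans (r.θ_of_ne b hi)
    rw [θ_self] at h2
    have key : r.t (a r.j) = r.t (b r.j) := by
      have h3 : residue (a r.j) - residue (r.ρ (b r.j)) = 1 ∨
          residue (a r.j) - residue (r.ρ (b r.j)) = -1 := by
        refine h2.symm.imp (fun h => ?_) fun h => ?_
        · rw [h, residue_add, residue_one]; ring
        · rw [h, residue_add, residue_one]; ring
      have h4 : residue (r.t (a r.j)) + residue (r.t (b r.j)) = 0 ∨
          residue (r.t (a r.j)) + residue (r.t (b r.j)) + 2 = 0 := by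
        rcases r.residue_t_ρ_sub (a r.j) (b r.j) with h5 | h5 <;> rcases h3 with h3 | h3
        · left; linear_combination h3 - h5
        · right; linear_combination h3 - h5
        · right; linear_combination h5 - h3
        · left; linear_combination h5 - h3
      rw [Left] at ha hb
      apply Fin.ext
      rcases h4 with h4 | h4
      · have h5 : (((r.t (a r.j) : ℕ) + r.t (b r.j) : ℕ) : ZMod ℓ) = 0 := by
          push_cast; exact h4
        rw [ZMod.natCast_eq_zero_iff] at h5
        have := Nat.eq_zero_of_dvd_of_lt h5 (by omega)
        omega
      · have h5 : (((r.t (a r.j) : ℕ) + r.t (b r.j) + 2 : ℕ) : ZMod ℓ) = 0 := by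
          push_cast; exact h4
        rw [ZMod.natCast_eq_zero_iff] at h5
        have := Nat.le_of_dvd (by omega) h5
        omega
    funext i
    by_cases hi : i = r.j
    · rw [hi]; exact r.t_injective key
    · exact hne i hi
  · exfalso
    have h3 := h1 r.j (Ne.symm hl)
    have h4 : r.Left h (r.θ b) := by rw [Left, ← h3]; exact ha
    exact (r.left_θ hℓ b).mp h4 hb

theorem periodise_θ_θ {J : (Fin d → ℤ) → ℝ} (hJ : FlipInvariant J) (x y : Box d ℓ) :
    periodise ℓ J (pos (r.θ x) - pos (r.θ y)) = periodise ℓ J (pos x - pos y) := by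
  refine periodise_eq_of_reflect hJ r.j (fun i hi => ?_) (Or.inr ?_)
  · simp only [Pi.sub_apply, Int.cast_sub, cast_pos, r.θ_of_ne _ hi]
  · simp only [Pi.sub_apply, Int.cast_sub, cast_pos, r.θ_self]
    exact r.residue_ρ_sub _ _

theorem periodise_θ_nonneg {J : (Fin d → ℤ) → ℝ} (hJ : GoodCoupling J) {h : ℕ} (hℓ : ℓ = h + h)
    {α : Type} [Fintype α] (x : α → Box d ℓ) (hx : ∀ a, r.Left h (x a)) (f : α → ℝ) :
    0 ≤ ∑ a, ∑ b, f a * f b * periodise ℓ J (pos (x a) - pos (r.θ (x b))) := by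
  have hh : 0 < h := by
    have := NeZero.pos ℓ
    omega
  have key := periodise_reflDiff_nonneg hJ.summable hJ.rp hJ.flip hh r.j
    (fun a i => if i = r.j then ((r.t (x a r.j) : ℕ) : ℤ) else pos (x a) i)
    (fun a => by simp) (fun a => by simpa [TorusReflection.Left] using hx a) f
  refine key.trans_eq ?_
  rw [← hℓ]
  refine Finset.sum_congr rfl fun a _ => Finset.sum_congr rfl fun b _ => ?_
  congr 1
  refine (periodise_eq_of_reflect hJ.flip r.j (fun i hi => ?_) ?_).symm
  · simp [reflDiff, hi, cast_pos, r.θ_of_ne _ hi]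
  · simp only [reflDiff, if_true, Pi.sub_apply, Int.cast_sub, cast_pos, r.θ_self]
    push_cast
    exact r.residue_t_ρ_sub _ _

end TorusReflection

theorem exists_torusReflection {ℓ : ℕ} [NeZero ℓ] {x y : Box d ℓ} (hxy : torusAdj x y) :
    ∃ r : TorusReflection d ℓ, r.θ x = y ∧ (r.t (x r.j) : ℕ) = 0 := by
  obtain ⟨j, h1, h2⟩ := hxy
  have hr : ∀ z : Fin ℓ, residue (x j + y j - z) = residue (x j) + residue (y j) - residue z := by
    intro z; rw [residue_sub, residue_add]
  have hval : ∀ c : Fin ℓ, residue c = 0 → (c : ℕ) = 0 := by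
    intro c hc
    rw [← residue_zero] at hc
    rw [residue_injective hc]
    rfl
  rcases h2 with h2 | h2
  · refine ⟨⟨j, fun z => x j + y j - z, fun z => x j - z, fun c => by abel, fun c => ?_,
      Or.inr fun a b => ?_⟩, ?_, ?_⟩
    · rw [residue_sub, hr, h2, residue_sub, residue_add, residue_one]; ring
    · rw [residue_sub, residue_sub]; ring
    · funext i
      by_cases hi : i = j
      · subst hi; simp [TorusReflection.θ]
      · simp [TorusReflection.θ, hi, h1 i hi]
    · exact hval _ (by rw [residue_sub, sub_self])
  · refine ⟨⟨j, fun z => x j + y j - z, fun z => z - x j, fun c => by abel, fun c => ?_,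
      Or.inl fun a b => ?_⟩, ?_, ?_⟩
    · rw [residue_sub, hr, h2, residue_sub, residue_add, residue_one]; ring
    · rw [residue_sub, residue_sub]; ring
    · funext i
      by_cases hi : i = j
      · subst hi; simp [TorusReflection.θ]
      · simp [TorusReflection.θ, hi, h1 i hi]
    · exact hval _ (by rw [residue_sub, sub_self])

end TorusReflections

section TorusDomination

variable {d : ℕ} {ι q : Type*} [Fintype ι] [DecidableEq ι] [Fintype q] [DecidableEq q] [Nonempty q]

theorem trace_exp_re_pos {n : Type*} [Fintype n] [DecidableEq n] [Nonempty n] {M : Matrix n n ℂ}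
    (hM : M.IsHermitian) : 0 < (NormedSpace.exp M).trace.re := by
  set B := NormedSpace.exp ((1 / 2 : ℝ) • M) with hB
  have hBh : B.IsHermitian := Matrix.IsHermitian.exp (by
    rw [Matrix.IsHermitian, Matrix.conjTranspose_smul, hM, star_trivial])
  have h1 : NormedSpace.exp M = B.conjTranspose * B := by
    rw [hBh, hB, ← Matrix.exp_add_of_commute _ _ (Commute.refl _), ← add_smul]
    norm_num
  have hu : IsUnit B := Matrix.isUnit_exp _
  have h2 : (B.conjTranspose * B).PosDef :=
    Matrix.PosDef.conjTranspose_mul_self _ (Matrix.mulVec_injective_of_isUnit hu)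
  rw [h1]
  exact (Complex.pos_iff.mp h2.trace_pos).1

theorem isHermitian_siteOp {Λ : Type*} [Fintype Λ] [DecidableEq Λ] {A : Matrix q q ℂ}
    (hA : A.IsHermitian) (x : Λ) : (siteOp A x).IsHermitian := by
  rw [Matrix.IsHermitian, conjTranspose_siteOp, hA]

theorem isHermitian_fieldEnergy {Λ : Type*} [Fintype Λ] [DecidableEq Λ] {K : ι → Λ → Λ → ℝ}
    (hsymm : ∀ i x y, K i x y = K i y x) {T : ι → ℝ → Matrix q q ℂ} {W : ℝ → Matrix q q ℂ}
    (hT : ∀ i r, (T i r).IsHermitian) (hW : ∀ r, (W r).IsHermitian) (v : Λ → ℝ) :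
    (fieldEnergy K T W v).IsHermitian := by
  rw [Matrix.IsHermitian, fieldEnergy, Matrix.conjTranspose_add, Matrix.conjTranspose_sum,
    Matrix.conjTranspose_sum]
  congr 1
  · refine Finset.sum_congr rfl fun i _ => ?_
    simp only [Matrix.conjTranspose_sum, Matrix.conjTranspose_smul, Matrix.conjTranspose_mul,
      star_trivial, (isHermitian_siteOp (hT i _) _).eq]
    rw [Finset.sum_comm]
    refine Finset.sum_congr rfl fun x _ => Finset.sum_congr rfl fun y _ => ?_
    rw [hsymm]
  · exact Finset.sum_congr rfl fun x _ => isHermitian_siteOp (hW _) x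

/-- Gaussian domination on an even torus. -/
theorem trace_exp_fieldEnergy_le {ℓ h : ℕ} [NeZero ℓ] (hℓ : ℓ = h + h) {β : ℝ} (hβ : 0 ≤ β)
    {G : ι → (Fin d → ℤ) → ℝ} (hG : ∀ i, GoodCoupling (G i)) (s : ι → ℝ)
    (hs : ∀ i, s i * s i = 1) {K : ι → Box d ℓ → Box d ℓ → ℝ}
    (hK : ∀ i x y, K i x y = s i * (β * periodise ℓ (G i) (pos x - pos y)))
    (T : ι → ℝ → Matrix q q ℂ) (W : ℝ → Matrix q q ℂ)
    (hTh : ∀ i r, (T i r).IsHermitian) (hWh : ∀ r, (W r).IsHermitian)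
    (hT : ∀ i r, conjMap (T i r) = s i • T i r) (hW : ∀ r, conjMap (W r) = W r)
    (hconst : ∀ c : ℝ, fieldEnergy K T W (fun _ => c) = fieldEnergy K T W 0) (v : Box d ℓ → ℝ) :
    (NormedSpace.exp (fieldEnergy K T W v)).trace.re ≤
      (NormedSpace.exp (fieldEnergy K T W 0)).trace.re := by
  have hsymm : ∀ i x y, K i x y = K i y x := by
    intro i x y
    rw [hK, hK, ← periodise_neg (hG i).even, neg_sub]
  refine le_const_of_reflections (fun v => (NormedSpace.exp (fieldEnergy K T W v)).trace.re)
    (fun v => trace_exp_re_pos (isHermitian_fieldEnergy hsymm hTh hWh v)) torusAdj ?_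
    (fun v hv x y => eq_of_torusAdj v hv x y) (fun c => by simp only [hconst]) v
  intro x y hxy _
  obtain ⟨r, hrx, hrt⟩ := exists_torusReflection hxy
  have hh : 0 < h := by have := NeZero.pos ℓ; omega
  classical
  refine ⟨{z : Box d ℓ // r.Left h z}, inferInstance,
    halves r.θ r.θ_θ (r.Left h) (r.left_θ hℓ), ⟨⟨x, ?_⟩, rfl, hrx⟩, fun a b => ?_,
    fun a b hab => ?_, fun a b hab => ?_, fun v => ?_⟩
  · rw [TorusReflection.Left, hrt]; exact hh
  · refine ⟨fun hab => r.torusAdj_θ hab, fun hab => ?_⟩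
    have := r.torusAdj_θ hab
    change torusAdj (r.θ (r.θ a.1)) (r.θ (r.θ b.1)) at this
    rwa [r.θ_θ, r.θ_θ] at this
  · exact Subtype.ext (r.eq_of_torusAdj_θ hℓ a.2 b.2 hab)
  · exact (Subtype.ext (r.eq_of_torusAdj_θ hℓ b.2 a.2 hab.symm)).symm
  · refine trace_exp_fieldEnergy_sq_le _ K (fun i a b => ?_) hsymm (fun i a b => ?_) T W s hs hT hW
      (fun i f => ?_) v
    · change K i a.1 b.1 = K i (r.θ a.1) (r.θ b.1)
      rw [hK, hK, r.periodise_θ_θ (hG i).flip]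
    · change K i a.1 (r.θ b.1) = K i b.1 (r.θ a.1)
      rw [hsymm i b.1, hK, hK, ← r.periodise_θ_θ (hG i).flip a.1, r.θ_θ]
    · have h1 := mul_nonneg hβ (r.periodise_θ_nonneg (hG i) hℓ
        (fun a : {z : Box d ℓ // r.Left h z} => a.1) (fun a => a.2) f)
      refine h1.trans_eq ?_
      simp only [Finset.mul_sum]
      refine Finset.sum_congr rfl fun a _ => Finset.sum_congr rfl fun b _ => ?_
      change _ = f a * f b * (s i * K i a.1 (r.θ b.1))
      rw [hK, ← mul_assoc (s i), hs]
      ring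

end TorusDomination

end

section

set_option linter.unusedSectionVars false
open scoped Matrix.Norms.Operator ComplexOrder
open Filter Topology QSpin

section SpinMatrices

variable (N : ℕ)

theorem conjTranspose_raising : (raising N).conjTranspose = lowering N := by
  ext a b
  simp only [raising, lowering, Matrix.conjTranspose_apply, Matrix.of_apply]
  split_ifs with h
  · rw [Complex.star_def, Complex.conj_ofReal]
    congr 3
    simp only [weight, h]
    push_cast
    ring
  · simp

theorem conjTranspose_lowering : (lowering N).conjTranspose = raising N := by
  rw [← conjTranspose_raising, Matrix.conjTranspose_conjTranspose]

theorem conjMap_raising : conjMap (raising N) = raising N := by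
  ext a b
  simp only [raising, conjMap_apply, Matrix.of_apply]
  split_ifs
  · rw [Complex.conj_ofReal]
  · simp

theorem conjMap_lowering : conjMap (lowering N) = lowering N := by
  ext a b
  simp only [lowering, conjMap_apply, Matrix.of_apply]
  split_ifs
  · rw [Complex.conj_ofReal]
  · simp

theorem spinMatrix_zero : spinMatrix N 0 = (1 / 2 : ℂ) • (raising N + lowering N) := rfl

theorem spinMatrix_one :
    spinMatrix N 1 = (1 / (2 * Complex.I) : ℂ) • (raising N - lowering N) := rfl

theorem spinMatrix_two : spinMatrix N 2 = Matrix.diagonal fun a => (weight a : ℂ) := rfl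

theorem isHermitian_spinMatrix (i : Fin 3) : (spinMatrix N i).IsHermitian := by
  fin_cases i
  · change (spinMatrix N 0).IsHermitian
    rw [Matrix.IsHermitian, spinMatrix_zero, Matrix.conjTranspose_smul, Matrix.conjTranspose_add,
      conjTranspose_raising, conjTranspose_lowering, add_comm (lowering N)]
    simp
  · change (spinMatrix N 1).IsHermitian
    rw [Matrix.IsHermitian, spinMatrix_one, Matrix.conjTranspose_smul, Matrix.conjTranspose_sub,
      conjTranspose_raising, conjTranspose_lowering, ← neg_sub, smul_neg, ← neg_smul]
    congr 1
    simp
  · change (spinMatrix N 2).IsHermitian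
    rw [spinMatrix_two]
    refine Matrix.isHermitian_diagonal_of_self_adjoint _ ?_
    funext a
    simp

/-- The sign of the spin matrices under complex conjugation. -/
def spinSign (i : Fin 3) : ℝ := if i = 1 then -1 else 1

theorem spinSign_mul_self (i : Fin 3) : spinSign i * spinSign i = 1 := by
  unfold spinSign; split_ifs <;> norm_num

theorem conjMap_smul_complex {m : Type*} [Fintype m] [DecidableEq m] (c : ℂ) (A : Matrix m m ℂ) :
    conjMap (c • A) = (starRingEnd ℂ) c • conjMap A := by
  ext i j; simp [conjMap_apply]

theorem conjMap_spinMatrix (i : Fin 3) :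
    conjMap (spinMatrix N i) = spinSign i • spinMatrix N i := by
  fin_cases i
  · change conjMap (spinMatrix N 0) = spinSign 0 • spinMatrix N 0
    rw [spinMatrix_zero, conjMap_smul_complex, map_add, conjMap_raising, conjMap_lowering]
    have : (starRingEnd ℂ) 2 = 2 := Complex.conj_ofNat 2
    simp [spinSign, this]
  · change conjMap (spinMatrix N 1) = spinSign 1 • spinMatrix N 1
    rw [spinMatrix_one, conjMap_smul_complex, map_sub, conjMap_raising, conjMap_lowering]
    have : (starRingEnd ℂ) 2 = 2 := Complex.conj_ofNat 2
    simp [spinSign, this]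
  · change conjMap (spinMatrix N 2) = spinSign 2 • spinMatrix N 2
    ext a b
    by_cases h : a = b
    · simp [spinMatrix_two, conjMap_apply, h, spinSign]
    · simp [spinMatrix_two, conjMap_apply, h]

theorem spinMatrix_two_mul_raising :
    spinMatrix N 2 * raising N = raising N * spinMatrix N 2 + raising N := by
  ext a b
  rw [spinMatrix_two, Matrix.add_apply, Matrix.diagonal_mul, Matrix.mul_diagonal, raising,
    Matrix.of_apply]
  split_ifs with h
  · simp only [weight, h]
    push_cast
    ring
  · simp

theorem spinMatrix_two_mul_lowering :
    spinMatrix N 2 * lowering N = lowering N * spinMatrix N 2 - lowering N := by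
  ext a b
  rw [spinMatrix_two, Matrix.sub_apply, Matrix.diagonal_mul, Matrix.mul_diagonal, lowering,
    Matrix.of_apply]
  split_ifs with h
  · simp only [weight, h]
    push_cast
    ring
  · simp

theorem spinMatrix_two_mul_zero : spinMatrix N 2 * spinMatrix N 0 =
    spinMatrix N 0 * spinMatrix N 2 + Complex.I • spinMatrix N 1 := by
  rw [spinMatrix_zero, spinMatrix_one, mul_smul_comm, mul_add, spinMatrix_two_mul_raising,
    spinMatrix_two_mul_lowering, smul_mul_assoc, add_mul, smul_smul]
  have : Complex.I * (1 / (2 * Complex.I)) = 1 / 2 := by field_simp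
  rw [this, ← smul_add]
  congr 1
  abel

theorem spinMatrix_two_mul_one : spinMatrix N 2 * spinMatrix N 1 =
    spinMatrix N 1 * spinMatrix N 2 + (-Complex.I) • spinMatrix N 0 := by
  rw [spinMatrix_zero, spinMatrix_one, mul_smul_comm, mul_sub, spinMatrix_two_mul_raising,
    spinMatrix_two_mul_lowering, smul_mul_assoc, sub_mul, smul_smul]
  have : -Complex.I * (1 / 2) = 1 / (2 * Complex.I) := by
    rw [one_div, one_div, mul_inv, Complex.inv_I]; ring
  rw [this, ← smul_add]
  congr 1
  abel

end SpinMatrices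

section DoubleCommutator

variable {Λ : Type*} [Fintype Λ] [DecidableEq Λ] (N : ℕ)

/-- `∑ v_x S_x^3`. -/
noncomputable def spinWave (v : Λ → ℝ) : Matrix (Λ → Fin (N + 1)) (Λ → Fin (N + 1)) ℂ :=
  ∑ x, v x • siteOp (spinMatrix N 2) x

theorem isHermitian_spinWave (v : Λ → ℝ) : (spinWave N v).IsHermitian := by
  rw [Matrix.IsHermitian, spinWave, Matrix.conjTranspose_sum]
  refine Finset.sum_congr rfl fun x _ => ?_
  rw [Matrix.conjTranspose_smul, star_trivial,
    (isHermitian_siteOp (isHermitian_spinMatrix N 2) x).eq]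

theorem spinWave_mul_siteOp (v : Λ → ℝ) {A A' : Matrix (Fin (N + 1)) (Fin (N + 1)) ℂ} {c : ℂ}
    (h : spinMatrix N 2 * A = A * spinMatrix N 2 + c • A') (x : Λ) :
    spinWave N v * siteOp A x - siteOp A x * spinWave N v = (v x * c) • siteOp A' x := by
  rw [spinWave, Finset.sum_mul, Finset.mul_sum, ← Finset.sum_sub_distrib,
    Finset.sum_eq_single x]
  · rw [smul_mul_assoc, mul_smul_comm, siteOp_mul_siteOp, siteOp_mul_siteOp, h, siteOp_add,
      siteOp_smul, smul_add, add_sub_cancel_left, ← smul_smul, Complex.coe_smul]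
  · intro y _ hy
    rw [smul_mul_assoc, mul_smul_comm, siteOp_commute _ _ hy, sub_self]
  · simp

theorem double_commutator_mul {R : Type*} [Ring R] [Algebra ℂ R] {Y A A' B B' : R}
    {a a' b b' : ℂ} (hA : Y * A - A * Y = a • A') (hA' : Y * A' - A' * Y = a' • A)
    (hB : Y * B - B * Y = b • B') (hB' : Y * B' - B' * Y = b' • B) :
    Y * (A * B * Y - Y * (A * B)) - (A * B * Y - Y * (A * B)) * Y =
      -((a * a' + b * b') • (A * B) + (2 * a * b) • (A' * B')) := by
  have leib : ∀ M M' : R, Y * (M * M') - M * M' * Y =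
      (Y * M - M * Y) * M' + M * (Y * M' - M' * Y) := by
    intro M M'; noncomm_ring
  have h1 : A * B * Y - Y * (A * B) = -(a • (A' * B) + b • (A * B')) := by
    rw [← neg_sub, leib, hA, hB, smul_mul_assoc, mul_smul_comm]
  have h2 : Y * (A' * B) - A' * B * Y = a' • (A * B) + b • (A' * B') := by
    rw [leib, hA', hB, smul_mul_assoc, mul_smul_comm]
  have h3 : Y * (A * B') - A * B' * Y = a • (A' * B') + b' • (A * B) := by
    rw [leib, hA, hB', smul_mul_assoc, mul_smul_comm]
  have h4 : Y * -(a • (A' * B) + b • (A * B')) - -(a • (A' * B) + b • (A * B')) * Y =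
      -(a • (Y * (A' * B) - A' * B * Y) + b • (Y * (A * B') - A * B' * Y)) := by
    rw [mul_neg, neg_mul, mul_add, add_mul, mul_smul_comm, mul_smul_comm, smul_mul_assoc,
      smul_mul_assoc, smul_sub, smul_sub]
    abel
  rw [h1, h4, h2, h3]
  module

/-- The double commutator of an `XYZ` energy with a spin wave. -/
theorem doubleComm_spinWave (K : Fin 3 → Λ → Λ → ℝ)
    {X : Matrix (Λ → Fin (N + 1)) (Λ → Fin (N + 1)) ℂ}
    (hX : X = ∑ i, ∑ x, ∑ y,
      K i x y • (siteOp (spinMatrix N i) x * siteOp (spinMatrix N i) y))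
    (v : Λ → ℝ) :
    doubleComm X (spinWave N v) = ∑ x, ∑ y,
      (((v x ^ 2 + v y ^ 2) * K 0 x y - 2 * (v x * v y) * K 1 x y) *
          (NormedSpace.exp X * (siteOp (spinMatrix N 0) x * siteOp (spinMatrix N 0) y)).trace.re +
        ((v x ^ 2 + v y ^ 2) * K 1 x y - 2 * (v x * v y) * K 0 x y) *
          (NormedSpace.exp X * (siteOp (spinMatrix N 1) x * siteOp (spinMatrix N 1) y)).trace.re)
    := by
  set Y := spinWave N v with hY
  set S : Fin 3 → Λ → Matrix (Λ → Fin (N + 1)) (Λ → Fin (N + 1)) ℂ :=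
    fun i x => siteOp (spinMatrix N i) x with hS
  have c0 : ∀ x, Y * S 0 x - S 0 x * Y = (v x * Complex.I) • S 1 x := fun x =>
    spinWave_mul_siteOp N v (spinMatrix_two_mul_zero N) x
  have c1 : ∀ x, Y * S 1 x - S 1 x * Y = (v x * -Complex.I) • S 0 x := fun x =>
    spinWave_mul_siteOp N v (spinMatrix_two_mul_one N) x
  have c2 : ∀ x, Y * S 2 x - S 2 x * Y = (0 : ℂ) • S 2 x := fun x => by
    have := spinWave_mul_siteOp N v (A := spinMatrix N 2) (A' := spinMatrix N 2) (c := 0)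
      (by simp) x
    rwa [mul_zero] at this
  have d0 : ∀ x y, Y * (S 0 x * S 0 y * Y - Y * (S 0 x * S 0 y)) -
      (S 0 x * S 0 y * Y - Y * (S 0 x * S 0 y)) * Y =
      -((v x ^ 2 + v y ^ 2) • (S 0 x * S 0 y) - (2 * (v x * v y)) • (S 1 x * S 1 y)) := by
    intro x y
    rw [double_commutator_mul (c0 x) (c1 x) (c0 y) (c1 y), ← Complex.coe_smul,
      ← Complex.coe_smul, sub_eq_add_neg, ← neg_smul]
    congr 3
    · push_cast; linear_combination (-(v x : ℂ) ^ 2 - (v y : ℂ) ^ 2) * Complex.I_sq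
    · push_cast; linear_combination (2 * (v x : ℂ) * (v y : ℂ)) * Complex.I_sq
  have d1 : ∀ x y, Y * (S 1 x * S 1 y * Y - Y * (S 1 x * S 1 y)) -
      (S 1 x * S 1 y * Y - Y * (S 1 x * S 1 y)) * Y =
      -((v x ^ 2 + v y ^ 2) • (S 1 x * S 1 y) - (2 * (v x * v y)) • (S 0 x * S 0 y)) := by
    intro x y
    rw [double_commutator_mul (c1 x) (c0 x) (c1 y) (c0 y), ← Complex.coe_smul,
      ← Complex.coe_smul, sub_eq_add_neg, ← neg_smul]
    congr 3
    · push_cast; linear_combination (-(v x : ℂ) ^ 2 - (v y : ℂ) ^ 2) * Complex.I_sq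
    · push_cast; linear_combination (2 * (v x : ℂ) * (v y : ℂ)) * Complex.I_sq
  have d2 : ∀ x y, Y * (S 2 x * S 2 y * Y - Y * (S 2 x * S 2 y)) -
      (S 2 x * S 2 y * Y - Y * (S 2 x * S 2 y)) * Y = 0 := by
    intro x y
    rw [double_commutator_mul (c2 x) (c2 x) (c2 y) (c2 y)]
    simp
  have lin : Y * (X * Y - Y * X) - (X * Y - Y * X) * Y = ∑ i, ∑ x, ∑ y, K i x y •
      (Y * (S i x * S i y * Y - Y * (S i x * S i y)) -
        (S i x * S i y * Y - Y * (S i x * S i y)) * Y) := by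
    rw [hX]
    simp only [Finset.mul_sum, Finset.sum_mul, ← Finset.sum_sub_distrib, mul_smul_comm,
      smul_mul_assoc, ← smul_sub]
    rfl
  rw [doubleComm, lin, Fin.sum_univ_three]
  simp only [d0, d1, d2, smul_zero, Finset.sum_const_zero, add_zero]
  rw [← Finset.sum_add_distrib, Finset.mul_sum, Matrix.trace_sum, Complex.re_sum,
    ← Finset.sum_neg_distrib]
  refine Finset.sum_congr rfl fun x _ => ?_
  rw [← Finset.sum_add_distrib, Finset.mul_sum, Matrix.trace_sum, Complex.re_sum,
    ← Finset.sum_neg_distrib]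
  refine Finset.sum_congr rfl fun y _ => ?_
  simp only [mul_add, mul_sub, smul_neg, mul_neg, smul_sub, Matrix.mul_smul, Matrix.trace_add,
    Matrix.trace_sub, Matrix.trace_neg, Matrix.trace_smul, Complex.add_re, Complex.sub_re,
    Complex.neg_re, Complex.smul_re, smul_eq_mul]
  ring

theorem trace_exp_mul_spinWave_sq (X : Matrix (Λ → Fin (N + 1)) (Λ → Fin (N + 1)) ℂ)
    (v : Λ → ℝ) :
    (NormedSpace.exp X * (spinWave N v * spinWave N v)).trace.re = ∑ x, ∑ y, v x * v y *
      (NormedSpace.exp X * (siteOp (spinMatrix N 2) x * siteOp (spinMatrix N 2) y)).trace.re := by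
  rw [spinWave, Finset.sum_mul, Finset.mul_sum, Matrix.trace_sum, Complex.re_sum]
  refine Finset.sum_congr rfl fun x _ => ?_
  rw [Finset.mul_sum, Finset.mul_sum, Matrix.trace_sum, Complex.re_sum]
  refine Finset.sum_congr rfl fun y _ => ?_
  rw [smul_mul_smul_comm, Matrix.mul_smul, Matrix.trace_smul, Complex.smul_re, smul_eq_mul]

end DoubleCommutator

section Field

variable {Λ : Type*} [Fintype Λ] [DecidableEq Λ] (N : ℕ)

/-- The spin matrices with the third one shifted by a field. -/
noncomputable def shiftedSpin (i : Fin 3) (r : ℝ) : Matrix (Fin (N + 1)) (Fin (N + 1)) ℂ :=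
  spinMatrix N i + (if i = 2 then r else 0) • 1

/-- The one-site term that makes the energy invariant under constant fields. -/
noncomputable def fieldCorrection (κ r : ℝ) : Matrix (Fin (N + 1)) (Fin (N + 1)) ℂ :=
  -(κ * (2 * r)) • spinMatrix N 2 - (κ * r ^ 2) • 1

theorem isHermitian_real_smul {m : Type*} {A : Matrix m m ℂ} (hA : A.IsHermitian) (r : ℝ) :
    (r • A).IsHermitian := by
  rw [Matrix.IsHermitian, Matrix.conjTranspose_smul, star_trivial, hA]

theorem isHermitian_shiftedSpin (i : Fin 3) (r : ℝ) : (shiftedSpin N i r).IsHermitian :=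
  (isHermitian_spinMatrix N i).add (isHermitian_real_smul Matrix.isHermitian_one _)

theorem isHermitian_fieldCorrection (κ r : ℝ) : (fieldCorrection N κ r).IsHermitian :=
  (isHermitian_real_smul (isHermitian_spinMatrix N 2) _).sub
    (isHermitian_real_smul Matrix.isHermitian_one _)

theorem conjMap_shiftedSpin (i : Fin 3) (r : ℝ) :
    conjMap (shiftedSpin N i r) = spinSign i • shiftedSpin N i r := by
  rw [shiftedSpin, map_add, conjMap_spinMatrix, conjMap_smul, map_one, smul_add]
  congr 1
  by_cases h : i = 2
  · subst h; simp [spinSign]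
  · simp [h]

theorem conjMap_fieldCorrection (κ r : ℝ) :
    conjMap (fieldCorrection N κ r) = fieldCorrection N κ r := by
  rw [fieldCorrection, map_sub, conjMap_smul, conjMap_smul, conjMap_spinMatrix, map_one]
  simp [spinSign]

theorem fieldEnergy_zero (K : Fin 3 → Λ → Λ → ℝ) (κ : ℝ) :
    fieldEnergy K (shiftedSpin N) (fieldCorrection N κ) 0 = ∑ i, ∑ x, ∑ y,
      K i x y • (siteOp (spinMatrix N i) x * siteOp (spinMatrix N i) y) := by
  have h0 : ∀ x : Λ, siteOp (0 : Matrix (Fin (N + 1)) (Fin (N + 1)) ℂ) x = 0 := by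
    intro x
    have := siteOp_smul (0 : ℂ) (0 : Matrix (Fin (N + 1)) (Fin (N + 1)) ℂ) x
    simpa using this
  simp [fieldEnergy, shiftedSpin, fieldCorrection, h0]

theorem fieldEnergy_eq (K : Fin 3 → Λ → Λ → ℝ) (hsymm : ∀ x y, K 2 x y = K 2 y x) {κ : ℝ}
    (hκ : ∀ x, ∑ y, K 2 x y = κ) (v : Λ → ℝ) :
    fieldEnergy K (shiftedSpin N) (fieldCorrection N κ) v =
      (∑ i, ∑ x, ∑ y, K i x y • (siteOp (spinMatrix N i) x * siteOp (spinMatrix N i) y)) -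
        (2 : ℝ) • spinWave N (fun x => ∑ y, K 2 x y * (v x - v y)) -
        (∑ x, v x * ∑ y, K 2 x y * (v x - v y)) • 1 := by
  have hT : ∀ i (r : ℝ) (x : Λ), siteOp (shiftedSpin N i r) x =
      siteOp (spinMatrix N i) x + (if i = 2 then r else 0) • 1 := by
    intro i r x
    rw [shiftedSpin, siteOp_add, siteOp_smul, siteOp_one]
  have hW : ∀ (r : ℝ) (x : Λ), siteOp (fieldCorrection N κ r) x =
      (-(κ * (2 * r))) • siteOp (spinMatrix N 2) x + (-(κ * r ^ 2)) • 1 := by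
    intro r x
    rw [fieldCorrection, sub_eq_add_neg, ← neg_smul, siteOp_add, siteOp_smul, siteOp_smul,
      siteOp_one]
  rw [fieldEnergy, Fin.sum_univ_three, Fin.sum_univ_three]
  simp only [hT, hW]
  simp only [show (0 : Fin 3) ≠ 2 by decide, show (1 : Fin 3) ≠ 2 by decide, if_true, if_false,
    zero_smul, add_zero]
  set S := fun x : Λ => siteOp (spinMatrix N 2) x with hS
  have e1 : ∑ x, ∑ y, K 2 x y • ((S x + v x • 1) * (S y + v y • 1)) =
      ∑ x, ∑ y, K 2 x y • (S x * S y) + (2 : ℝ) • ∑ x, (∑ y, K 2 x y * v y) • S x +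
        (∑ x, ∑ y, K 2 x y * (v x * v y)) • (1 : Matrix (Λ → Fin (N + 1)) (Λ → Fin (N + 1)) ℂ) := by
    have e2 : ∀ x y, K 2 x y • ((S x + v x • 1) * (S y + v y • 1)) =
        K 2 x y • (S x * S y) + (K 2 x y * v y) • S x + (K 2 x y * v x) • S y +
          (K 2 x y * (v x * v y)) • 1 := by
      intro x y
      simp only [add_mul, mul_add, smul_mul_assoc, mul_smul_comm, one_mul, mul_one]
      module
    simp only [e2, Finset.sum_add_distrib, Finset.sum_smul]
    have e3 : ∑ x, ∑ y, (K 2 x y * v x) • S y = ∑ x, ∑ y, (K 2 x y * v y) • S x := by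
      rw [Finset.sum_comm]
      refine Finset.sum_congr rfl fun x _ => Finset.sum_congr rfl fun y _ => ?_
      rw [hsymm]
    rw [e3, two_smul]
    abel
  have e4 : ∀ x, ∑ y, K 2 x y * (v x - v y) = κ * v x - ∑ y, K 2 x y * v y := by
    intro x
    simp only [mul_sub, Finset.sum_sub_distrib]
    rw [← Finset.sum_mul, hκ]
  have e5 : ∑ x, v x * (κ * v x - ∑ y, K 2 x y * v y) =
      ∑ x, κ * v x ^ 2 - ∑ x, ∑ y, K 2 x y * (v x * v y) := by
    rw [← Finset.sum_sub_distrib]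
    refine Finset.sum_congr rfl fun x _ => ?_
    rw [mul_sub, Finset.mul_sum]
    congr 1
    · ring
    · exact Finset.sum_congr rfl fun y _ => by ring
  have e6 : spinWave N (fun x => κ * v x - ∑ y, K 2 x y * v y) =
      ∑ x, (κ * v x) • S x - ∑ x, (∑ y, K 2 x y * v y) • S x := by
    rw [spinWave, ← Finset.sum_sub_distrib]
    exact Finset.sum_congr rfl fun x _ => sub_smul _ _ _
  change _ + ∑ x, ∑ y, K 2 x y • ((S x + v x • 1) * (S y + v y • 1)) + _ = _
  rw [e1]
  simp only [e4]
  rw [e5, e6, Finset.sum_add_distrib]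
  have e7 : ∑ x, (-(κ * (2 * v x))) • S x = -((2 : ℝ) • ∑ x, (κ * v x) • S x) := by
    rw [Finset.smul_sum, ← Finset.sum_neg_distrib]
    refine Finset.sum_congr rfl fun x _ => ?_
    rw [smul_smul, ← neg_smul]
    congr 1; ring
  have e8 : ∑ x : Λ, (-(κ * v x ^ 2)) • (1 : Matrix (Λ → Fin (N + 1)) (Λ → Fin (N + 1)) ℂ) =
      -((∑ x, κ * v x ^ 2) • 1) := by
    rw [← Finset.sum_smul, Finset.sum_neg_distrib, neg_smul]
  rw [e7, e8]
  change _ + (∑ x, ∑ y, K 2 x y • (S x * S y) + _ + _) + _ = _ + ∑ x, ∑ y, K 2 x y • (S x * S y) - _ - _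
  rw [smul_sub, sub_smul]
  abel

end Field

end

section

set_option linter.unusedSectionVars false
open scoped Matrix.Norms.Operator ComplexOrder
open Filter Topology QSpin

section TorusFourier

variable {d ℓ : ℕ} [NeZero ℓ]

theorem dot_sub (k : Fin d → ℝ) (u v : Fin d → ℤ) : dot k (u - v) = dot k u - dot k v := by
  simp only [dot, ← Finset.sum_sub_distrib]
  refine Finset.sum_congr rfl fun i _ => ?_
  rw [Pi.sub_apply]; push_cast; ring

theorem exists_dot_eq_add {k : Fin d → ℝ} (hk : k ∈ dualBox d ℓ) {u v : Fin d → ℤ}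
    (h : ∀ i, (u i : ZMod ℓ) = v i) : ∃ n : ℤ, dot k u = dot k v + n * (2 * Real.pi) := by
  obtain ⟨m, hm⟩ := hk
  have h' : ∀ i, ∃ c, v i - u i = ℓ * c := fun i =>
    (ZMod.intCast_eq_intCast_iff_dvd_sub _ _ _).mp (h i)
  choose c hc using h'
  refine ⟨-∑ i, m i * c i, ?_⟩
  have hℓ : (ℓ : ℝ) ≠ 0 := by exact_mod_cast NeZero.ne ℓ
  rw [← sub_eq_iff_eq_add', ← dot_sub, dot]
  push_cast
  rw [neg_mul, Finset.sum_mul, ← Finset.sum_neg_distrib]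
  refine Finset.sum_congr rfl fun i _ => ?_
  have h1 : ((u - v) i : ℤ) = -(ℓ * c i) := by rw [← hc i, Pi.sub_apply]; ring
  rw [h1, (hm i).2.2]
  push_cast
  field_simp

theorem residue_pos_sub (x y : Box d ℓ) (i : Fin d) :
    ((pos (x - y) i : ℤ) : ZMod ℓ) = ((pos x - pos y) i : ℤ) := by
  rw [cast_pos, Pi.sub_apply, Pi.sub_apply, residue_sub, Int.cast_sub, cast_pos, cast_pos]

theorem cos_pos_sub {k : Fin d → ℝ} (hk : k ∈ dualBox d ℓ) (x y : Box d ℓ) :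
    Real.cos (dot k (pos (x - y))) = Real.cos (dot k (pos x)) * Real.cos (dot k (pos y)) +
      Real.sin (dot k (pos x)) * Real.sin (dot k (pos y)) := by
  obtain ⟨n, hn⟩ := exists_dot_eq_add hk (residue_pos_sub x y)
  rw [hn, Real.cos_add_int_mul_two_pi, dot_sub, Real.cos_sub]

theorem sin_pos_sub {k : Fin d → ℝ} (hk : k ∈ dualBox d ℓ) (x y : Box d ℓ) :
    Real.sin (dot k (pos (x - y))) = Real.sin (dot k (pos x)) * Real.cos (dot k (pos y)) -
      Real.cos (dot k (pos x)) * Real.sin (dot k (pos y)) := by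
  obtain ⟨n, hn⟩ := exists_dot_eq_add hk (residue_pos_sub x y)
  rw [hn, Real.sin_add_int_mul_two_pi, dot_sub, Real.sin_sub]

theorem dot_pos_zero (k : Fin d → ℝ) : dot k (pos (0 : Box d ℓ)) = 0 := by
  simp [dot, pos]

theorem cos_pos_neg {k : Fin d → ℝ} (hk : k ∈ dualBox d ℓ) (x : Box d ℓ) :
    Real.cos (dot k (pos (-x))) = Real.cos (dot k (pos x)) := by
  rw [← zero_sub, cos_pos_sub hk, dot_pos_zero]; simp

theorem sin_pos_neg {k : Fin d → ℝ} (hk : k ∈ dualBox d ℓ) (x : Box d ℓ) :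
    Real.sin (dot k (pos (-x))) = -Real.sin (dot k (pos x)) := by
  rw [← zero_sub, sin_pos_sub hk, dot_pos_zero]; simp

theorem sum_eq_zero_of_odd {G : Type*} [Fintype G] [AddCommGroup G] (f : G → ℝ)
    (hf : ∀ z, f (-z) = -f z) : ∑ z, f z = 0 := by
  have h := Equiv.sum_comp (Equiv.neg G) f
  simp only [Equiv.neg_apply, hf, Finset.sum_neg_distrib] at h
  linarith

theorem sum_sum_eq_card_mul {G : Type*} [Fintype G] [AddCommGroup G] (f : G → G → ℝ) (g : G → ℝ)
    (h : ∀ x z, f x (x + z) = g z) : ∑ x, ∑ y, f x y = Fintype.card G * ∑ z, g z := by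
  have h1 : ∀ x, ∑ y, f x y = ∑ z, g z := by
    intro x
    rw [← Equiv.sum_comp (Equiv.addLeft x)]
    exact Finset.sum_congr rfl fun z _ => h x z
  simp only [h1, Finset.sum_const, Finset.card_univ, nsmul_eq_mul]

theorem periodise_pos_sub (J : (Fin d → ℤ) → ℝ) (x y : Box d ℓ) :
    periodise ℓ J (pos x - pos y) = periodise ℓ J (pos (x - y)) :=
  periodise_congr J fun i => (residue_pos_sub x y i).symm

theorem periodise_pos_neg {J : (Fin d → ℤ) → ℝ} (hJ : ∀ x, J (-x) = J x) (z : Box d ℓ) :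
    periodise ℓ J (pos (-z)) = periodise ℓ J (pos z) := by
  rw [← zero_sub, ← periodise_pos_sub, ← periodise_neg hJ, neg_sub, periodise_pos_sub, sub_zero]

/-- Plane waves are eigenvectors of the lattice Laplacian of an even coupling. -/
theorem laplacian_cos {J : (Fin d → ℤ) → ℝ} (hJ : ∀ x, J (-x) = J x) {k : Fin d → ℝ}
    (hk : k ∈ dualBox d ℓ) (x : Box d ℓ) :
    ∑ y : Box d ℓ, periodise ℓ J (pos x - pos y) * (Real.cos (dot k (pos x)) - Real.cos (dot k (pos y))) =
      (∑ z : Box d ℓ, periodise ℓ J (pos z) * (1 - Real.cos (dot k (pos z)))) *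
        Real.cos (dot k (pos x)) := by
  have h0 : ∑ z : Box d ℓ, periodise ℓ J (pos z) * Real.sin (dot k (pos z)) = 0 :=
    sum_eq_zero_of_odd _ fun z => by rw [periodise_pos_neg hJ, sin_pos_neg hk, mul_neg]
  rw [← Equiv.sum_comp (Equiv.subLeft x), ← sub_zero (_ * Real.cos _),
    ← zero_mul (Real.sin (dot k (pos x))), ← h0, Finset.sum_mul, Finset.sum_mul,
    ← Finset.sum_sub_distrib]
  refine Finset.sum_congr rfl fun z _ => ?_
  rw [Equiv.subLeft_apply, periodise_pos_sub, sub_sub_cancel, cos_pos_sub hk]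
  ring

theorem laplacian_sin {J : (Fin d → ℤ) → ℝ} (hJ : ∀ x, J (-x) = J x) {k : Fin d → ℝ}
    (hk : k ∈ dualBox d ℓ) (x : Box d ℓ) :
    ∑ y : Box d ℓ, periodise ℓ J (pos x - pos y) * (Real.sin (dot k (pos x)) - Real.sin (dot k (pos y))) =
      (∑ z : Box d ℓ, periodise ℓ J (pos z) * (1 - Real.cos (dot k (pos z)))) *
        Real.sin (dot k (pos x)) := by
  have h0 : ∑ z : Box d ℓ, periodise ℓ J (pos z) * Real.sin (dot k (pos z)) = 0 :=
    sum_eq_zero_of_odd _ fun z => by rw [periodise_pos_neg hJ, sin_pos_neg hk, mul_neg]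
  rw [← Equiv.sum_comp (Equiv.subLeft x), ← add_zero (_ * Real.sin _),
    ← zero_mul (Real.cos (dot k (pos x))), ← h0, Finset.sum_mul, Finset.sum_mul,
    ← Finset.sum_add_distrib]
  refine Finset.sum_congr rfl fun z _ => ?_
  rw [Equiv.subLeft_apply, periodise_pos_sub, sub_sub_cancel, sin_pos_sub hk]
  ring

theorem eps_pos {J : Fin 3 → (Fin d → ℤ) → ℝ} (hJ : GoodCoupling (J 2))
    (hJ3 : ∃ x : Fin d → ℤ, x ≠ 0 ∧ J 2 x ≠ 0) (hℓ : 2 ≤ ℓ) {k : Fin d → ℝ}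
    (hk : k ∈ dualBox d ℓ) (hk0 : k ≠ 0) : 0 < eps ℓ J k := by
  obtain ⟨m, hm⟩ := hk
  have hfar : ∀ j, 0 < J 2 (Pi.single j 1) := by
    refine hJ.far.resolve_left fun h => ?_
    obtain ⟨x, hx, hx'⟩ := hJ3
    exact hx' (h x hx)
  obtain ⟨j, hj⟩ := Function.ne_iff.mp hk0
  have hnn : ∀ u, 0 ≤ periodise ℓ (J 2) u := fun u => tsum_nonneg fun z => hJ.nonneg _
  refine Finset.sum_pos' (fun x _ => mul_nonneg (hnn _) (sub_nonneg.mpr (Real.cos_le_one _)))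
    ⟨Pi.single j 1, Finset.mem_univ _, ?_⟩
  have hpos : pos (Pi.single j 1 : Box d ℓ) = Pi.single j 1 := by
    funext i
    by_cases h : i = j
    · subst h
      simp [pos, Nat.mod_eq_of_lt (show 1 < ℓ by omega)]
    · simp [pos, h]
  rw [hpos]
  refine mul_pos ?_ ?_
  · refine lt_of_lt_of_le (hfar j) ?_
    have h1 := (summable_periodise hJ.summable (show 0 < ℓ by omega) (Pi.single j 1)).le_tsum 0
      fun z _ => hJ.nonneg _
    simpa [periodise] using h1
  · have hdot : dot k (Pi.single j 1) = k j := by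
      rw [dot, Finset.sum_eq_single j] <;> simp +contextual
    rw [hdot, sub_pos]
    refine lt_of_le_of_ne (Real.cos_le_one _) fun h => hj ?_
    obtain ⟨n, hn⟩ := (Real.cos_eq_one_iff _).mp h
    have hℓ' : (0 : ℝ) < ℓ := by exact_mod_cast (show 0 < ℓ by omega)
    rw [(hm j).2.2] at hn
    have hmn : m j = n * ℓ := by
      have : (m j : ℝ) = n * ℓ := by
        field_simp at hn
        exact hn.symm
      exact_mod_cast this
    have h1 := (hm j).1
    have h2 := (hm j).2.1
    rw [hmn] at h1 h2
    push_cast at h1 h2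
    have h3 : (n : ℝ) < 1 := by nlinarith
    have h4 : (-1 : ℝ) < n := by nlinarith
    have h5 : n = 0 := by
      have : n < 1 := by exact_mod_cast h3
      have : -1 < n := by exact_mod_cast h4
      omega
    rw [(hm j).2.2, hmn, h5]
    simp

end TorusFourier

section Correlations

variable {Λ : Type*} [Fintype Λ] [DecidableEq Λ] {N : ℕ}

/-- The unnormalised correlation functions of the state with density `exp X`. -/
noncomputable def twoPoint (X : Matrix (Λ → Fin (N + 1)) (Λ → Fin (N + 1)) ℂ) (i : Fin 3)
    (x y : Λ) : ℝ :=
  (NormedSpace.exp X * (siteOp (spinMatrix N i) x * siteOp (spinMatrix N i) y)).trace.re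

theorem twoPoint_comm (X : Matrix (Λ → Fin (N + 1)) (Λ → Fin (N + 1)) ℂ) (i : Fin 3) (x y : Λ) :
    twoPoint X i x y = twoPoint X i y x := by
  by_cases h : x = y
  · rw [h]
  · rw [twoPoint, twoPoint, siteOp_commute _ _ h]

theorem twoPoint_relabel {X : Matrix (Λ → Fin (N + 1)) (Λ → Fin (N + 1)) ℂ} (e : Λ ≃ Λ)
    (hX : X.submatrix (relabel e) (relabel e) = X) (i : Fin 3) (x y : Λ) :
    twoPoint X i (e x) (e y) = twoPoint X i x y := by
  rw [twoPoint, ← siteOp_submatrix_relabel, ← siteOp_submatrix_relabel, Matrix.submatrix_mul_equiv]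
  nth_rewrite 1 [← hX]
  rw [exp_submatrix_equiv, Matrix.submatrix_mul_equiv, trace_submatrix_equiv, twoPoint]

theorem submatrix_sum_relabel {α : Type*} (e : Λ ≃ Λ) (s : Finset α)
    (M : α → Matrix (Λ → Fin (N + 1)) (Λ → Fin (N + 1)) ℂ) :
    (∑ a ∈ s, M a).submatrix (relabel e) (relabel e) =
      ∑ a ∈ s, (M a).submatrix (relabel e) (relabel e) := by
  ext σ τ
  simp [Matrix.sum_apply]

theorem submatrix_relabel_energy {K : Fin 3 → Λ → Λ → ℝ} (e : Λ ≃ Λ)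
    (hK : ∀ i x y, K i (e x) (e y) = K i x y) :
    (∑ i, ∑ x, ∑ y, K i x y • (siteOp (spinMatrix N i) x * siteOp (spinMatrix N i) y)).submatrix
      (relabel e) (relabel e) =
    ∑ i, ∑ x, ∑ y, K i x y • (siteOp (spinMatrix N i) x * siteOp (spinMatrix N i) y) := by
  rw [submatrix_sum_relabel]
  refine Finset.sum_congr rfl fun i _ => ?_
  rw [submatrix_sum_relabel, ← e.sum_comp (fun x => ∑ y, K i x y •
    (siteOp (spinMatrix N i) x * siteOp (spinMatrix N i) y))]
  refine Finset.sum_congr rfl fun x _ => ?_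
  rw [submatrix_sum_relabel, ← e.sum_comp (fun y => K i (e x) y •
    (siteOp (spinMatrix N i) (e x) * siteOp (spinMatrix N i) y))]
  refine Finset.sum_congr rfl fun y _ => ?_
  rw [hK, Matrix.submatrix_smul, Pi.smul_apply, Pi.smul_apply, ← siteOp_submatrix_relabel,
    ← siteOp_submatrix_relabel, Matrix.submatrix_mul_equiv]

theorem trace_mul_eq_ofReal {n : Type*} [Fintype n] {A B : Matrix n n ℂ} (hA : A.IsHermitian)
    (hB : B.IsHermitian) : (A * B).trace = ((A * B).trace.re : ℂ) := by
  refine (Complex.conj_eq_iff_re.mp ?_).symm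
  rw [← Complex.star_def, ← Matrix.trace_conjTranspose, Matrix.conjTranspose_mul, hA, hB,
    Matrix.trace_mul_comm]

theorem isHermitian_siteOp_mul (i : Fin 3) (x y : Λ) :
    (siteOp (spinMatrix N i) x * siteOp (spinMatrix N i) y).IsHermitian := by
  have h := fun x : Λ => isHermitian_siteOp (isHermitian_spinMatrix N i) x
  rw [Matrix.IsHermitian, Matrix.conjTranspose_mul, h, h]
  by_cases hxy : x = y
  · rw [hxy]
  · exact (siteOp_commute _ _ hxy).symm

end Correlations

end

section

set_option linter.unusedSectionVars false
open scoped Matrix.Norms.Operator ComplexOrder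
open Filter Topology QSpin

section TorusState

variable {d ℓ : ℕ} [NeZero ℓ] (N : ℕ) (J : Fin 3 → (Fin d → ℤ) → ℝ) (β : ℝ)

/-- The couplings of `-β H`. -/
noncomputable def torusKernel (ℓ : ℕ) (J : Fin 3 → (Fin d → ℤ) → ℝ) (β : ℝ) (i : Fin 3)
    (x y : Box d ℓ) : ℝ :=
  β * periodise ℓ (J i) (pos x - pos y)

theorem neg_smul_hamiltonian : -(β : ℂ) • hamiltonian ℓ N J = ∑ i, ∑ x : Box d ℓ, ∑ y,
    torusKernel ℓ J β i x y • (siteOp (spinMatrix N i) x * siteOp (spinMatrix N i) y) := by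
  rw [hamiltonian, smul_neg, neg_smul, neg_neg]
  simp only [Finset.smul_sum]
  refine Finset.sum_congr rfl fun i _ => Finset.sum_congr rfl fun x _ =>
    Finset.sum_congr rfl fun y _ => ?_
  rw [smul_smul, torusKernel, ← Complex.coe_smul, Complex.ofReal_mul]
  rfl

theorem isHermitian_neg_smul_hamiltonian (hJ : ∀ i x, J i (-x) = J i x) :
    (-(β : ℂ) • hamiltonian (d := d) ℓ N J).IsHermitian := by
  rw [neg_smul_hamiltonian, ← fieldEnergy_zero N _ 0]
  refine isHermitian_fieldEnergy (fun i x y => ?_) (isHermitian_shiftedSpin N)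
    (isHermitian_fieldCorrection N 0) 0
  rw [torusKernel, torusKernel, ← periodise_neg (hJ i), neg_sub]

theorem twoPoint_add_right (i : Fin 3) (x y z : Box d ℓ) :
    twoPoint (-(β : ℂ) • hamiltonian ℓ N J) i (x + z) (y + z) =
      twoPoint (-(β : ℂ) • hamiltonian ℓ N J) i x y := by
  refine twoPoint_relabel (Equiv.addRight z) ?_ i x y
  rw [neg_smul_hamiltonian]
  refine submatrix_relabel_energy _ fun i x y => ?_
  rw [torusKernel, torusKernel, Equiv.coe_addRight, periodise_pos_sub, periodise_pos_sub,
    add_sub_add_right_eq_sub]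

theorem twoPoint_add (i : Fin 3) (x z : Box d ℓ) :
    twoPoint (-(β : ℂ) • hamiltonian ℓ N J) i x (x + z) =
      twoPoint (-(β : ℂ) • hamiltonian ℓ N J) i 0 z := by
  rw [← twoPoint_add_right N J β i 0 z x, zero_add, add_comm]

theorem twoPoint_neg (i : Fin 3) (z : Box d ℓ) :
    twoPoint (-(β : ℂ) • hamiltonian ℓ N J) i 0 (-z) =
      twoPoint (-(β : ℂ) • hamiltonian ℓ N J) i 0 z := by
  rw [← twoPoint_add_right N J β i 0 (-z) z, zero_add, neg_add_cancel, twoPoint_comm]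

theorem corr_eq (hJ : ∀ i x, J i (-x) = J i x) (i : Fin 3) (x : Box d ℓ) :
    corr ℓ N J β i x = ((twoPoint (-(β : ℂ) • hamiltonian ℓ N J) i 0 x /
      (NormedSpace.exp (-(β : ℂ) • hamiltonian (d := d) ℓ N J)).trace.re : ℝ) : ℂ) := by
  have hX := (isHermitian_neg_smul_hamiltonian (ℓ := ℓ) N J β hJ).exp
  have h1 := trace_mul_eq_ofReal hX (isHermitian_siteOp_mul (N := N) i 0 x)
  have h2 := trace_mul_eq_ofReal hX Matrix.isHermitian_one
  rw [mul_one] at h2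
  rw [corr, gibbs, Matrix.trace_mul_comm, Complex.ofReal_div, ← h2]
  congr 1

theorem exp_sub_smul_one {n : Type*} [Fintype n] [DecidableEq n] (A : Matrix n n ℂ) (r : ℝ) :
    (NormedSpace.exp (A - r • 1)).trace.re = Real.exp (-r) * (NormedSpace.exp A).trace.re := by
  have h1 : NormedSpace.exp ((-r) • (1 : Matrix n n ℂ)) = Real.exp (-r) • 1 := by
    have := NormedSpace.algebraMap_exp_comm (𝕂 := ℝ) (𝔸 := Matrix n n ℂ) (-r)
    rw [Algebra.algebraMap_eq_smul_one, Algebra.algebraMap_eq_smul_one] at this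
    exact this.symm.trans (by rw [Real.exp_eq_exp_ℝ])
  rw [sub_eq_add_neg, ← neg_smul, Matrix.exp_add_of_commute, h1, mul_smul_comm, mul_one,
    Matrix.trace_smul, Complex.smul_re, smul_eq_mul]
  exact ((Commute.one_right A).smul_right _)

/-- Gaussian domination for a field that is an eigenvector of the Laplacian. -/
theorem trace_exp_add_spinWave_le {h : ℕ} (hℓ : ℓ = h + h) (hβ : 0 < β)
    (hG : ∀ i, GoodCoupling (spinSign i • J i)) {eig : ℝ} (heig : 0 < eig) {v : Box d ℓ → ℝ}
    (hv : ∀ x, ∑ y, periodise ℓ (J 2) (pos x - pos y) * (v x - v y) = eig * v x) (t : ℝ) :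
    (NormedSpace.exp (-(β : ℂ) • hamiltonian ℓ N J + t • spinWave N v)).trace.re ≤
      (NormedSpace.exp (-(β : ℂ) • hamiltonian (d := d) ℓ N J)).trace.re *
        Real.exp ((∑ x, v x ^ 2) / (4 * (β * eig)) * t ^ 2) := by
  set K := torusKernel (d := d) ℓ J β with hK
  have hG2 : spinSign 2 • J 2 = J 2 := by simp [spinSign]
  have heven : ∀ x, J 2 (-x) = J 2 x := by
    have := (hG 2).even
    rwa [hG2] at this
  have hsymm : ∀ x y, K 2 x y = K 2 y x := by
    intro x y
    rw [hK, torusKernel, torusKernel, ← periodise_neg heven, neg_sub]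
  set κ := ∑ z : Box d ℓ, K 2 0 z with hκ
  have hκ' : ∀ x, ∑ y, K 2 x y = κ := by
    intro x
    rw [hκ, ← Equiv.sum_comp (Equiv.addLeft x)]
    refine Finset.sum_congr rfl fun z _ => ?_
    rw [hK, torusKernel, torusKernel, periodise_pos_sub, periodise_pos_sub, Equiv.coe_addLeft,
      sub_add_cancel_left, zero_sub]
  have henergy := fieldEnergy_eq N K hsymm hκ'
  have hzero : fieldEnergy K (shiftedSpin N) (fieldCorrection N κ) 0 =
      -(β : ℂ) • hamiltonian ℓ N J := by
    rw [fieldEnergy_zero, neg_smul_hamiltonian]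
  have hbeig : 0 < β * eig := mul_pos hβ heig
  have key := trace_exp_fieldEnergy_le hℓ hβ.le hG spinSign spinSign_mul_self (K := K)
    (fun i x y => ?_) (shiftedSpin N) (fieldCorrection N κ) (isHermitian_shiftedSpin N)
    (isHermitian_fieldCorrection N κ) (conjMap_shiftedSpin N) (conjMap_fieldCorrection N κ)
    (fun c => ?_) (fun x => -t / (2 * (β * eig)) * v x)
  · rw [hzero, henergy] at key
    rw [← neg_smul_hamiltonian] at key
    have hL : ∀ x, ∑ y, K 2 x y * (-t / (2 * (β * eig)) * v x - -t / (2 * (β * eig)) * v y) =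
        -(t / 2) * v x := by
      intro x
      have h1 : ∑ y, K 2 x y * (-t / (2 * (β * eig)) * v x - -t / (2 * (β * eig)) * v y) =
          -t / (2 * (β * eig)) * β *
            ∑ y, periodise ℓ (J 2) (pos x - pos y) * (v x - v y) := by
        rw [Finset.mul_sum]
        refine Finset.sum_congr rfl fun y _ => ?_
        rw [hK, torusKernel]
        ring
      rw [h1, hv]
      field_simp
    simp only [hL] at key
    have hY : (2 : ℝ) • spinWave N (fun x => -(t / 2) * v x) = -(t • spinWave N v) := by
      rw [spinWave, spinWave, Finset.smul_sum, Finset.smul_sum, ← Finset.sum_neg_distrib]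
      refine Finset.sum_congr rfl fun x _ => ?_
      rw [smul_smul, smul_smul, ← neg_smul]
      congr 1; ring
    have hr : ∑ x, -t / (2 * (β * eig)) * v x * (-(t / 2) * v x) =
        (∑ x, v x ^ 2) / (4 * (β * eig)) * t ^ 2 := by
      rw [Finset.sum_div, Finset.sum_mul]
      refine Finset.sum_congr rfl fun x _ => ?_
      field_simp
      ring
    rw [hY, hr, sub_neg_eq_add, exp_sub_smul_one, Real.exp_neg, inv_mul_le_iff₀ (Real.exp_pos _)]
      at key
    rw [mul_comm]
    exact key
  · have h1 : periodise ℓ (spinSign i • J i) (pos x - pos y) =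
        spinSign i * periodise ℓ (J i) (pos x - pos y) := by
      simp only [periodise, Pi.smul_apply, smul_eq_mul, tsum_mul_left]
    rw [h1, hK, torusKernel]
    linear_combination (-β * periodise ℓ (J i) (pos x - pos y)) * spinSign_mul_self i
  · rw [fieldEnergy_zero, henergy]
    simp [spinWave]

end TorusState

section InfraredBound

variable {d ℓ : ℕ} [NeZero ℓ] (N : ℕ) {J : Fin 3 → (Fin d → ℤ) → ℝ} {β : ℝ} {k : Fin d → ℝ}

theorem sum_trace_exp_mul_spinWave_sq (hk : k ∈ dualBox d ℓ) :
    (NormedSpace.exp (-(β : ℂ) • hamiltonian ℓ N J) *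
        (spinWave N (fun x : Box d ℓ => Real.cos (dot k (pos x))) *
          spinWave N fun x : Box d ℓ => Real.cos (dot k (pos x)))).trace.re +
      (NormedSpace.exp (-(β : ℂ) • hamiltonian ℓ N J) *
        (spinWave N (fun x : Box d ℓ => Real.sin (dot k (pos x))) *
          spinWave N fun x : Box d ℓ => Real.sin (dot k (pos x)))).trace.re =
    Fintype.card (Box d ℓ) * ∑ z : Box d ℓ, Real.cos (dot k (pos z)) *
      twoPoint (-(β : ℂ) • hamiltonian ℓ N J) 2 0 z := by
  rw [trace_exp_mul_spinWave_sq, trace_exp_mul_spinWave_sq, ← Finset.sum_add_distrib]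
  simp only [← Finset.sum_add_distrib, ← add_mul]
  refine sum_sum_eq_card_mul _ _ fun x z => ?_
  rw [← twoPoint_add N J β 2 x z, ← cos_pos_sub hk, sub_add_cancel_left, cos_pos_neg hk]
  rfl

theorem sum_doubleComm_spinWave (hk : k ∈ dualBox d ℓ) (hJ : ∀ i x, J i (-x) = J i x) :
    doubleComm (-(β : ℂ) • hamiltonian ℓ N J)
        (spinWave N fun x : Box d ℓ => Real.cos (dot k (pos x))) +
      doubleComm (-(β : ℂ) • hamiltonian ℓ N J)
        (spinWave N fun x : Box d ℓ => Real.sin (dot k (pos x))) =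
    Fintype.card (Box d ℓ) * ∑ z : Box d ℓ, 2 * β *
      ((periodise ℓ (J 0) (pos z) - periodise ℓ (J 1) (pos z) * Real.cos (dot k (pos z))) *
          twoPoint (-(β : ℂ) • hamiltonian ℓ N J) 0 0 z +
        (periodise ℓ (J 1) (pos z) - periodise ℓ (J 0) (pos z) * Real.cos (dot k (pos z))) *
          twoPoint (-(β : ℂ) • hamiltonian ℓ N J) 1 0 z) := by
  rw [doubleComm_spinWave N _ (neg_smul_hamiltonian N J β),
    doubleComm_spinWave N _ (neg_smul_hamiltonian N J β), ← Finset.sum_add_distrib]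
  simp only [← Finset.sum_add_distrib]
  refine sum_sum_eq_card_mul _ _ fun x z => ?_
  rw [← twoPoint_add N J β 0 x z, ← twoPoint_add N J β 1 x z]
  have hP : ∀ i, torusKernel ℓ J β i x (x + z) = β * periodise ℓ (J i) (pos z) := by
    intro i
    rw [torusKernel, periodise_pos_sub, sub_add_cancel_left, periodise_pos_neg (hJ i)]
  have hc : Real.cos (dot k (pos z)) = Real.cos (dot k (pos x)) * Real.cos (dot k (pos (x + z))) +
      Real.sin (dot k (pos x)) * Real.sin (dot k (pos (x + z))) := by
    rw [← cos_pos_sub hk, sub_add_cancel_left, cos_pos_neg hk]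
  have h1 := Real.sin_sq_add_cos_sq (dot k (pos x))
  have h2 := Real.sin_sq_add_cos_sq (dot k (pos (x + z)))
  rw [hP, hP, hc]
  simp only [twoPoint]
  linear_combination
    (h1 + h2) * (β * (periodise ℓ (J 0) (pos z) *
      (NormedSpace.exp (-(β : ℂ) • hamiltonian ℓ N J) * (siteOp (spinMatrix N 0) x *
        siteOp (spinMatrix N 0) (x + z))).trace.re +
      periodise ℓ (J 1) (pos z) *
      (NormedSpace.exp (-(β : ℂ) • hamiltonian ℓ N J) * (siteOp (spinMatrix N 1) x *
        siteOp (spinMatrix N 1) (x + z))).trace.re))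

theorem sqrt_infrared {n Z b e E : ℝ} (hn : 0 < n) (hZ : 0 < Z) (hb : 0 < b) (he : 0 < e) :
    √(n * Z / (2 * (b * e)) * (n * Z * (4 * b * E))) / 2 = n * Z * √(E / (2 * e)) := by
  have h1 : n * Z / (2 * (b * e)) * (n * Z * (4 * b * E)) =
      (2 * (n * Z)) ^ 2 * (E / (2 * e)) := by
    field_simp
    ring
  rw [h1, Real.sqrt_mul (sq_nonneg _), Real.sqrt_sq (by positivity)]
  ring

/-- The infrared bound for the real-valued correlation functions. -/
theorem infrared_bound {h : ℕ} (hℓ : ℓ = h + h) (hβ : 0 < β)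
    (hG : ∀ i, GoodCoupling (spinSign i • J i)) (hk : k ∈ dualBox d ℓ) (heps : 0 < eps ℓ J k)
    (C : Fin 3 → Box d ℓ → ℝ)
    (hC : ∀ i x, C i x = twoPoint (-(β : ℂ) • hamiltonian ℓ N J) i 0 x /
      (NormedSpace.exp (-(β : ℂ) • hamiltonian (d := d) ℓ N J)).trace.re) {E : ℝ}
    (hE : E = 1 / 2 * ∑ x : Box d ℓ,
      ((periodise ℓ (J 0) (pos x) - periodise ℓ (J 1) (pos x) * Real.cos (dot k (pos x))) * C 0 x +
        (periodise ℓ (J 1) (pos x) - periodise ℓ (J 0) (pos x) * Real.cos (dot k (pos x))) *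
          C 1 x)) :
    0 ≤ E ∧ ∑ x : Box d ℓ, Real.cos (dot k (pos x)) * C 2 x ≤
      √(E / (2 * eps ℓ J k)) + 1 / (2 * β * eps ℓ J k) := by
  have heven : ∀ i x, J i (-x) = J i x := by
    intro i x
    have h1 := (hG i).even x
    have h2 : spinSign i ≠ 0 := by unfold spinSign; split_ifs <;> norm_num
    exact mul_left_cancel₀ h2 h1
  set X := -(β : ℂ) • hamiltonian (d := d) ℓ N J with hX
  have hXh : X.IsHermitian := isHermitian_neg_smul_hamiltonian N J β heven
  set Z := (NormedSpace.exp X).trace.re with hZ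
  have hZpos : 0 < Z := trace_exp_re_pos hXh
  set n : ℝ := (Fintype.card (Box d ℓ) : ℝ) with hn
  have hnpos : 0 < n := by rw [hn]; exact_mod_cast Fintype.card_pos
  set ε := eps ℓ J k with hε
  let v : Bool → Box d ℓ → ℝ := fun b x =>
    if b then Real.cos (dot k (pos x)) else Real.sin (dot k (pos x))
  have hv : ∀ b x, ∑ y, periodise ℓ (J 2) (pos x - pos y) * (v b x - v b y) = ε * v b x := by
    intro b x
    cases b
    · exact laplacian_sin (heven 2) hk x
    · exact laplacian_cos (heven 2) hk x
  obtain ⟨hpos, hle⟩ := falk_bruch X hXh (fun b => spinWave N (v b))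
    (fun b => isHermitian_spinWave N (v b)) (fun b => (∑ x, v b x ^ 2) / (4 * (β * ε)))
    fun b t => trace_exp_add_spinWave_le N J β hℓ hβ hG heps (hv b) t
  rw [Fintype.sum_bool, Fintype.sum_bool, Fintype.sum_bool] at hle
  have hD : doubleComm X (spinWave N (v true)) + doubleComm X (spinWave N (v false)) =
      n * Z * (4 * β * E) := by
    refine (sum_doubleComm_spinWave N hk heven).trans ?_
    rw [hE, mul_assoc n Z]
    refine congrArg (n * ·) ?_
    have h1 : ∀ S : ℝ, Z * (4 * β * (1 / 2 * S)) = 2 * β * Z * S := fun S => by ring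
    rw [h1, Finset.mul_sum]
    refine Finset.sum_congr rfl fun z _ => ?_
    rw [hC, hC]
    field_simp
    ring
  have hT : (NormedSpace.exp X * (spinWave N (v true) * spinWave N (v true))).trace.re +
      (NormedSpace.exp X * (spinWave N (v false) * spinWave N (v false))).trace.re =
      n * Z * ∑ x : Box d ℓ, Real.cos (dot k (pos x)) * C 2 x := by
    refine (sum_trace_exp_mul_spinWave_sq N hk).trans ?_
    rw [mul_assoc, ← hn, Finset.mul_sum _ _ Z]
    congr 1
    refine Finset.sum_congr rfl fun z _ => ?_
    rw [hC]
    field_simp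
    rfl
  have hc : 2 * ((∑ x, v true x ^ 2) / (4 * (β * ε))) * Z +
      2 * ((∑ x, v false x ^ 2) / (4 * (β * ε))) * Z = n * Z / (2 * (β * ε)) := by
    have h1 : (∑ x, v true x ^ 2) + ∑ x, v false x ^ 2 = n := by
      rw [← Finset.sum_add_distrib]
      have : ∀ x, v true x ^ 2 + v false x ^ 2 = 1 := fun x => Real.cos_sq_add_sin_sq _
      simp only [this, Finset.sum_const, Finset.card_univ, nsmul_eq_mul, mul_one, hn]
    have h2 : 0 < β * ε := mul_pos hβ heps
    rw [← h1]
    field_simp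
    ring
  rw [hT, hc, hD, sqrt_infrared hnpos hZpos hβ heps] at hle
  have hnZ : 0 < n * Z := mul_pos hnpos hZpos
  constructor
  · have h1 := add_nonneg (hpos true) (hpos false)
    rw [hD] at h1
    have h2 : 0 < n * Z * (4 * β) := by positivity
    rw [← mul_assoc] at h1
    exact nonneg_of_mul_nonneg_right h1 h2
  · refine le_of_mul_le_mul_left ?_ hnZ
    refine hle.trans_eq ?_
    rw [mul_add]
    congr 1
    field_simp

theorem fourier_ofReal (C : Box d ℓ → ℝ) (hk : k ∈ dualBox d ℓ) (hC : ∀ x, C (-x) = C x) :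
    QSpin.fourier (fun x => (C x : ℂ)) k = ((∑ x, Real.cos (dot k (pos x)) * C x : ℝ) : ℂ) := by
  have h0 : ∑ x : Box d ℓ, Real.sin (dot k (pos x)) * C x = 0 :=
    sum_eq_zero_of_odd _ fun z => by rw [hC, sin_pos_neg hk, neg_mul]
  have h1 : QSpin.fourier (fun x => (C x : ℂ)) k =
      ((∑ x, Real.cos (dot k (pos x)) * C x : ℝ) : ℂ) -
        Complex.I * ((∑ x, Real.sin (dot k (pos x)) * C x : ℝ) : ℂ) := by
    rw [QSpin.fourier]
    push_cast
    rw [Finset.mul_sum, ← Finset.sum_sub_distrib]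
    refine Finset.sum_congr rfl fun x _ => ?_
    rw [show -Complex.I * (dot k (pos x) : ℂ) = (-(dot k (pos x) : ℂ)) * Complex.I by ring,
      Complex.exp_mul_I, Complex.cos_neg, Complex.sin_neg]
    ring
  rw [h1, h0]
  simp

end InfraredBound

end

theorem lemma4p4 (d ℓ N : ℕ) [NeZero ℓ] (hℓ : Even ℓ) (hN : 1 ≤ N)
    (J : Fin 3 → (Fin d → ℤ) → ℝ) (hJ : QSpin.Admissible J)
    (hJ3 : ∃ x : Fin d → ℤ, x ≠ 0 ∧ J 2 x ≠ 0)
    (β : ℝ) (hβ : 0 < β)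
    (k : Fin d → ℝ) (hk : k ∈ QSpin.dualBox d ℓ) (hk0 : k ≠ 0) :
    0 < QSpin.eps ℓ J k ∧
    (QSpin.eFun ℓ N J β k).im = 0 ∧
    0 ≤ (QSpin.eFun ℓ N J β k).re ∧
    (QSpin.fourier (QSpin.corr ℓ N J β 2) k).im = 0 ∧
    (QSpin.fourier (QSpin.corr ℓ N J β 2) k).re ≤
      Real.sqrt ((QSpin.eFun ℓ N J β k).re / (2 * QSpin.eps ℓ J k)) +
        1 / (2 * β * QSpin.eps ℓ J k) := by
  obtain ⟨h, hh⟩ := hℓ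
  have hℓ2 : 2 ≤ ℓ := by have := NeZero.pos ℓ; omega
  have hG : ∀ i, GoodCoupling (spinSign i • J i) := by
    intro i
    fin_cases i
    · simpa [spinSign] using GoodCoupling.of_mem_convexHull hJ.mem_one
    · simpa [spinSign] using GoodCoupling.of_mem_convexHull hJ.mem_two
    · simpa [spinSign] using GoodCoupling.of_mem_convexHull hJ.mem_three
  have heven : ∀ i x, J i (-x) = J i x := by
    intro i x
    have h2 : spinSign i ≠ 0 := by unfold spinSign; split_ifs <;> norm_num
    exact mul_left_cancel₀ h2 ((hG i).even x)
  have heps : 0 < QSpin.eps ℓ J k :=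
    eps_pos (GoodCoupling.of_mem_convexHull hJ.mem_three) hJ3 hℓ2 hk hk0
  set C : Fin 3 → QSpin.Box d ℓ → ℝ := fun i x =>
    twoPoint (-(β : ℂ) • QSpin.hamiltonian ℓ N J) i 0 x /
      (NormedSpace.exp (-(β : ℂ) • QSpin.hamiltonian (d := d) ℓ N J)).trace.re with hC
  have hcorr : ∀ i x, QSpin.corr ℓ N J β i x = (C i x : ℂ) := corr_eq N J β heven
  obtain ⟨hE, hle⟩ := infrared_bound N hh hβ hG hk heps C (fun _ _ => rfl) rfl
  have he : QSpin.eFun ℓ N J β k = ((1 / 2 * ∑ x : QSpin.Box d ℓ,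
      ((QSpin.periodise ℓ (J 0) (QSpin.pos x) - QSpin.periodise ℓ (J 1) (QSpin.pos x) *
          Real.cos (QSpin.dot k (QSpin.pos x))) * C 0 x +
        (QSpin.periodise ℓ (J 1) (QSpin.pos x) - QSpin.periodise ℓ (J 0) (QSpin.pos x) *
          Real.cos (QSpin.dot k (QSpin.pos x))) * C 1 x) : ℝ) : ℂ) := by
    rw [QSpin.eFun]
    simp only [hcorr]
    push_cast
    rfl
  have hf : QSpin.fourier (QSpin.corr ℓ N J β 2) k =
      ((∑ x, Real.cos (QSpin.dot k (QSpin.pos x)) * C 2 x : ℝ) : ℂ) := by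
    rw [funext (hcorr 2)]
    exact fourier_ofReal (C 2) hk fun x => by simp only [hC, twoPoint_neg]
  rw [he, hf, Complex.ofReal_im, Complex.ofReal_re, Complex.ofReal_im, Complex.ofReal_re]
  exact ⟨heps, rfl, hE, rfl, hle⟩
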